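/- Fix an even, non-negative function $\psi\in C_0^\infty((-2,2))$ with $\psi(r)=1$ for $|r|\le 1$, and put $\psi_1=\psi$ and $\psi_N(r)=\psi(r/N)-\psi(2r/N)$ for $N=2,4,8,\dots$. For a tempered distribution $u=u(t,x,y)$ on $\mathbb R\times\mathbb R^2$ with space-time Fourier transform $\widehat u(\tau,\xi,\eta)$ (normalized so that $\partial_t,\partial_x,\partial_y$ correspond to $i\tau,i\xi,i\eta$) and for dyadic $N,L\in\{1,2,4,\dots\}$ define $P_N$ and $Q_L$ by $$\widehat{P_Nu}=\psi_N(|(\xi,\eta)|)\,\widehat u,\qquad \widehat{Q_Lu}=\psi_L(\tau-\xi^3-\eta^3)\,\widehat u .$$ For $s,b\in\mathbb R$ let $$\|u\|_{X^{s,b}}=\Bigl(\sum_{N,L}N^{2s}L^{2b}\,\|P_NQ_Lu\|_{L^2(\mathbb R^3)}^2\Bigr)^{1/2},$$ where $N,L$ run over $\{1,2,4,\dots\}$ and the $L^2$ norm of a distribution that is not in $L^2$ is $\infty$, and let $X^{s,b}=\{u\in\mathcal S'(\mathbb R^3):\|u\|_{X^{s,b}}<\infty\}$. **Theorem.** For every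 $s\ge 1/4$ there exist $b\in(1/2,1)$, $\varepsilon>0$ and $C>0$ such that for all complex-valued $u_1,u_2,u_3\in X^{s,b}$ the following holds: $u_1,u_2,u_3$ are locally integrable functions, their pointwise product $u_1u_2u_3$ is locally integrable and defines a tempered distribution (its product with every Schwartz function is integrable), and $$\|(\partial_x+\partial_y)(u_1u_2u_3)\|_{X^{s,\,b-1+\varepsilon}}\le C\prod_{i=1}^3\|u_i\|_{X^{s,b}} .$$ -/

import Mathlib

open MeasureTheory TemperedDistribution LineDeriv
open scoped SchwartzMap ENNReal ContDiff

noncomputable section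

namespace MZK

/-- Space-time `ℝ × ℝ²`; the coordinates `0, 1, 2` are `t, x, y` on the physical side and
`τ, ξ, η` on the frequency side. -/
abbrev SpaceTime : Type := EuclideanSpace ℝ (Fin 3)

/-- `ψ ∈ C_0^∞((-2,2))` is even, non-negative, and equal to `1` on `[-1,1]`. -/
structure IsCutoff (ψ : ℝ → ℝ) : Prop where
  contDiff : ContDiff ℝ ∞ ψ
  tsupport_subset : tsupport ψ ⊆ Set.Ioo (-2) 2
  even : ∀ r, ψ (-r) = ψ r
  nonneg : ∀ r, 0 ≤ ψ r
  eq_one : ∀ r, |r| ≤ 1 → ψ r = 1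

/-- The inhomogeneous dyadic partition of unity: `dyadic ψ n` is `ψ_N` for `N = 2 ^ n`, that is
`ψ_1 = ψ` and `ψ_N(r) = ψ(r / N) - ψ(2 r / N)` for `N = 2, 4, 8, …`. -/
def dyadic (ψ : ℝ → ℝ) : ℕ → ℝ → ℝ
  | 0 => ψ
  | n + 1 => fun r => ψ (r / 2 ^ (n + 1)) - ψ (2 * r / 2 ^ (n + 1))

/-- The frequency symbol `ψ_N(|(ξ, η)|)`. Mathlib's Fourier transform has the kernel
`exp(-2πi⟨z, ζ⟩)`, so that `(τ, ξ, η) = 2π ζ`, where `(τ, ξ, η)` are the frequencies for which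
`∂_t, ∂_x, ∂_y` correspond to `iτ, iξ, iη`. -/
def freqSymbol (ψ : ℝ → ℝ) (n : ℕ) (ζ : SpaceTime) : ℂ :=
  (dyadic ψ n (Real.sqrt ((2 * Real.pi * ζ 1) ^ 2 + (2 * Real.pi * ζ 2) ^ 2)) : ℝ)

/-- The modulation symbol `ψ_L(τ - ξ³ - η³)`, with `(τ, ξ, η) = 2π ζ`. -/
def modSymbol (ψ : ℝ → ℝ) (l : ℕ) (ζ : SpaceTime) : ℂ :=
  (dyadic ψ l (2 * Real.pi * ζ 0 - (2 * Real.pi * ζ 1) ^ 3 - (2 * Real.pi * ζ 2) ^ 3) : ℝ)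

/-- The frequency projection `P_N`, `N = 2 ^ n`, on tempered distributions. -/
def projP (ψ : ℝ → ℝ) (n : ℕ) : 𝓢'(SpaceTime, ℂ) →L[ℂ] 𝓢'(SpaceTime, ℂ) :=
  fourierMultiplierCLM ℂ (freqSymbol ψ n)

/-- The modulation projection `Q_L`, `L = 2 ^ l`, on tempered distributions. -/
def projQ (ψ : ℝ → ℝ) (l : ℕ) : 𝓢'(SpaceTime, ℂ) →L[ℂ] 𝓢'(SpaceTime, ℂ) :=
  fourierMultiplierCLM ℂ (modSymbol ψ l)

/-- The `L²(ℝ³)` norm of a tempered distribution: the norm of the (unique) `L²` function that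
represents it, and `∞` if there is none. -/
def l2Norm (u : 𝓢'(SpaceTime, ℂ)) : ℝ≥0∞ :=
  ⨅ (g : Lp ℂ 2 (volume : Measure SpaceTime)) (_ : (g : 𝓢'(SpaceTime, ℂ)) = u), ‖g‖ₑ

/-- `‖u‖_{X^{s,b}} = (∑_{N,L} N^{2s} L^{2b} ‖P_N Q_L u‖²_{L²})^{1/2}`, with `N = 2 ^ n` and
`L = 2 ^ l` for `n, l = 0, 1, 2, …`. -/
def xNorm (ψ : ℝ → ℝ) (s b : ℝ) (u : 𝓢'(SpaceTime, ℂ)) : ℝ≥0∞ :=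
  (∑' (n : ℕ) (l : ℕ), ((2 : ℝ≥0∞) ^ n) ^ (2 * s) * ((2 : ℝ≥0∞) ^ l) ^ (2 * b) *
    l2Norm (projP ψ n (projQ ψ l u)) ^ 2) ^ (1 / 2 : ℝ)

/-- The space `X^{s,b}` of the tempered distributions with finite `X^{s,b}` norm. -/
def xSpace (ψ : ℝ → ℝ) (s b : ℝ) : Set 𝓢'(SpaceTime, ℂ) :=
  {u | xNorm ψ s b u < ⊤}

/-- The operator `∂_x + ∂_y` on tempered distributions. -/
def dxAddDy (u : 𝓢'(SpaceTime, ℂ)) : 𝓢'(SpaceTime, ℂ) :=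
  lineDerivOp (EuclideanSpace.single 1 1 : SpaceTime) u +
    lineDerivOp (EuclideanSpace.single 2 1 : SpaceTime) u

/-- The tempered distribution `u` is the locally integrable function `f`. -/
def IsFunction (u : 𝓢'(SpaceTime, ℂ)) (f : SpaceTime → ℂ) : Prop :=
  LocallyIntegrable f volume ∧
    ∀ φ : 𝓢(SpaceTime, ℂ), Integrable (fun z => φ z * f z) volume ∧ u φ = ∫ z, φ z * f z

/-- `w` is the pointwise product `u₁ u₂ u₃`: each `uᵢ` is a locally integrable function `fᵢ`, and
the function `f₁ f₂ f₃` is locally integrable and defines the tempered distribution `w`. -/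
def IsProduct (u₁ u₂ u₃ w : 𝓢'(SpaceTime, ℂ)) : Prop :=
  ∃ f₁ f₂ f₃ : SpaceTime → ℂ, IsFunction u₁ f₁ ∧ IsFunction u₂ f₂ ∧ IsFunction u₃ f₃ ∧
    IsFunction w (fun z => f₁ z * f₂ z * f₃ z)

/-! The symbols are of temperate growth, so that the projections are not junk values, and the
product of three tempered distributions is unique. -/

theorem IsCutoff.hasCompactSupport {ψ : ℝ → ℝ} (h : IsCutoff ψ) : HasCompactSupport ψ :=
  HasCompactSupport.of_support_subset_isCompact isCompact_Icc
    ((subset_tsupport ψ).trans (h.tsupport_subset.trans Set.Ioo_subset_Icc_self))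

theorem temperate_dyadic {g : ℝ → ℝ}
    (h : ∀ c : ℝ, 0 < c → Function.HasTemperateGrowth fun y => g (c * y)) (n : ℕ) :
    Function.HasTemperateGrowth (dyadic g n) := by
  cases n with
  | zero => simpa [dyadic] using h 1 one_pos
  | succ n =>
    have h1 := h (1 / 2 ^ (n + 1)) (by positivity)
    have h2 := h (2 / 2 ^ (n + 1)) (by positivity)
    convert h1.sub h2 using 1
    funext r
    simp only [dyadic, Pi.sub_apply]
    congr 2 <;> ring

theorem IsCutoff.temperate_comp_mul {ψ : ℝ → ℝ} (h : IsCutoff ψ) (c : ℝ) :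
    Function.HasTemperateGrowth fun y => ψ (c * y) := by
  have h1 := h.hasCompactSupport.hasTemperateGrowth h.contDiff
  have h2 : Function.HasTemperateGrowth fun y : ℝ => c * y := by fun_prop
  exact h1.comp h2

theorem temperate_coord (i : Fin 3) : Function.HasTemperateGrowth fun ζ : SpaceTime => ζ i :=
  (EuclideanSpace.proj i : SpaceTime →L[ℝ] ℝ).hasTemperateGrowth

theorem IsCutoff.temperate_modSymbol {ψ : ℝ → ℝ} (h : IsCutoff ψ) (l : ℕ) :
    Function.HasTemperateGrowth (modSymbol ψ l) := by
  have h1 := temperate_dyadic (fun c _ => h.temperate_comp_mul c) l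
  have t0 := temperate_coord 0
  have t1 := temperate_coord 1
  have t2 := temperate_coord 2
  have h2 : Function.HasTemperateGrowth fun ζ : SpaceTime =>
      2 * Real.pi * ζ 0 - (2 * Real.pi * ζ 1) ^ 3 - (2 * Real.pi * ζ 2) ^ 3 := by fun_prop
  exact Function.Complex.hasTemperateGrowth_ofReal.comp (h1.comp h2)

theorem IsCutoff.temperate_sqrt {ψ : ℝ → ℝ} (h : IsCutoff ψ) (c : ℝ) (hc : 0 < c) :
    Function.HasTemperateGrowth fun y : ℝ => ψ (c * Real.sqrt |y|) := by
  apply HasCompactSupport.hasTemperateGrowth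
  · apply HasCompactSupport.of_support_subset_isCompact
      (isCompact_Icc (a := -(2 / c) ^ 2) (b := (2 / c) ^ 2))
    intro y hy
    have h1 := (h.tsupport_subset (subset_tsupport ψ hy)).2
    have h2 : Real.sqrt |y| < 2 / c := by rw [lt_div_iff₀ hc]; linarith
    have h3 : |y| ≤ (2 / c) ^ 2 := (Real.sqrt_le_left (by positivity)).1 h2.le
    exact abs_le.1 h3
  · rw [contDiff_iff_contDiffAt]
    intro y
    rcases eq_or_ne y 0 with rfl | hy
    · have : (fun y : ℝ => ψ (c * Real.sqrt |y|)) =ᶠ[nhds 0] fun _ => 1 := by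
        have hcont : Continuous fun y : ℝ => |c * Real.sqrt (abs y)| := by fun_prop
        have : ∀ᶠ y in nhds (0 : ℝ), |c * Real.sqrt (abs y)| < 1 :=
          hcont.continuousAt.eventually_lt continuousAt_const (by simp)
        filter_upwards [this] with y hy
        exact h.eq_one _ hy.le
      exact contDiffAt_const.congr_of_eventuallyEq this
    · exact h.contDiff.contDiffAt.comp y
        (contDiffAt_const.mul ((contDiffAt_abs hy).sqrt (abs_ne_zero.2 hy)))

theorem IsCutoff.temperate_freqSymbol {ψ : ℝ → ℝ} (h : IsCutoff ψ) (n : ℕ) :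
    Function.HasTemperateGrowth (freqSymbol ψ n) := by
  have h1 : Function.HasTemperateGrowth fun y : ℝ => dyadic ψ n (Real.sqrt |y|) := by
    cases n with
    | zero => simpa [dyadic] using h.temperate_sqrt 1 one_pos
    | succ n =>
      have h1 := h.temperate_sqrt (1 / 2 ^ (n + 1)) (by positivity)
      have h2 := h.temperate_sqrt (2 / 2 ^ (n + 1)) (by positivity)
      convert h1.sub h2 using 1
      funext r
      simp only [dyadic, Pi.sub_apply]
      congr 2 <;> ring
  have t1 := temperate_coord 1
  have t2 := temperate_coord 2
  have h2 : Function.HasTemperateGrowth fun ζ : SpaceTime =>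
      (2 * Real.pi * ζ 1) ^ 2 + (2 * Real.pi * ζ 2) ^ 2 := by fun_prop
  have h3 : freqSymbol ψ n = Complex.ofReal ∘ (fun y : ℝ => dyadic ψ n (Real.sqrt |y|)) ∘
      fun ζ : SpaceTime => (2 * Real.pi * ζ 1) ^ 2 + (2 * Real.pi * ζ 2) ^ 2 := by
    funext ζ
    simp only [freqSymbol, Function.comp]
    rw [abs_of_nonneg (by positivity)]
  rw [h3]
  exact Function.Complex.hasTemperateGrowth_ofReal.comp (h1.comp h2)

theorem IsFunction.ae_eq {u : 𝓢'(SpaceTime, ℂ)} {f g : SpaceTime → ℂ} (hf : IsFunction u f)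
    (hg : IsFunction u g) : f =ᵐ[volume] g := by
  refine ae_eq_of_integral_contDiff_smul_eq hf.1 hg.1 fun φ h1 h2 => ?_
  have h3 : HasCompactSupport (Complex.ofRealCLM ∘ φ) := h2.comp_left rfl
  have h4 : ContDiff ℝ ∞ (Complex.ofRealCLM ∘ φ) := by fun_prop
  have h5 := (hf.2 (h3.toSchwartzMap h4)).2.symm.trans (hg.2 (h3.toSchwartzMap h4)).2
  simpa using h5

theorem IsProduct.unique {u₁ u₂ u₃ w w' : 𝓢'(SpaceTime, ℂ)} (h : IsProduct u₁ u₂ u₃ w)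
    (h' : IsProduct u₁ u₂ u₃ w') : w = w' := by
  obtain ⟨f₁, f₂, f₃, a1, a2, a3, a⟩ := h
  obtain ⟨g₁, g₂, g₃, b1, b2, b3, b⟩ := h'
  ext φ
  rw [(a.2 φ).2, (b.2 φ).2]
  apply integral_congr_ae
  filter_upwards [a1.ae_eq b1, a2.ae_eq b2, a3.ae_eq b3] with z e1 e2 e3
  rw [e1, e2, e3]

end MZK

end

/-!
Write `n = max (1, |ξ|, |η|)` for the size of a frequency and `σ = τ - ξ³ - η³` for the modulation.
The theorem holds with `b = 33/64` and `ε = 1/64`, so that the output is measured with the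
modulation exponent `b - 1 + ε = -15/32`.

For `s, b > 0` the elements of `X^{s,b}` are square integrable functions
(`IsCutoff.exists_lp_of_mem_xSpace`), and for every distribution whose Fourier transform is a
function, the `X^{s,b}` norm is comparable to the `L²` norm of that transform with the weight
`n ^ s (1 + |σ|) ^ b` (`IsCutoff.exists_xNorm_comparable`). The problem thereby becomes one about
convolutions of non-negative functions in weighted `L²` spaces.

Everything rests on one bilinear estimate (`exists_nrm_cnv_le`),

  `‖u v‖_{L²} ≲ ‖u‖_{X^{1/4, 33/64}} ‖v‖_{X^{-1/2, 15/32}}`.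

It is used twice for the trilinear estimate. The output carries the weight `n ^ (s + 1)`, one power
of `n` coming from the derivative. Since `n` is subadditive, `n ^ (s + 1/2)` may, up to a constant, be
moved to one of the three factors, say `u₂`, which is then controlled in `X^{-1/2, b}`. The
remaining `n ^ (1/2) (1 + |σ|) ^ (-15/32)` is moved by duality to a test function `h ∈ L²`, which
then lies in `X^{-1/2, 15/32}`. The integral of `u₁ u₂ u₃ h` is bounded by
`‖u₁ u₂‖_{L²} ‖u₃ h‖_{L²}`, and the bilinear estimate applies to both products
(`exists_nrm_cnv_cnv_le`, `exists_trilinear`); this is where `s ≥ 1/4` enters. The same estimate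
shows that `u₁ u₂` is square integrable, so that `u₁ u₂ u₃` is integrable, and its Fourier transform
is the convolution of the three transforms (`fourier_mul_eq_integral`, `enorm_fourier_mul_mul_le`).

For the bilinear estimate, the Cauchy-Schwarz inequality on the fibers over the output frequency
`(τ, ξ, η)` and the integration in `τ₁` leave a bound, uniform in `c`, `ξ` and `η`, for the integral
over `(ξ₁, η₁)` of `n₁ ^ (-1/2) n₂` times the weight

  `(1 + |c - 3 ξ (ξ₁ - ξ / 2) ^ 2 - 3 η (η₁ - η / 2) ^ 2|) ^ (-15/16)`

(`exists_triBound_freqKernel`). Up to an exchange of `ξ` and `η`, the largest component `m > 1` of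
the two inputs is in the direction `η`. If `|η₁² - η₂²| ≳ m²`, the derivative of the quadratic
polynomial in `η₁` has size `m²`, and the integral in `η₁` leaves a function which is integrable in
`ξ₁` (`exists_triBound_transversal`). Otherwise `|η₁|` and `|η₂|` are both comparable to `m`, and
the weight `n₁ ^ (-1/2) n₂` has size `m ^ (1/2)`. Then `ξ₁` and, where necessary, `η₁` are localized
to intervals of the lengths given by the output frequency, and `|η₁|` to a dyadic scale, which costs
no more than a constant because the pieces of the inputs interact almost orthogonally. The output
frequency itself is decomposed dyadically: in `|ξ|` if `|η|` is comparable to `m`, where the integral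
in `η₁` gains `|η| ^ (-1/2)` (`exists_triBound_parallel_large`), and in `|ξ|` and `|η| m ^ (1/2)` if
`|η|` is small (`exists_triBound_parallel_small`). Integrating first in one variable and then in the
other gives decay in the dyadic scales, so that the pieces can be summed.
-/

open scoped NNReal

noncomputable section

namespace MZK

/-! ### Weights and integrals on the line -/

/-- The singular weight `|x| ^ (-μ)`, equal to `∞` at `x = 0` when `μ > 0`. -/
def sing (μ x : ℝ) : ℝ≥0∞ := ENNReal.ofReal |x| ^ (-μ)

/-- The regular weight `(1 + |x|) ^ (-μ)`. -/
def brk (μ x : ℝ) : ℝ≥0∞ := ENNReal.ofReal ((1 + |x|) ^ (-μ))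

theorem measurable_sing (μ : ℝ) : Measurable (sing μ) := by
  unfold sing; fun_prop

theorem measurable_brk (μ : ℝ) : Measurable (brk μ) := by
  unfold brk; fun_prop

theorem sing_of_ne {μ x : ℝ} (hx : x ≠ 0) : sing μ x = ENNReal.ofReal (|x| ^ (-μ)) := by
  rw [sing, ENNReal.ofReal_rpow_of_pos (abs_pos.2 hx)]

theorem sing_zero {μ : ℝ} (hμ : 0 < μ) : sing μ 0 = ⊤ := by
  simp [sing, ENNReal.zero_rpow_of_neg (neg_lt_zero.2 hμ)]

theorem sing_mul {μ a : ℝ} (ha : a ≠ 0) (x : ℝ) :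
    sing μ (a * x) = ENNReal.ofReal (|a| ^ (-μ)) * sing μ x := by
  have h0 : ENNReal.ofReal |a| ≠ 0 := by simpa using ha
  rw [sing, abs_mul, ENNReal.ofReal_mul (abs_nonneg a), ← ENNReal.ofReal_rpow_of_pos (abs_pos.2 ha),
    sing]
  rw [ENNReal.mul_rpow_eq_ite, if_neg]
  rintro ⟨h | h, h'⟩
  · exact h0 h.1
  · exact ENNReal.ofReal_ne_top h.1

theorem sing_anti {μ x y : ℝ} (hμ : 0 ≤ μ) (h : |x| ≤ |y|) : sing μ y ≤ sing μ x := by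
  rw [sing, sing, ENNReal.rpow_neg, ENNReal.rpow_neg]
  exact ENNReal.inv_le_inv.2 (ENNReal.rpow_le_rpow (ENNReal.ofReal_le_ofReal h) hμ)

theorem sing_le_mul {μ x y t : ℝ} (hμ : 0 ≤ μ) (ht : 0 < t) (h : t * |x| ≤ |y|) :
    sing μ y ≤ ENNReal.ofReal (t ^ (-μ)) * sing μ x := by
  have := sing_mul (μ := μ) ht.ne' x
  rw [abs_of_pos ht] at this
  rw [← this]
  exact sing_anti hμ (by rwa [abs_mul, abs_of_pos ht])

theorem brk_le_one {μ : ℝ} (hμ : 0 ≤ μ) (x : ℝ) : brk μ x ≤ 1 := by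
  rw [brk, ← ENNReal.ofReal_one]
  exact ENNReal.ofReal_le_ofReal
    (Real.rpow_le_one_of_one_le_of_nonpos (by linarith [abs_nonneg x]) (by linarith))

theorem brk_le_sing {μ : ℝ} (hμ : 0 ≤ μ) (x : ℝ) : brk μ x ≤ sing μ x := by
  rcases hμ.eq_or_lt with rfl | hμ'
  · simp [brk, sing]
  rcases eq_or_ne x 0 with rfl | hx
  · simp [sing_zero hμ']
  rw [brk, sing_of_ne hx]
  exact ENNReal.ofReal_le_ofReal
    (Real.rpow_le_rpow_of_nonpos (abs_pos.2 hx) (by linarith) (by linarith))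

theorem brk_mul_brk (μ ν x : ℝ) : brk μ x * brk ν x = brk (μ + ν) x := by
  rw [brk, brk, brk, ← ENNReal.ofReal_mul (by positivity), ← Real.rpow_add (by positivity), neg_add]

theorem brk_anti {μ x y : ℝ} (hμ : 0 ≤ μ) (h : |x| ≤ |y|) : brk μ y ≤ brk μ x :=
  ENNReal.ofReal_le_ofReal
    (Real.rpow_le_rpow_of_nonpos (by positivity) (by linarith) (by linarith))

theorem lintegral_abs_le (g : ℝ → ℝ≥0∞) :
    ∫⁻ x, g |x| ≤ 2 * ∫⁻ x in Set.Ioi 0, g x := by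
  have h1 : ∫⁻ x in Set.Ioi (0 : ℝ), g |x| = ∫⁻ x in Set.Ioi 0, g x :=
    setLIntegral_congr_fun measurableSet_Ioi fun x hx => by rw [abs_of_pos hx]
  have h2 : ∫⁻ x in Set.Iio (0 : ℝ), g |x| = ∫⁻ x in Set.Ioi 0, g x := by
    rw [← h1]
    have := (Measure.measurePreserving_neg (volume : Measure ℝ)).setLIntegral_comp_preimage_emb
      (MeasurableEquiv.neg ℝ).measurableEmbedding (fun x => g |x|) (Set.Ioi 0)
    simpa using this
  have h3 : ∫⁻ x, g |x| = ∫⁻ x in Set.Iio (0 : ℝ) ∪ Set.Ioi 0, g |x| := by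
    rw [Set.Iio_union_Ioi, MeasureTheory.restrict_compl_singleton]
  calc ∫⁻ x, g |x| ≤ (∫⁻ x in Set.Iio (0 : ℝ), g |x|) + ∫⁻ x in Set.Ioi (0 : ℝ), g |x| := by
        rw [h3]; exact lintegral_union_le _ _ _
    _ = _ := by rw [h1, h2, two_mul]

theorem lintegral_rpow_Ioc {μ ℓ : ℝ} (hμ : μ < 1) (hℓ : 0 < ℓ) :
    ∫⁻ x in Set.Ioc 0 ℓ, ENNReal.ofReal (x ^ (-μ)) =
      ENNReal.ofReal (1 / (1 - μ)) * ENNReal.ofReal (ℓ ^ (1 - μ)) := by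
  have hi : IntervalIntegrable (fun x : ℝ => x ^ (-μ)) volume 0 ℓ :=
    intervalIntegral.intervalIntegrable_rpow' (by linarith)
  rw [← ofReal_integral_eq_lintegral_ofReal, ← intervalIntegral.integral_of_le hℓ.le,
    integral_rpow (Or.inl (by linarith)), ← ENNReal.ofReal_mul (by
      rw [one_div]; exact inv_nonneg.2 (by linarith))]
  · congr 1
    rw [Real.zero_rpow (by linarith)]
    rw [show -μ + 1 = 1 - μ by ring]; ring
  · exact (intervalIntegrable_iff_integrableOn_Ioc_of_le hℓ.le).1 hi
  · filter_upwards [ae_restrict_mem measurableSet_Ioc] with x hx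
    exact Real.rpow_nonneg hx.1.le _

theorem lintegral_rpow_Ioi {a ℓ : ℝ} (ha : 1 < a) (hℓ : 0 < ℓ) :
    ∫⁻ x in Set.Ioi ℓ, ENNReal.ofReal (x ^ (-a)) =
      ENNReal.ofReal (1 / (a - 1)) * ENNReal.ofReal (ℓ ^ (1 - a)) := by
  have hi := integrableOn_Ioi_rpow_of_lt (a := -a) (by linarith) hℓ
  rw [← ofReal_integral_eq_lintegral_ofReal hi, integral_Ioi_rpow_of_lt (by linarith) hℓ,
    ← ENNReal.ofReal_mul (by rw [one_div]; exact inv_nonneg.2 (by linarith))]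
  · congr 1
    rw [show -a + 1 = 1 - a by ring, show (1 - a) = -(a - 1) by ring, neg_div_neg_eq]
    ring
  · filter_upwards [ae_restrict_mem measurableSet_Ioi] with x hx
    exact Real.rpow_nonneg (hℓ.trans hx).le _

/-- Splitting a radial integral at the radius `ℓ`, with an integrable power on either side. -/
theorem lintegral_radial_le {μ a ℓ : ℝ} (hμ : μ < 1) (ha : 1 < a) (hℓ : 0 < ℓ)
    {g : ℝ → ℝ≥0∞} {c₁ c₂ : ℝ≥0∞}
    (h₁ : ∀ x, 0 < x → x ≤ ℓ → g x ≤ c₁ * ENNReal.ofReal (x ^ (-μ)))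
    (h₂ : ∀ x, ℓ < x → g x ≤ c₂ * ENNReal.ofReal (x ^ (-a))) :
    ∫⁻ x, g |x| ≤ 2 * (c₁ * (ENNReal.ofReal (1 / (1 - μ)) * ENNReal.ofReal (ℓ ^ (1 - μ))) +
      c₂ * (ENNReal.ofReal (1 / (a - 1)) * ENNReal.ofReal (ℓ ^ (1 - a)))) := by
  refine (lintegral_abs_le g).trans ?_
  gcongr
  rw [← Set.Ioc_union_Ioi_eq_Ioi hℓ.le]
  refine (lintegral_union_le _ _ _).trans (add_le_add ?_ ?_)
  · rw [← lintegral_rpow_Ioc hμ hℓ, ← lintegral_const_mul _ (by fun_prop)]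
    exact setLIntegral_mono' measurableSet_Ioc fun x hx => h₁ x hx.1 hx.2
  · rw [← lintegral_rpow_Ioi ha hℓ, ← lintegral_const_mul _ (by fun_prop)]
    exact setLIntegral_mono' measurableSet_Ioi fun x hx => h₂ x hx

/-- The folded integral of a radial function is at most twice its integral: `||q| - d|` is
`|q - d|` or `|q + d|`. -/
theorem lintegral_abs_sub_le {g : ℝ → ℝ≥0∞} (hg : Measurable g) (d : ℝ) :
    ∫⁻ q, g |(|q| - d)| ≤ 2 * ∫⁻ x, g |x| := by
  calc ∫⁻ q, g |(|q| - d)| ≤ ∫⁻ q, (g |q - d| + g |q + d|) := by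
        refine lintegral_mono fun q => ?_
        rcases abs_cases q with ⟨h, -⟩ | ⟨h, -⟩
        · rw [h]; exact le_self_add
        · rw [h, show -q - d = -(q + d) by ring, abs_neg]; exact le_add_self
    _ = (∫⁻ q, g |q - d|) + ∫⁻ q, g |q + d| := lintegral_add_left (by fun_prop) _
    _ = _ := by
      rw [lintegral_sub_right_eq_self (fun x => g |x|) d,
        lintegral_add_right_eq_self (fun x => g |x|) d, two_mul]

/-- The quadratic polynomial `q² - D` is at least `(|q| - √|D|)(|q| + √|D|)` in size,
whatever the sign of `D`. -/
theorem abs_sq_sub_ge (q D : ℝ) :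
    |(|q| - √|D|)| * (|q| + √|D|) ≤ |q ^ 2 - D| := by
  have h1 : |(|q| - √|D|)| * (|q| + √|D|) = |q ^ 2 - (|D|)| := by
    rw [← abs_of_nonneg (by positivity : 0 ≤ |q| + √|D|)]
    rw [← abs_mul]
    congr 1
    have := Real.sq_sqrt (abs_nonneg D)
    have h2 := sq_abs q
    nlinarith
  rw [h1]
  rcases abs_cases D with ⟨h, -⟩ | ⟨h, h0⟩
  · rw [h]
  · rw [h, abs_le, abs_of_nonneg (by nlinarith : 0 ≤ q ^ 2 - D)]
    constructor <;> nlinarith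

/-- The bound `|B| ^ (-1/2)` is uniform in `D`: the quadratic polynomial grows at
least as fast near its zeros `±√D`, if there are any, as at the double zero of the case `D = 0`. -/
theorem exists_lintegral_brk_quadratic {κ : ℝ} (hκ : 1 / 2 < κ) :
    ∃ C : ℝ≥0, ∀ B D : ℝ, B ≠ 0 →
      ∫⁻ q, brk κ (B * (q ^ 2 - D)) ≤ C * ENNReal.ofReal (|B| ^ (-(1 / 2) : ℝ)) := by
  refine ⟨4 * (1 + (1 / (2 * κ - 1)).toNNReal), fun B D hB => ?_⟩
  have hB' := abs_pos.2 hB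
  set ℓ : ℝ := |B| ^ (-(1 / 2) : ℝ) with hℓ
  have hℓ0 : 0 < ℓ := by positivity
  have key := lintegral_radial_le (μ := 0) (a := 2 * κ) (ℓ := ℓ) (by norm_num) (by linarith) hℓ0
    (g := fun x => brk κ (B * x ^ 2)) (c₁ := 1) (c₂ := ENNReal.ofReal (|B| ^ (-κ)))
    (fun x _ _ => by simpa using brk_le_one (by linarith) _)
    (fun x hx => by
      have hx0 : 0 < x := hℓ0.trans hx
      refine (brk_le_sing (by linarith) _).trans ?_
      rw [sing_mul hB, sing_of_ne (by positivity), abs_of_pos (by positivity : 0 < x ^ 2),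
        ← Real.rpow_natCast, ← Real.rpow_mul hx0.le]
      norm_num)
  calc ∫⁻ q, brk κ (B * (q ^ 2 - D)) ≤ ∫⁻ q, brk κ (B * |(|q| - √|D|)| ^ 2) := by
        refine lintegral_mono fun q => brk_anti (by linarith) ?_
        rw [abs_mul, abs_mul]
        refine mul_le_mul_of_nonneg_left ?_ (abs_nonneg B)
        rw [abs_of_nonneg (sq_nonneg |(|q| - √|D|)|)]
        refine le_trans ?_ (abs_sq_sub_ge q D)
        rw [sq]
        gcongr
        rw [abs_le]
        constructor <;> linarith [abs_nonneg q, Real.sqrt_nonneg |D|]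
    _ ≤ 2 * ∫⁻ x, brk κ (B * |x| ^ 2) :=
        lintegral_abs_sub_le (g := fun x => brk κ (B * x ^ 2))
          ((measurable_brk κ).comp (by fun_prop)) _
    _ ≤ _ := by
        grw [key]
        have e1 : ENNReal.ofReal (|B| ^ (-κ)) * ENNReal.ofReal (ℓ ^ (1 - 2 * κ)) =
            ENNReal.ofReal ℓ := by
          rw [← ENNReal.ofReal_mul (by positivity), hℓ, ← Real.rpow_mul hB'.le,
            ← Real.rpow_add hB']
          congr 2; ring
        rw [mul_left_comm (ENNReal.ofReal (|B| ^ (-κ))), e1]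
        simp only [sub_zero, Real.rpow_one, ENNReal.ofReal_one, one_mul, div_one]
        push_cast
        simp only [ENNReal.ofReal]
        apply le_of_eq
        ring

/-- The singular weight scales to a power of `D`; it is integrable at the two simple zeros because
`κ < 1`, and at infinity because `2 κ > 1`. -/
theorem exists_lintegral_sing_quadratic {κ : ℝ} (hκ : 1 / 2 < κ) (hκ' : κ < 1) :
    ∃ C : ℝ≥0, ∀ D : ℝ, ∫⁻ q, sing κ (q ^ 2 - D) ≤ C * sing (κ - 1 / 2) D := by
  refine ⟨4 * ((1 / (1 - κ)).toNNReal + (1 / (2 * κ - 1)).toNNReal), fun D => ?_⟩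
  rcases eq_or_ne D 0 with rfl | hD
  · rw [sing_zero (by linarith), ENNReal.mul_top]
    · exact le_top
    · have : 0 < 1 / (1 - κ) := by rw [one_div]; exact inv_pos.2 (by linarith)
      have h2 : 0 < (1 / (1 - κ)).toNNReal := Real.toNNReal_pos.2 this
      exact_mod_cast (by positivity : 4 * ((1 / (1 - κ)).toNNReal + (1 / (2 * κ - 1)).toNNReal) ≠ 0)
  set d : ℝ := √|D| with hd
  have hd0 : 0 < d := Real.sqrt_pos.2 (abs_pos.2 hD)
  have key := lintegral_radial_le (μ := κ) (a := 2 * κ) (ℓ := d) hκ' (by linarith) hd0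
    (g := fun x => sing κ (x * max d x)) (c₁ := ENNReal.ofReal (d ^ (-κ))) (c₂ := 1)
    (fun x hx0 hx => by
      rw [max_eq_left hx, mul_comm, sing_mul hd0.ne', abs_of_pos hd0, sing_of_ne hx0.ne',
        abs_of_pos hx0])
    (fun x hx => by
      have hx0 : 0 < x := hd0.trans hx
      rw [max_eq_right hx.le, ← sq, sing_of_ne (by positivity), abs_of_pos (by positivity : 0 < x ^ 2),
        ← Real.rpow_natCast, ← Real.rpow_mul hx0.le]
      norm_num)
  calc ∫⁻ q, sing κ (q ^ 2 - D) ≤ ∫⁻ q, sing κ (|(|q| - d)| * max d |(|q| - d)|) := by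
        refine lintegral_mono fun q => sing_anti (by linarith) ?_
        refine le_trans ?_ (abs_sq_sub_ge q D)
        rw [abs_mul, abs_abs, abs_of_nonneg (le_max_of_le_left hd0.le)]
        gcongr
        refine max_le (by linarith [abs_nonneg q]) (abs_le.2 ?_)
        constructor <;> linarith [abs_nonneg q]
    _ ≤ 2 * ∫⁻ x, sing κ (|x| * max d |x|) :=
        lintegral_abs_sub_le (g := fun x => sing κ (x * max d x))
          ((measurable_sing κ).comp (by fun_prop)) _
    _ ≤ _ := by
        grw [key]
        have e0 : d ^ (1 - 2 * κ) = |D| ^ (-(κ - 1 / 2)) := by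
          rw [hd, Real.sqrt_eq_rpow, ← Real.rpow_mul (abs_nonneg D)]
          congr 1; ring
        have e1 : ENNReal.ofReal (d ^ (-κ)) * ENNReal.ofReal (d ^ (1 - κ)) =
            ENNReal.ofReal (d ^ (1 - 2 * κ)) := by
          rw [← ENNReal.ofReal_mul (by positivity), ← Real.rpow_add hd0]
          congr 2; ring
        rw [mul_left_comm (ENNReal.ofReal (d ^ (-κ))), e1, e0, sing_of_ne hD]
        push_cast
        simp only [ENNReal.ofReal]
        apply le_of_eq
        ring

/-- The singularities at `|x| = r` may lie anywhere in relation to the interval of integration. -/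
theorem exists_lintegral_sing_ball {μ : ℝ} (hμ : 0 ≤ μ) (hμ' : μ < 1) :
    ∃ C : ℝ≥0, ∀ ℓ x₀ r : ℝ, 0 < ℓ →
      ∫⁻ x in {x | |x - x₀| ≤ ℓ}, sing μ (|x| - r) ≤ C * ENNReal.ofReal (ℓ ^ (1 - μ)) := by
  refine ⟨4 * (1 / (1 - μ)).toNNReal + 4, fun ℓ x₀ r hℓ => ?_⟩
  have hball : ∫⁻ x, ({x | |x| ≤ ℓ} : Set ℝ).indicator (sing μ) x ≤
      2 * (1 / (1 - μ)).toNNReal * ENNReal.ofReal (ℓ ^ (1 - μ)) := by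
    have key := lintegral_radial_le (μ := μ) (a := 2) (ℓ := ℓ) hμ' (by norm_num) hℓ
      (g := ({x | |x| ≤ ℓ} : Set ℝ).indicator (sing μ)) (c₁ := 1) (c₂ := 0)
      (fun x hx0 hx => by
        rw [Set.indicator_of_mem (by simpa [abs_of_pos hx0] using hx), sing_of_ne hx0.ne',
          abs_of_pos hx0, one_mul])
      (fun x hx => by
        rw [Set.indicator_of_notMem (by
          simp only [Set.mem_ofPred_eq, not_le]; rwa [abs_of_pos (hℓ.trans hx)])]
        simp)
    calc _ = ∫⁻ x, ({x | |x| ≤ ℓ} : Set ℝ).indicator (sing μ) |x| := by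
          refine lintegral_congr fun x => ?_
          simp [Set.indicator, sing]
      _ ≤ _ := key
      _ = _ := by
        simp only [ENNReal.ofReal]; ring
  have hone : ∀ y : ℝ, ∫⁻ x in {x | |x - x₀| ≤ ℓ}, sing μ (x - y) ≤
      (2 * (1 / (1 - μ)).toNNReal + 2 : ℝ≥0) * ENNReal.ofReal (ℓ ^ (1 - μ)) := by
    intro y
    have hm : MeasurableSet ({x | |x| ≤ ℓ} : Set ℝ) :=
      measurableSet_le (by fun_prop) (by fun_prop)
    calc ∫⁻ x in {x | |x - x₀| ≤ ℓ}, sing μ (x - y)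
        ≤ ∫⁻ x in {x | |x - x₀| ≤ ℓ}, (({x | |x| ≤ ℓ} : Set ℝ).indicator (sing μ) (x - y) +
            ENNReal.ofReal (ℓ ^ (-μ))) := by
          refine lintegral_mono fun x => ?_
          by_cases h : |x - y| ≤ ℓ
          · rw [Set.indicator_of_mem (by exact h)]; exact le_self_add
          · refine le_trans ?_ le_add_self
            have := sing_anti hμ (x := ℓ) (y := x - y) (by rw [abs_of_pos hℓ]; linarith)
            rwa [sing_of_ne hℓ.ne', abs_of_pos hℓ] at this
      _ ≤ (∫⁻ x, ({x | |x| ≤ ℓ} : Set ℝ).indicator (sing μ) (x - y)) +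
            ENNReal.ofReal (ℓ ^ (-μ)) * volume {x | |x - x₀| ≤ ℓ} := by
          rw [lintegral_add_right _ (by fun_prop), setLIntegral_const]
          gcongr
          exact Measure.restrict_le_self
      _ ≤ 2 * (1 / (1 - μ)).toNNReal * ENNReal.ofReal (ℓ ^ (1 - μ)) +
            2 * ENNReal.ofReal (ℓ ^ (1 - μ)) := by
          rw [lintegral_sub_right_eq_self (({x | |x| ≤ ℓ} : Set ℝ).indicator (sing μ)) y]
          refine add_le_add hball ?_
          have : {x | |x - x₀| ≤ ℓ} = Metric.closedBall x₀ ℓ := by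
            ext x; simp [Real.dist_eq]
          rw [this, Real.volume_closedBall, ← ENNReal.ofReal_mul (by positivity),
            show ℓ ^ (-μ) * (2 * ℓ) = 2 * ℓ ^ (1 - μ) by
              rw [show 1 - μ = -μ + 1 by ring, Real.rpow_add hℓ, Real.rpow_one]; ring,
            ENNReal.ofReal_mul (by norm_num)]
          simp
      _ = _ := by push_cast; ring
  calc ∫⁻ x in {x | |x - x₀| ≤ ℓ}, sing μ (|x| - r)
      ≤ ∫⁻ x in {x | |x - x₀| ≤ ℓ}, (sing μ (x - r) + sing μ (x - (-r))) := by
        refine lintegral_mono fun x => ?_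
        rcases abs_cases x with ⟨h, -⟩ | ⟨h, -⟩
        · rw [h]; exact le_self_add
        · refine le_trans (le_of_eq ?_) le_add_self
          rw [h, sing, sing, show -x - r = -(x - -r) by ring, abs_neg]
    _ = (∫⁻ x in {x | |x - x₀| ≤ ℓ}, sing μ (x - r)) +
          ∫⁻ x in {x | |x - x₀| ≤ ℓ}, sing μ (x - (-r)) :=
        lintegral_add_left ((measurable_sing μ).comp (by fun_prop)) _
    _ ≤ _ := by
        grw [hone r, hone (-r)]
        rw [← add_mul]
        apply le_of_eq
        push_cast; ring

/-- Away from the origin the quadratic `q² - D` has derivative of size at least `N`, so that its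
negative powers are integrable as those of a linear function with slope `N`. -/
theorem exists_lintegral_sing_quadratic_ball {μ : ℝ} (hμ : 0 ≤ μ) (hμ' : μ < 1) :
    ∃ C : ℝ≥0, ∀ ℓ x₀ N D : ℝ, 0 < ℓ → 0 < N →
      ∫⁻ q in {q | |q - x₀| ≤ ℓ ∧ N ≤ |q|}, sing μ (q ^ 2 - D) ≤
        C * (ENNReal.ofReal (N ^ (-μ)) * ENNReal.ofReal (ℓ ^ (1 - μ))) := by
  obtain ⟨C, hC⟩ := exists_lintegral_sing_ball hμ hμ'
  refine ⟨C, fun ℓ x₀ N D hℓ hN => ?_⟩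
  have h1 : MeasurableSet {q : ℝ | |q - x₀| ≤ ℓ} := measurableSet_le (by fun_prop) (by fun_prop)
  have h2 : MeasurableSet {q : ℝ | N ≤ |q|} := measurableSet_le (by fun_prop) (by fun_prop)
  have hm : MeasurableSet {q : ℝ | |q - x₀| ≤ ℓ ∧ N ≤ |q|} := h1.inter h2
  calc ∫⁻ q in {q | |q - x₀| ≤ ℓ ∧ N ≤ |q|}, sing μ (q ^ 2 - D)
      ≤ ∫⁻ q in {q | |q - x₀| ≤ ℓ ∧ N ≤ |q|},
          ENNReal.ofReal (N ^ (-μ)) * sing μ (|q| - √|D|) := by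
        refine setLIntegral_mono' hm fun q hq => sing_le_mul hμ hN ?_
        refine le_trans ?_ (abs_sq_sub_ge q D)
        rw [mul_comm]
        gcongr
        linarith [hq.2, Real.sqrt_nonneg |D|]
    _ ≤ ∫⁻ q in {q | |q - x₀| ≤ ℓ}, ENNReal.ofReal (N ^ (-μ)) * sing μ (|q| - √|D|) :=
        lintegral_mono_set fun q hq => hq.1
    _ ≤ _ := by
        have := measurable_sing μ
        rw [lintegral_const_mul _ (by fun_prop)]
        grw [hC ℓ x₀ _ hℓ]
        apply le_of_eq
        ring

/-- A quadratic polynomial `q² - D` over a ball of radius `ℓ`, anywhere on the line; the zero may be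
double, whence `μ < 1 / 2`. -/
theorem exists_lintegral_sing_quadratic_ball' {μ : ℝ} (hμ : 0 ≤ μ) (hμ' : μ < 1 / 2) :
    ∃ C : ℝ≥0, ∀ ℓ x₀ D : ℝ, 0 < ℓ →
      ∫⁻ q in {q | |q - x₀| ≤ ℓ}, sing μ (q ^ 2 - D) ≤ C * ENNReal.ofReal (ℓ ^ (1 - 2 * μ)) := by
  obtain ⟨C, hC⟩ := exists_lintegral_sing_ball (μ := 2 * μ) (by linarith) (by linarith)
  refine ⟨C, fun ℓ x₀ D hℓ => (lintegral_mono fun q => ?_).trans (hC ℓ x₀ (√|D|) hℓ)⟩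
  calc sing μ (q ^ 2 - D) ≤ sing μ ((|q| - √|D|) * (|q| - √|D|)) := by
        refine sing_anti hμ (le_trans ?_ (abs_sq_sub_ge q D))
        rw [abs_mul]
        gcongr
        rw [abs_le]
        constructor <;> linarith [abs_nonneg q, Real.sqrt_nonneg |D|]
    _ = sing (2 * μ) (|q| - √|D|) := by
        rw [sing, sing, abs_mul, ENNReal.ofReal_mul (abs_nonneg _), ← sq, ← ENNReal.rpow_natCast,
          ← ENNReal.rpow_mul]
        congr 1
        push_cast; ring

/-- The convolution of two brackets with exponents `a > 1` and `c ≤ a` decays like the worse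
one. -/
theorem exists_lintegral_brk_conv {a c : ℝ} (ha : 1 < a) (hc : 0 ≤ c) (hca : c ≤ a) :
    ∃ C : ℝ≥0, ∀ y : ℝ, ∫⁻ x, brk a x * brk c (y - x) ≤ C * brk c y := by
  have hI : ∫⁻ x, brk a x ≠ ⊤ := by
    have := integrable_one_add_norm (E := ℝ) (r := a) (by simpa using ha) (μ := volume)
    have h2 := this.lintegral_lt_top
    simpa [brk, Real.norm_eq_abs] using h2.ne
  lift (∫⁻ x, brk a x) to ℝ≥0 using hI with I hIeq
  refine ⟨(2 : ℝ≥0) ^ c * 3 * I, fun y => ?_⟩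
  have hpt : ∀ x, brk a x * brk c (y - x) ≤
      brk c y * (((2 : ℝ≥0) ^ c : ℝ≥0) * (2 * brk a x + brk a (y - x))) := by
    intro x
    set X := 1 + |x|
    set Y := 1 + |y - x|
    have hX : 1 ≤ X := by simp [X]
    have hY : 1 ≤ Y := by simp [Y]
    have h2c : (((2 : ℝ≥0) ^ c : ℝ≥0) : ℝ≥0∞) = ENNReal.ofReal (2 ^ c) := by
      rw [ENNReal.ofReal, Real.toNNReal_rpow_of_nonneg (by norm_num)]; norm_num
    have hreal : X ^ (-a) * Y ^ (-c) ≤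
        (1 + |y|) ^ (-c) * (2 ^ c * (2 * X ^ (-a) + Y ^ (-a))) := by
      have hxy : 1 + |y| ≤ 2 * max X Y := by
        have := abs_add_le x (y - x)
        rw [add_sub_cancel] at this
        have h1 := le_max_left X Y
        have h2 := le_max_right X Y
        simp only [X, Y] at *
        linarith
      have h3 : (2 * max X Y) ^ (-c) ≤ (1 + |y|) ^ (-c) :=
        Real.rpow_le_rpow_of_nonpos (by positivity) hxy (by linarith)
      have h4 : (2 * max X Y) ^ (-c) * (2 ^ c * (2 * X ^ (-a) + Y ^ (-a))) ≤
          (1 + |y|) ^ (-c) * (2 ^ c * (2 * X ^ (-a) + Y ^ (-a))) := by gcongr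
      refine le_trans ?_ h4
      have h5 : (2 * max X Y) ^ (-c) * 2 ^ c = (max X Y) ^ (-c) := by
        rw [Real.mul_rpow (by norm_num) (by positivity), mul_right_comm, ← Real.rpow_add (by norm_num)]
        simp
      rw [← mul_assoc, h5]
      have hXa : 0 < X ^ (-a) := by positivity
      have hYa : 0 < Y ^ (-a) := by positivity
      rcases le_total X Y with h | h
      · rw [max_eq_right h, mul_comm]
        gcongr
        linarith
      · rw [max_eq_left h]
        have h6 : X ^ (-a) ≤ X ^ (-c) * Y ^ (c - a) := by
          rw [show -a = -c + (c - a) by ring, Real.rpow_add (by positivity)]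
          gcongr ?_ * ?_
          exact Real.rpow_le_rpow_of_nonpos (by positivity) h (by linarith)
        calc X ^ (-a) * Y ^ (-c) ≤ X ^ (-c) * Y ^ (c - a) * Y ^ (-c) := by gcongr
          _ = X ^ (-c) * Y ^ (-a) := by
            rw [mul_assoc, ← Real.rpow_add (by positivity)]; congr 2; ring
          _ ≤ _ := by gcongr; linarith
    rw [h2c, brk, brk, brk, brk, ← ENNReal.ofReal_mul (by positivity),
      show (2 : ℝ≥0∞) = ENNReal.ofReal 2 by simp, ← ENNReal.ofReal_mul (by norm_num),
      ← ENNReal.ofReal_add (by positivity) (by positivity), ← ENNReal.ofReal_mul (by positivity),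
      ← ENNReal.ofReal_mul (by positivity)]
    exact ENNReal.ofReal_le_ofReal hreal
  have hmb := measurable_brk a
  calc ∫⁻ x, brk a x * brk c (y - x)
      ≤ ∫⁻ x, brk c y * (((2 : ℝ≥0) ^ c : ℝ≥0) * (2 * brk a x + brk a (y - x))) :=
        lintegral_mono hpt
    _ = brk c y * (((2 : ℝ≥0) ^ c : ℝ≥0) * (2 * I + I)) := by
        rw [lintegral_const_mul _ (by fun_prop), lintegral_const_mul _ (by fun_prop),
          lintegral_add_left (by fun_prop), lintegral_const_mul _ hmb,
          lintegral_sub_left_eq_self (brk a) y, ← hIeq]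
    _ = _ := by push_cast; ring

/-! ### Trilinear forms on `L²` -/

/-- The `L²` norm of an `[0, ∞]`-valued function. -/
def nrm {α : Type*} [MeasurableSpace α] (μ : Measure α) (f : α → ℝ≥0∞) : ℝ≥0∞ :=
  (∫⁻ x, f x ^ 2 ∂μ) ^ (1 / 2 : ℝ)

section nrm

variable {α : Type*} [MeasurableSpace α] {μ : Measure α}

theorem nrm_sq (f : α → ℝ≥0∞) : nrm μ f ^ 2 = ∫⁻ x, f x ^ 2 ∂μ := by
  rw [nrm, ← ENNReal.rpow_natCast, ← ENNReal.rpow_mul]; norm_num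

theorem rpow_half_sq (x : ℝ≥0∞) : (x ^ (1 / 2 : ℝ)) ^ 2 = x := by
  rw [← ENNReal.rpow_natCast, ← ENNReal.rpow_mul]; norm_num

theorem sq_rpow_half (x : ℝ≥0∞) : (x ^ 2) ^ (1 / 2 : ℝ) = x := by
  rw [← ENNReal.rpow_natCast, ← ENNReal.rpow_mul]; norm_num

theorem nrm_mono {f g : α → ℝ≥0∞} (h : ∀ x, f x ≤ g x) : nrm μ f ≤ nrm μ g := by
  unfold nrm
  gcongr with x
  exact h x

/-- The Cauchy-Schwarz inequality. -/
theorem lintegral_mul_le_nrm {f g : α → ℝ≥0∞} (hf : AEMeasurable f μ) (hg : AEMeasurable g μ) :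
    ∫⁻ x, f x * g x ∂μ ≤ nrm μ f * nrm μ g := by
  have := ENNReal.lintegral_mul_le_Lp_mul_Lq μ (Real.HolderConjugate.two_two) hf hg
  simpa [nrm] using this

theorem nrm_const_mul (c : ℝ≥0∞) {f : α → ℝ≥0∞} (hf : Measurable f) :
    nrm μ (fun x => c * f x) = c * nrm μ f := by
  simp only [nrm, mul_pow]
  rw [lintegral_const_mul _ (by fun_prop), ENNReal.mul_rpow_of_nonneg _ _ (by norm_num),
    sq_rpow_half]

/-- If `T` pairs with every measurable function with the constant `C`, its `L²` norm is at most
`C`: test against truncations of `T` itself. -/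
theorem nrm_le_of_forall_lintegral_mul_le [SigmaFinite μ] {T : α → ℝ≥0∞} (hT : Measurable T)
    {C : ℝ≥0∞} (h : ∀ H : α → ℝ≥0∞, Measurable H → ∫⁻ x, H x * T x ∂μ ≤ C * nrm μ H) :
    nrm μ T ≤ C := by
  set T' : ℕ → α → ℝ≥0∞ := fun n => (spanningSets μ n).indicator fun x => min (T x) n
  have hT'm : ∀ n, Measurable (T' n) := fun n =>
    (hT.min measurable_const).indicator (measurableSet_spanningSets μ n)
  have hbound : ∀ n, ∫⁻ x, T' n x ^ 2 ∂μ ≤ C ^ 2 := by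
    intro n
    have hfin : nrm μ (T' n) ≠ ⊤ := by
      rw [nrm]
      refine ENNReal.rpow_ne_top_of_nonneg (by norm_num) (ne_of_lt ?_)
      calc ∫⁻ x, T' n x ^ 2 ∂μ ≤ ∫⁻ x, (spanningSets μ n).indicator (fun _ => (n : ℝ≥0∞) ^ 2) x ∂μ := by
            refine lintegral_mono fun x => ?_
            by_cases hx : x ∈ spanningSets μ n
            · simp only [T', Set.indicator_of_mem hx]
              gcongr
              exact min_le_right _ _
            · simp [T', Set.indicator_of_notMem hx]
        _ = (n : ℝ≥0∞) ^ 2 * μ (spanningSets μ n) :=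
            lintegral_indicator_const (measurableSet_spanningSets μ n) _
        _ < ⊤ := ENNReal.mul_lt_top (by simp) (measure_spanningSets_lt_top μ n)
    have hle : nrm μ (T' n) ^ 2 ≤ C * nrm μ (T' n) := by
      rw [nrm_sq]
      refine le_trans (lintegral_mono fun x => ?_) (h _ (hT'm n))
      rw [sq]
      gcongr
      exact (Set.indicator_le_self' (fun _ _ => zero_le) x).trans (min_le_left _ _)
    rw [← nrm_sq]
    by_cases h0 : nrm μ (T' n) = 0
    · rw [h0]; simp
    · rw [sq] at hle
      have := (ENNReal.mul_le_mul_iff_left h0 hfin).1 hle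
      gcongr
  have hlim : ∫⁻ x, T x ^ 2 ∂μ ≤ C ^ 2 := by
    have hmono : Monotone fun n x => T' n x ^ 2 := by
      intro m n hmn x
      simp only [T']
      gcongr
      by_cases hx : x ∈ spanningSets μ m
      · rw [Set.indicator_of_mem hx, Set.indicator_of_mem (monotone_spanningSets μ hmn hx)]
        gcongr
      · rw [Set.indicator_of_notMem hx]; exact zero_le
    have hsup : ∀ x, T x ^ 2 ≤ ⨆ n, T' n x ^ 2 := by
      intro x
      obtain ⟨m, hm⟩ : ∃ m, x ∈ spanningSets μ m := ⟨_, mem_spanningSetsIndex μ x⟩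
      have ht : Filter.Tendsto (fun n : ℕ => min (T x) (n : ℝ≥0∞) ^ 2) Filter.atTop
          (nhds (min (T x) ⊤ ^ 2)) :=
        (ENNReal.continuous_pow 2).continuousAt.tendsto.comp
          (tendsto_const_nhds.min ENNReal.tendsto_nat_nhds_top)
      rw [min_top_right] at ht
      refine le_of_tendsto ht ?_
      filter_upwards [Filter.eventually_ge_atTop m] with n hn
      refine le_trans (le_of_eq ?_) (le_iSup _ n)
      simp [T', Set.indicator_of_mem (monotone_spanningSets μ hn hm)]
    calc ∫⁻ x, T x ^ 2 ∂μ ≤ ∫⁻ x, ⨆ n, T' n x ^ 2 ∂μ := lintegral_mono hsup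
      _ = ⨆ n, ∫⁻ x, T' n x ^ 2 ∂μ := lintegral_iSup (fun n => (hT'm n).pow_const 2) hmono
      _ ≤ C ^ 2 := iSup_le hbound
  calc nrm μ T ≤ (C ^ 2) ^ (1 / 2 : ℝ) := ENNReal.rpow_le_rpow hlim (by norm_num)
    _ = C := sq_rpow_half C

end nrm

/-- The trilinear form with kernel `k` on the functions `F`, `G` and `H` at the frequencies `z₁`,
`z₂` and `z₁ + z₂` is bounded by `K` on `L² × L² × L²`. -/
def TriBound (k : SpaceTime → SpaceTime → ℝ≥0∞) (K : ℝ≥0∞) : Prop :=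
  ∀ F G H : SpaceTime → ℝ≥0∞, Measurable F → Measurable G → Measurable H →
    ∫⁻ z₁, ∫⁻ z₂, k z₁ z₂ * (F z₁ * G z₂ * H (z₁ + z₂)) ≤
      K * (nrm volume F * nrm volume G * nrm volume H)

section TriBound

variable {k k₁ k₂ : SpaceTime → SpaceTime → ℝ≥0∞} {K K₁ K₂ : ℝ≥0∞}

theorem TriBound.mono (h : TriBound k K) (hk : ∀ z₁ z₂, k₁ z₁ z₂ ≤ k z₁ z₂) (hK : K ≤ K₁) :
    TriBound k₁ K₁ := fun F G H hF hG hH =>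
  calc _ ≤ ∫⁻ z₁, ∫⁻ z₂, k z₁ z₂ * (F z₁ * G z₂ * H (z₁ + z₂)) := by
        gcongr with z₁ z₂; exact hk _ _
    _ ≤ _ := h F G H hF hG hH
    _ ≤ _ := by gcongr

theorem TriBound.tsum {k : ℕ → SpaceTime → SpaceTime → ℝ≥0∞} {K : ℕ → ℝ≥0∞}
    (hm : ∀ i, Measurable (Function.uncurry (k i))) (h : ∀ i, TriBound (k i) (K i)) :
    TriBound (fun z₁ z₂ => ∑' i, k i z₁ z₂) (∑' i, K i) := fun F G H hF hG hH => by
  have hm' : ∀ i z₁, Measurable (k i z₁) := fun i z₁ => Measurable.of_uncurry_left (hm i)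
  have e : ∀ z₁, ∫⁻ z₂, (∑' i, k i z₁ z₂) * (F z₁ * G z₂ * H (z₁ + z₂)) =
      ∑' i, ∫⁻ z₂, k i z₁ z₂ * (F z₁ * G z₂ * H (z₁ + z₂)) := by
    intro z₁
    simp_rw [← ENNReal.tsum_mul_right]
    refine lintegral_tsum fun i => ?_
    have := hm' i z₁
    fun_prop
  simp_rw [e]
  rw [lintegral_tsum, ← ENNReal.tsum_mul_right]
  · exact ENNReal.tsum_le_tsum fun i => h i F G H hF hG hH
  · intro i
    apply Measurable.aemeasurable
    apply Measurable.lintegral_prod_right'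
      (f := fun z : SpaceTime × SpaceTime => k i z.1 z.2 * (F z.1 * G z.2 * H (z.1 + z.2)))
    have : Measurable fun z : SpaceTime × SpaceTime => k i z.1 z.2 := hm i
    fun_prop

theorem TriBound.add (h₁ : TriBound k₁ K₁) (h₂ : TriBound k₂ K₂)
    (hm : Measurable (Function.uncurry k₁)) :
    TriBound (fun z₁ z₂ => k₁ z₁ z₂ + k₂ z₁ z₂) (K₁ + K₂) := fun F G H hF hG hH => by
  have hm1 : Measurable fun z : SpaceTime × SpaceTime => k₁ z.1 z.2 := hm
  have hm' : ∀ z₁, Measurable (k₁ z₁) := fun z₁ => Measurable.of_uncurry_left hm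
  have e : ∀ z₁, ∫⁻ z₂, (k₁ z₁ z₂ + k₂ z₁ z₂) * (F z₁ * G z₂ * H (z₁ + z₂)) =
      (∫⁻ z₂, k₁ z₁ z₂ * (F z₁ * G z₂ * H (z₁ + z₂))) +
        ∫⁻ z₂, k₂ z₁ z₂ * (F z₁ * G z₂ * H (z₁ + z₂)) := by
    intro z₁
    simp_rw [add_mul]
    have := hm' z₁
    exact lintegral_add_left (by fun_prop) _
  simp_rw [e]
  rw [lintegral_add_left, add_mul]
  · exact add_le_add (h₁ F G H hF hG hH) (h₂ F G H hF hG hH)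
  · apply Measurable.lintegral_prod_right'
      (f := fun z : SpaceTime × SpaceTime => k₁ z.1 z.2 * (F z.1 * G z.2 * H (z.1 + z.2)))
    fun_prop

/-- The Cauchy-Schwarz bound: the fibers of `k` over the output frequency are bounded in `L²`. -/
theorem TriBound.of_fiber (hm : Measurable (Function.uncurry k)) {M : ℝ≥0∞}
    (h : ∀ z, ∫⁻ z₁, k z₁ (z - z₁) ^ 2 ≤ M) : TriBound k (M ^ (1 / 2 : ℝ)) := by
  intro F G H hF hG hH
  have hm1 : Measurable fun z : SpaceTime × SpaceTime => k z.1 z.2 := hm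
  have h1 : ∫⁻ z : SpaceTime × SpaceTime, (k z.1 z.2 * H (z.1 + z.2)) ^ 2 ≤
      M * ∫⁻ z, H z ^ 2 := by
    rw [Measure.volume_eq_prod, lintegral_prod _ (by fun_prop)]
    calc ∫⁻ z₁, ∫⁻ z₂, (k z₁ z₂ * H (z₁ + z₂)) ^ 2
        = ∫⁻ z₁, ∫⁻ z, (k z₁ (z - z₁) * H z) ^ 2 := by
          refine lintegral_congr fun z₁ => ?_
          rw [← lintegral_sub_right_eq_self (fun z₂ => (k z₁ z₂ * H (z₁ + z₂)) ^ 2) z₁]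
          simp
      _ = ∫⁻ z, ∫⁻ z₁, (k z₁ (z - z₁) * H z) ^ 2 := by
          refine lintegral_lintegral_swap (Measurable.aemeasurable ?_)
          have : Measurable fun z : SpaceTime × SpaceTime => k z.1 (z.2 - z.1) :=
            hm1.comp (f := fun z : SpaceTime × SpaceTime => (z.1, z.2 - z.1)) (by fun_prop)
          exact (this.mul (hH.comp measurable_snd)).pow_const 2
      _ = ∫⁻ z, (∫⁻ z₁, k z₁ (z - z₁) ^ 2) * H z ^ 2 := by
          refine lintegral_congr fun z => ?_
          simp_rw [mul_pow]
          refine lintegral_mul_const _ (Measurable.pow_const ?_ 2)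
          exact hm1.comp (f := fun z₁ : SpaceTime => (z₁, z - z₁)) (by fun_prop)
      _ ≤ ∫⁻ z, M * H z ^ 2 := by gcongr with z; exact h z
      _ = _ := lintegral_const_mul _ (by fun_prop)
  have h2 : ∫⁻ z : SpaceTime × SpaceTime, (F z.1 * G z.2) ^ 2 =
      (∫⁻ z, F z ^ 2) * ∫⁻ z, G z ^ 2 := by
    simp_rw [mul_pow]
    rw [Measure.volume_eq_prod]
    exact lintegral_prod_mul (hF.pow_const 2).aemeasurable (hG.pow_const 2).aemeasurable
  calc ∫⁻ z₁, ∫⁻ z₂, k z₁ z₂ * (F z₁ * G z₂ * H (z₁ + z₂))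
      = ∫⁻ z : SpaceTime × SpaceTime, (k z.1 z.2 * H (z.1 + z.2)) * (F z.1 * G z.2) := by
        rw [Measure.volume_eq_prod, lintegral_prod _ (by fun_prop)]
        refine lintegral_congr fun z₁ => lintegral_congr fun z₂ => ?_
        ring
    _ ≤ nrm volume (fun z : SpaceTime × SpaceTime => k z.1 z.2 * H (z.1 + z.2)) *
          nrm volume (fun z : SpaceTime × SpaceTime => F z.1 * G z.2) := by
        apply lintegral_mul_le_nrm <;> fun_prop
    _ ≤ (M * ∫⁻ z, H z ^ 2) ^ (1 / 2 : ℝ) *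
          ((∫⁻ z, F z ^ 2) * ∫⁻ z, G z ^ 2) ^ (1 / 2 : ℝ) := by
        rw [← h2]
        unfold nrm
        gcongr
    _ = _ := by
        rw [ENNReal.mul_rpow_of_nonneg _ _ (by norm_num),
          ENNReal.mul_rpow_of_nonneg _ _ (by norm_num)]
        unfold nrm
        ring

/-- Localization: if the kernel couples the piece `S θ` of `F` only to the piece `S' θ` of `G`
and these pieces overlap boundedly, then it suffices to bound it on each piece of `F`. -/
theorem TriBound.localize (hm : Measurable (Function.uncurry k)) {π : SpaceTime → ℝ}
    (hπ : Measurable π) {S S' : Set (ℝ × ℝ)} (hS : MeasurableSet S) (hS' : MeasurableSet S')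
    {w : ℝ → ℝ≥0∞} (hw : Measurable w) {C C' : ℝ≥0∞}
    (hC : ∀ x, ∫⁻ θ, w θ * S.indicator 1 (θ, x) ≤ C)
    (hC' : ∀ x, ∫⁻ θ, w θ * S'.indicator 1 (θ, x) ≤ C')
    (hk : ∀ z₁ z₂, k z₁ z₂ ≠ 0 →
      1 ≤ ∫⁻ θ, w θ * (S.indicator 1 (θ, π z₁) * S'.indicator 1 (θ, π z₂)))
    (h : ∀ θ, TriBound (fun z₁ z₂ => k z₁ z₂ * S.indicator 1 (θ, π z₁)) K) :
    TriBound k (K * (C * C') ^ (1 / 2 : ℝ)) := by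
  intro F G H hF hG hH
  have hm1 : Measurable fun z : SpaceTime × SpaceTime => k z.1 z.2 := hm
  have hI : Measurable (S.indicator (1 : ℝ × ℝ → ℝ≥0∞)) := measurable_one.indicator hS
  have hI' : Measurable (S'.indicator (1 : ℝ × ℝ → ℝ≥0∞)) := measurable_one.indicator hS'
  set F' : ℝ → SpaceTime → ℝ≥0∞ := fun θ z => S.indicator 1 (θ, π z) * F z with hF'
  set G' : ℝ → SpaceTime → ℝ≥0∞ := fun θ z => S'.indicator 1 (θ, π z) * G z with hG'
  have hF'm : Measurable fun x : ℝ × SpaceTime => F' x.1 x.2 :=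
    (hI.comp (f := fun x : ℝ × SpaceTime => (x.1, π x.2)) (by fun_prop)).mul (by fun_prop)
  have hG'm : Measurable fun x : ℝ × SpaceTime => G' x.1 x.2 :=
    (hI'.comp (f := fun x : ℝ × SpaceTime => (x.1, π x.2)) (by fun_prop)).mul (by fun_prop)
  have hsq : ∀ (T : Set (ℝ × ℝ)) (x : ℝ × ℝ),
      (T.indicator (1 : ℝ × ℝ → ℝ≥0∞) x) ^ 2 = T.indicator 1 x := by
    intro T x
    by_cases hx : x ∈ T <;> simp [hx]
  have hmass : ∀ (T : Set (ℝ × ℝ)) (_ : Measurable (T.indicator (1 : ℝ × ℝ → ℝ≥0∞)))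
      (D : ℝ≥0∞) (_ : ∀ x, ∫⁻ θ, w θ * T.indicator 1 (θ, x) ≤ D) (E : SpaceTime → ℝ≥0∞)
      (_ : Measurable E), ∫⁻ θ, w θ * ∫⁻ z, (T.indicator 1 (θ, π z) * E z) ^ 2 ≤
        D * ∫⁻ z, E z ^ 2 := by
    intro T hT D hD E hE
    have hT2 : Measurable fun x : ℝ × SpaceTime => T.indicator (1 : ℝ × ℝ → ℝ≥0∞) (x.1, π x.2) :=
      hT.comp (by fun_prop)
    have hT1 : ∀ θ, Measurable fun z => T.indicator (1 : ℝ × ℝ → ℝ≥0∞) (θ, π z) :=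
      fun θ => hT.comp (by fun_prop)
    have hT3 : ∀ x, Measurable fun θ => T.indicator (1 : ℝ × ℝ → ℝ≥0∞) (θ, x) :=
      fun θ => hT.comp (by fun_prop)
    calc ∫⁻ θ, w θ * ∫⁻ z, (T.indicator 1 (θ, π z) * E z) ^ 2
        = ∫⁻ θ, ∫⁻ z, w θ * T.indicator 1 (θ, π z) * E z ^ 2 := by
          refine lintegral_congr fun θ => ?_
          have := hT1 θ
          rw [← lintegral_const_mul _ (by fun_prop)]
          refine lintegral_congr fun z => ?_
          rw [mul_pow, hsq, mul_assoc]
      _ = ∫⁻ z, ∫⁻ θ, w θ * T.indicator 1 (θ, π z) * E z ^ 2 := by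
          refine lintegral_lintegral_swap (Measurable.aemeasurable ?_)
          exact ((hw.comp measurable_fst).mul hT2).mul ((hE.comp measurable_snd).pow_const 2)
      _ = ∫⁻ z, (∫⁻ θ, w θ * T.indicator 1 (θ, π z)) * E z ^ 2 := by
          refine lintegral_congr fun z => lintegral_mul_const _ ?_
          have := hT3 (π z)
          fun_prop
      _ ≤ ∫⁻ z, D * E z ^ 2 := by gcongr with z; exact hD _
      _ = _ := lintegral_const_mul _ (by fun_prop)
  set Φ : ℝ → SpaceTime → SpaceTime → ℝ≥0∞ := fun θ z₁ z₂ =>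
    k z₁ z₂ * S.indicator 1 (θ, π z₁) * (F' θ z₁ * G' θ z₂ * H (z₁ + z₂)) with hΦ
  have hΦm : Measurable fun x : ℝ × SpaceTime × SpaceTime => Φ x.1 x.2.1 x.2.2 := by
    have a1 := hm1.comp (f := fun x : ℝ × SpaceTime × SpaceTime => x.2) (by fun_prop)
    have a2 := hF'm.comp (f := fun x : ℝ × SpaceTime × SpaceTime => (x.1, x.2.1)) (by fun_prop)
    have a3 := hG'm.comp (f := fun x : ℝ × SpaceTime × SpaceTime => (x.1, x.2.2)) (by fun_prop)
    have a4 := hI.comp (f := fun x : ℝ × SpaceTime × SpaceTime => (x.1, π x.2.1)) (by fun_prop)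
    have a5 := hH.comp (f := fun x : ℝ × SpaceTime × SpaceTime => x.2.1 + x.2.2) (by fun_prop)
    exact (a1.mul a4).mul ((a2.mul a3).mul a5)
  have hΦ1 : ∀ z₁ z₂, Measurable fun θ => Φ θ z₁ z₂ := fun z₁ z₂ =>
    hΦm.comp (f := fun θ => (θ, z₁, z₂)) (by fun_prop)
  have hFn : Measurable fun θ => nrm volume (F' θ) := by
    unfold nrm
    exact ((hF'm.pow_const 2).lintegral_prod_right').pow_const _
  have hGn : Measurable fun θ => nrm volume (G' θ) := by
    unfold nrm
    exact ((hG'm.pow_const 2).lintegral_prod_right').pow_const _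
  calc ∫⁻ z₁, ∫⁻ z₂, k z₁ z₂ * (F z₁ * G z₂ * H (z₁ + z₂))
      ≤ ∫⁻ z₁, ∫⁻ z₂, ∫⁻ θ, w θ * Φ θ z₁ z₂ := by
        refine lintegral_mono fun z₁ => lintegral_mono fun z₂ => ?_
        by_cases h0 : k z₁ z₂ = 0
        · simp [h0]
        have hT1 : Measurable fun θ => S.indicator (1 : ℝ × ℝ → ℝ≥0∞) (θ, π z₁) :=
          hI.comp (by fun_prop)
        have hT2 : Measurable fun θ => S'.indicator (1 : ℝ × ℝ → ℝ≥0∞) (θ, π z₂) :=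
          hI'.comp (by fun_prop)
        calc k z₁ z₂ * (F z₁ * G z₂ * H (z₁ + z₂))
            ≤ (∫⁻ θ, w θ * (S.indicator 1 (θ, π z₁) * S'.indicator 1 (θ, π z₂))) *
                (k z₁ z₂ * (F z₁ * G z₂ * H (z₁ + z₂))) := le_mul_of_one_le_left' (hk z₁ z₂ h0)
          _ = ∫⁻ θ, w θ * (S.indicator 1 (θ, π z₁) * S'.indicator 1 (θ, π z₂)) *
                (k z₁ z₂ * (F z₁ * G z₂ * H (z₁ + z₂))) :=
              (lintegral_mul_const _ (by fun_prop)).symm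
          _ = _ := by
              refine lintegral_congr fun θ => ?_
              rw [hΦ, hF', hG']
              dsimp only
              nth_rewrite 1 [← hsq S]
              ring
    _ = ∫⁻ θ, w θ * ∫⁻ z₁, ∫⁻ z₂, Φ θ z₁ z₂ := by
        have b1 : ∀ z₁, ∫⁻ z₂, ∫⁻ θ, w θ * Φ θ z₁ z₂ = ∫⁻ θ, ∫⁻ z₂, w θ * Φ θ z₁ z₂ := by
          intro z₁
          refine lintegral_lintegral_swap (Measurable.aemeasurable ?_)
          exact (hw.comp measurable_snd).mul
            (hΦm.comp (f := fun x : SpaceTime × ℝ => (x.2, z₁, x.1)) (by fun_prop))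
        simp_rw [b1]
        have hmm : Measurable fun x : (SpaceTime × ℝ) × SpaceTime => w x.1.2 * Φ x.1.2 x.1.1 x.2 :=
          (hw.comp (by fun_prop)).mul (hΦm.comp
            (f := fun x : (SpaceTime × ℝ) × SpaceTime => (x.1.2, x.1.1, x.2)) (by fun_prop))
        rw [lintegral_lintegral_swap (Measurable.aemeasurable ?_)]
        · refine lintegral_congr fun θ => ?_
          have hm3 : Measurable fun x : SpaceTime × SpaceTime => Φ θ x.1 x.2 :=
            hΦm.comp (f := fun x : SpaceTime × SpaceTime => (θ, x.1, x.2)) (by fun_prop)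
          rw [← lintegral_const_mul _ hm3.lintegral_prod_right']
          refine lintegral_congr fun z₁ => lintegral_const_mul _ ?_
          exact hΦm.comp (f := fun z₂ => (θ, z₁, z₂)) (by fun_prop)
        · exact hmm.lintegral_prod_right'
    _ ≤ ∫⁻ θ, w θ * (K * (nrm volume (F' θ) * nrm volume (G' θ) * nrm volume H)) := by
        gcongr with θ
        refine h θ (F' θ) (G' θ) H ?_ ?_ hH
        · exact hF'm.comp (f := fun z => (θ, z)) (by fun_prop)
        · exact hG'm.comp (f := fun z => (θ, z)) (by fun_prop)
    _ = K * nrm volume H * ∫⁻ θ, (w θ ^ (1 / 2 : ℝ) * nrm volume (F' θ)) *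
          (w θ ^ (1 / 2 : ℝ) * nrm volume (G' θ)) := by
        rw [← lintegral_const_mul _ (by fun_prop)]
        refine lintegral_congr fun θ => ?_
        nth_rewrite 1 [← rpow_half_sq (w θ)]
        ring
    _ ≤ K * nrm volume H * ((C * ∫⁻ z, F z ^ 2) ^ (1 / 2 : ℝ) *
          (C' * ∫⁻ z, G z ^ 2) ^ (1 / 2 : ℝ)) := by
        gcongr
        refine (lintegral_mul_le_nrm (by fun_prop) (by fun_prop)).trans ?_
        unfold nrm
        gcongr ?_ ^ _ * ?_ ^ _
        · refine le_trans (le_of_eq ?_) (hmass S hI C hC F hF)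
          refine lintegral_congr fun θ => ?_
          rw [mul_pow, rpow_half_sq, rpow_half_sq]
        · refine le_trans (le_of_eq ?_) (hmass S' hI' C' hC' G hG)
          refine lintegral_congr fun θ => ?_
          rw [mul_pow, rpow_half_sq, rpow_half_sq]
    _ = _ := by
        rw [ENNReal.mul_rpow_of_nonneg _ _ (by norm_num),
          ENNReal.mul_rpow_of_nonneg _ _ (by norm_num),
          ENNReal.mul_rpow_of_nonneg _ _ (by norm_num)]
        unfold nrm
        ring

end TriBound

/-! ### The kernel of the bilinear estimate -/

/-- The frequency `ξ` of the point `ζ`. -/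
def freqX (ζ : SpaceTime) : ℝ := 2 * Real.pi * ζ 1

/-- The frequency `η` of the point `ζ`. -/
def freqY (ζ : SpaceTime) : ℝ := 2 * Real.pi * ζ 2

/-- The modulation `τ - ξ³ - η³` of the point `ζ`. -/
def modulation (ζ : SpaceTime) : ℝ :=
  2 * Real.pi * ζ 0 - (2 * Real.pi * ζ 1) ^ 3 - (2 * Real.pi * ζ 2) ^ 3

@[fun_prop] theorem continuous_freqX : Continuous freqX := by unfold freqX; fun_prop
@[fun_prop] theorem continuous_freqY : Continuous freqY := by unfold freqY; fun_prop
@[fun_prop] theorem continuous_modulation : Continuous modulation := by unfold modulation; fun_prop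
@[fun_prop] theorem measurable_freqX : Measurable freqX := continuous_freqX.measurable
@[fun_prop] theorem measurable_freqY : Measurable freqY := continuous_freqY.measurable

theorem freqX_add (z w : SpaceTime) : freqX (z + w) = freqX z + freqX w := by
  simp [freqX]; ring

theorem freqY_add (z w : SpaceTime) : freqY (z + w) = freqY z + freqY w := by
  simp [freqY]; ring

/-- The integral over space-time as an iterated integral, with the time variable innermost. -/
theorem lintegral_spaceTime (f : ℝ × ℝ × ℝ → ℝ≥0∞) (hf : Measurable f) :
    ∫⁻ z : SpaceTime, f (z 0, z 1, z 2) = ∫⁻ x, ∫⁻ y, ∫⁻ t, f (t, x, y) := by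
  have e1 := (EuclideanSpace.volume_preserving_symm_measurableEquiv_toLp (Fin 3)).lintegral_comp_emb
    (MeasurableEquiv.measurableEmbedding _) (fun z : Fin 3 → ℝ => f (z 0, z 1, z 2))
  have e2 := (volume_preserving_piFinSuccAbove (fun _ : Fin 3 => ℝ) 0).lintegral_comp_emb
    (MeasurableEquiv.measurableEmbedding _) (fun z : ℝ × (Fin 2 → ℝ) => f (z.1, z.2 0, z.2 1))
  have e3 : ∀ t, _ := fun t => (volume_preserving_finTwoArrow ℝ).lintegral_comp_emb
    (MeasurableEquiv.measurableEmbedding _) (fun z : ℝ × ℝ => f (t, z.1, z.2))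
  calc ∫⁻ z : SpaceTime, f (z 0, z 1, z 2) = ∫⁻ z : Fin 3 → ℝ, f (z 0, z 1, z 2) := by
        rw [← e1]; rfl
    _ = ∫⁻ z : ℝ × (Fin 2 → ℝ), f (z.1, z.2 0, z.2 1) := by rw [← e2]; rfl
    _ = ∫⁻ t, ∫⁻ z : Fin 2 → ℝ, f (t, z 0, z 1) := by
        rw [Measure.volume_eq_prod, lintegral_prod _ (by fun_prop)]
    _ = ∫⁻ t, ∫⁻ z : ℝ × ℝ, f (t, z.1, z.2) := by
        refine lintegral_congr fun t => ?_
        rw [← e3 t]; rfl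
    _ = ∫⁻ z : ℝ × ℝ, ∫⁻ t, f (t, z.1, z.2) :=
        lintegral_lintegral_swap (Measurable.aemeasurable (by fun_prop))
    _ = _ := by
        rw [Measure.volume_eq_prod, lintegral_prod]
        exact (Measurable.lintegral_prod_right' (f := fun z : (ℝ × ℝ) × ℝ => f (z.2, z.1.1, z.1.2))
          (by fun_prop)).aemeasurable

theorem lintegral_comp_mul_left {f : ℝ → ℝ≥0∞} (hf : Measurable f) {a : ℝ} (ha : a ≠ 0) :
    ∫⁻ x, f (a * x) = ENNReal.ofReal |a⁻¹| * ∫⁻ x, f x := by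
  rw [← lintegral_map (f := f) hf (by fun_prop : Measurable fun x => a * x),
    Real.map_volume_mul_left ha, lintegral_smul_measure, smul_eq_mul]

/-- The integral in the variables `(τ, ξ, η) = 2 π ζ`. -/
theorem lintegral_spaceTime_scaled (f : ℝ × ℝ × ℝ → ℝ≥0∞) (hf : Measurable f) :
    ∫⁻ z : SpaceTime, f (2 * Real.pi * z 0, freqX z, freqY z) =
      ENNReal.ofReal |(2 * Real.pi)⁻¹| ^ 3 * ∫⁻ x, ∫⁻ y, ∫⁻ t, f (t, x, y) := by
  have hp : 2 * Real.pi ≠ 0 := by positivity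
  have h := lintegral_spaceTime
    (fun z => f (2 * Real.pi * z.1, 2 * Real.pi * z.2.1, 2 * Real.pi * z.2.2)) (by fun_prop)
  simp only [freqX, freqY]
  rw [h]
  have h1 : ∀ x y : ℝ, ∫⁻ t, f (2 * Real.pi * t, x, y) =
      ENNReal.ofReal |(2 * Real.pi)⁻¹| * ∫⁻ t, f (t, x, y) := fun x y =>
    lintegral_comp_mul_left (f := fun t => f (t, x, y)) (by fun_prop) hp
  have hm1 : Measurable fun z : ℝ × ℝ => ∫⁻ t, f (t, z.1, z.2) :=
    Measurable.lintegral_prod_right' (f := fun z : (ℝ × ℝ) × ℝ => f (z.2, z.1.1, z.1.2))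
      (by fun_prop)
  have hm1' : ∀ x, Measurable fun y => ∫⁻ t, f (t, x, y) := fun x =>
    hm1.comp (f := fun y => (x, y)) (by fun_prop)
  have h2 : ∀ x : ℝ, ∫⁻ y, ∫⁻ t, f (t, x, 2 * Real.pi * y) =
      ENNReal.ofReal |(2 * Real.pi)⁻¹| * ∫⁻ y, ∫⁻ t, f (t, x, y) := fun x =>
    lintegral_comp_mul_left (f := fun y => ∫⁻ t, f (t, x, y)) (hm1' x) hp
  have hm2 : Measurable fun x => ∫⁻ y, ∫⁻ t, f (t, x, y) := hm1.lintegral_prod_right'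
  simp_rw [h1]
  have h3 : ∀ x, ∫⁻ y, ENNReal.ofReal |(2 * Real.pi)⁻¹| * ∫⁻ t, f (t, x, 2 * Real.pi * y) =
      ENNReal.ofReal |(2 * Real.pi)⁻¹| * ∫⁻ y, ∫⁻ t, f (t, x, 2 * Real.pi * y) := fun x =>
    lintegral_const_mul _ ((hm1' x).comp (by fun_prop))
  simp_rw [h3, h2]
  rw [lintegral_const_mul' _ _ ENNReal.ofReal_ne_top, lintegral_const_mul' _ _ ENNReal.ofReal_ne_top,
    lintegral_comp_mul_left hm2 hp]
  ring

/-- The kernel with the frequency weight `a (ξ₁, η₁, ξ₂, η₂)` and the weights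
`⟨τᵢ - ξᵢ³ - ηᵢ³⟩ ^ (-bᵢ)`, where `b₁ = 33/64 > 1/2 > b₂ = 15/32`. -/
def freqKernel (a : ℝ × ℝ × ℝ × ℝ → ℝ≥0∞) (z₁ z₂ : SpaceTime) : ℝ≥0∞ :=
  a (freqX z₁, freqY z₁, freqX z₂, freqY z₂) *
    (brk (33 / 64) (modulation z₁) * brk (15 / 32) (modulation z₂))

theorem measurable_freqKernel {a : ℝ × ℝ × ℝ × ℝ → ℝ≥0∞} (ha : Measurable a) :
    Measurable (Function.uncurry (freqKernel a)) := by
  have h1 := measurable_brk (33 / 64)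
  have h2 := measurable_brk (15 / 32)
  unfold Function.uncurry freqKernel
  fun_prop

theorem brk_sq (μ x : ℝ) : brk μ x ^ 2 = brk (2 * μ) x := by
  rw [sq, brk_mul_brk, two_mul]

/-- After the integration in `τ₁`, the fiber over the output frequency is a weighted integral of
the resonance function, which is a quadratic polynomial in `(ξ₁ - ξ / 2, η₁ - η / 2)`. -/
theorem exists_triBound_freqKernel : ∃ C : ℝ≥0, ∀ a : ℝ × ℝ × ℝ × ℝ → ℝ≥0∞, Measurable a →
    ∀ M : ℝ≥0∞, (∀ c ξ η : ℝ, ∫⁻ x, ∫⁻ y, a (x, y, ξ - x, η - y) ^ 2 *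
      brk (15 / 16) (c - 3 * ξ * (x - ξ / 2) ^ 2 - 3 * η * (y - η / 2) ^ 2) ≤ M) →
    TriBound (freqKernel a) (C * M ^ (1 / 2 : ℝ)) := by
  -- The exponents are doubled by squaring: `33 / 32 = 2 b₁` and `15 / 16 = 2 b₂`.
  obtain ⟨C, hC⟩ := exists_lintegral_brk_conv (a := 33 / 32) (c := 15 / 16) (by norm_num)
    (by norm_num) (by norm_num)
  refine ⟨((|(2 * Real.pi)⁻¹|.toNNReal ^ 3 * C) ^ (1 / 2 : ℝ) : ℝ≥0), fun a ha M h => ?_⟩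
  have hb1 := measurable_brk (33 / 32)
  have hb2 := measurable_brk (15 / 16)
  have key : ∀ z, ∫⁻ z₁, freqKernel a z₁ (z - z₁) ^ 2 ≤
      (|(2 * Real.pi)⁻¹|.toNNReal ^ 3 * C : ℝ≥0) * M := by
    intro z
    set ξ := freqX z with hξ
    set η := freqY z with hη
    set T := 2 * Real.pi * z 0 with hT
    set f : ℝ × ℝ × ℝ → ℝ≥0∞ := fun w => a (w.2.1, w.2.2, ξ - w.2.1, η - w.2.2) ^ 2 *
      (brk (33 / 32) (w.1 - w.2.1 ^ 3 - w.2.2 ^ 3) *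
        brk (15 / 16) (T - ξ ^ 3 / 4 - η ^ 3 / 4 - 3 * ξ * (w.2.1 - ξ / 2) ^ 2 -
          3 * η * (w.2.2 - η / 2) ^ 2 - (w.1 - w.2.1 ^ 3 - w.2.2 ^ 3))) with hf
    have hfm : Measurable f := by
      rw [hf]
      fun_prop
    calc ∫⁻ z₁, freqKernel a z₁ (z - z₁) ^ 2
        = ∫⁻ z₁, f (2 * Real.pi * z₁ 0, freqX z₁, freqY z₁) := by
          refine lintegral_congr fun z₁ => ?_
          have e1 : freqX (z - z₁) = ξ - freqX z₁ := by simp [hξ, freqX]; ring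
          have e2 : freqY (z - z₁) = η - freqY z₁ := by simp [hη, freqY]; ring
          have e3 : modulation z₁ = 2 * Real.pi * z₁ 0 - freqX z₁ ^ 3 - freqY z₁ ^ 3 := rfl
          have e4 : modulation (z - z₁) = T - ξ ^ 3 / 4 - η ^ 3 / 4 -
              3 * ξ * (freqX z₁ - ξ / 2) ^ 2 - 3 * η * (freqY z₁ - η / 2) ^ 2 -
              (2 * Real.pi * z₁ 0 - freqX z₁ ^ 3 - freqY z₁ ^ 3) := by
            simp only [modulation, hξ, hη, hT, freqX, freqY, PiLp.sub_apply]
            ring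
          rw [freqKernel, mul_pow, mul_pow, brk_sq, brk_sq, e1, e2, e3, e4, hf]
          norm_num
      _ = ENNReal.ofReal |(2 * Real.pi)⁻¹| ^ 3 * ∫⁻ x, ∫⁻ y, ∫⁻ t, f (t, x, y) :=
          lintegral_spaceTime_scaled f hfm
      _ ≤ ENNReal.ofReal |(2 * Real.pi)⁻¹| ^ 3 * ∫⁻ x, ∫⁻ y, C *
            (a (x, y, ξ - x, η - y) ^ 2 * brk (15 / 16) (T - ξ ^ 3 / 4 - η ^ 3 / 4 -
              3 * ξ * (x - ξ / 2) ^ 2 - 3 * η * (y - η / 2) ^ 2)) := by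
          gcongr with x y
          set S := T - ξ ^ 3 / 4 - η ^ 3 / 4 -
              3 * ξ * (x - ξ / 2) ^ 2 - 3 * η * (y - η / 2) ^ 2
          have e5 : ∫⁻ t, f (t, x, y) = a (x, y, ξ - x, η - y) ^ 2 *
              ∫⁻ t, brk (33 / 32) t * brk (15 / 16) (S - t) := by
            rw [← lintegral_const_mul _ (by fun_prop), ← lintegral_sub_right_eq_self
              (fun t => a (x, y, ξ - x, η - y) ^ 2 * (brk (33 / 32) t * brk (15 / 16) (S - t)))
              (x ^ 3 + y ^ 3)]
            refine lintegral_congr fun t => ?_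
            simp only [hf]
            rw [sub_add_eq_sub_sub]
          rw [e5, mul_left_comm]
          gcongr
          exact hC S
      _ = ENNReal.ofReal |(2 * Real.pi)⁻¹| ^ 3 * (C * ∫⁻ x, ∫⁻ y,
            (a (x, y, ξ - x, η - y) ^ 2 * brk (15 / 16) (T - ξ ^ 3 / 4 - η ^ 3 / 4 -
              3 * ξ * (x - ξ / 2) ^ 2 - 3 * η * (y - η / 2) ^ 2))) := by
          congr 1
          rw [← lintegral_const_mul' _ _ ENNReal.coe_ne_top]
          exact lintegral_congr fun x => lintegral_const_mul' _ _ ENNReal.coe_ne_top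
      _ ≤ ENNReal.ofReal |(2 * Real.pi)⁻¹| ^ 3 * (C * M) := by gcongr; exact h _ _ _
      _ = _ := by rw [ENNReal.ofReal]; push_cast; ring
  refine (TriBound.of_fiber (measurable_freqKernel ha) key).mono (fun _ _ => le_rfl) ?_
  rw [ENNReal.mul_rpow_of_nonneg _ _ (by norm_num), ENNReal.coe_rpow_of_nonneg _ (by norm_num)]

/-! ### Integrals over the fibers of the resonance function -/

theorem quadratic_eq {η : ℝ} (hη : η ≠ 0) (c t : ℝ) :
    c - 3 * η * t ^ 2 = (-3 * η) * (t ^ 2 - (1 / (3 * η)) * c) := by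
  field_simp; ring

theorem exists_lintegral_brk_fiber : ∃ C : ℝ≥0, ∀ c η y₀ : ℝ, η ≠ 0 →
    ∫⁻ y, brk (15 / 16) (c - 3 * η * (y - y₀) ^ 2) ≤
      C * ENNReal.ofReal (|η| ^ (-(1 / 2) : ℝ)) := by
  obtain ⟨C, hC⟩ := exists_lintegral_brk_quadratic (κ := 15 / 16) (by norm_num)
  refine ⟨C, fun c η y₀ hη => ?_⟩
  have hη' := abs_pos.2 hη
  rw [lintegral_sub_right_eq_self (fun y => brk (15 / 16) (c - 3 * η * y ^ 2)) y₀]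
  simp_rw [quadratic_eq hη]
  refine (hC _ _ (by simpa using hη)).trans ?_
  gcongr _ * ENNReal.ofReal ?_
  exact Real.rpow_le_rpow_of_nonpos hη' (by rw [abs_mul]; norm_num; linarith) (by norm_num)

theorem brk_quadratic_le_sing {κ : ℝ} (hκ : 0 ≤ κ) {η : ℝ} (hη : η ≠ 0) (c t : ℝ) :
    brk κ (c - 3 * η * t ^ 2) ≤
      ENNReal.ofReal (|(-3 * η)| ^ (-κ)) * sing κ (t ^ 2 - (1 / (3 * η)) * c) := by
  rw [quadratic_eq hη, ← sing_mul (by simpa using hη)]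
  exact brk_le_sing hκ _

/-- Compared with `exists_lintegral_brk_fiber`, the bound retains the decay of the resonance function
in the other variable, as the singular weight with the exponent `15/16 - 1/2 = 7/16`. -/
theorem exists_lintegral_brk_fiber_sing : ∃ C : ℝ≥0, ∀ c η y₀ : ℝ, η ≠ 0 →
    ∫⁻ y, brk (15 / 16) (c - 3 * η * (y - y₀) ^ 2) ≤
      C * (ENNReal.ofReal (|η| ^ (-(1 / 2) : ℝ)) * sing (7 / 16) c) := by
  obtain ⟨C, hC⟩ := exists_lintegral_sing_quadratic (κ := 15 / 16) (by norm_num) (by norm_num)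
  refine ⟨C, fun c η y₀ hη => ?_⟩
  have hη' := abs_pos.2 hη
  have h3 : |(-3 * η)| = 3 * |η| := by rw [abs_mul]; norm_num
  rw [lintegral_sub_right_eq_self (fun y => brk (15 / 16) (c - 3 * η * y ^ 2)) y₀]
  calc ∫⁻ y, brk (15 / 16) (c - 3 * η * y ^ 2)
      ≤ ∫⁻ y, ENNReal.ofReal (|(-3 * η)| ^ (-(15 / 16) : ℝ)) *
          sing (15 / 16) (y ^ 2 - (1 / (3 * η)) * c) :=
        lintegral_mono fun y => brk_quadratic_le_sing (by norm_num) hη c y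
    _ ≤ ENNReal.ofReal (|(-3 * η)| ^ (-(15 / 16) : ℝ)) *
          (C * sing (15 / 16 - 1 / 2) ((1 / (3 * η)) * c)) := by
        rw [lintegral_const_mul' _ _ ENNReal.ofReal_ne_top]
        gcongr
        exact hC _
    _ = C * (ENNReal.ofReal ((3 * |η|) ^ (-(1 / 2) : ℝ)) * sing (7 / 16) c) := by
        rw [sing_mul (by positivity), h3, show (15 / 16 - 1 / 2 : ℝ) = 7 / 16 by norm_num,
          show |1 / (3 * η)| = (3 * |η|)⁻¹ by rw [abs_div, abs_mul]; norm_num,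
          Real.inv_rpow (by positivity), ← Real.rpow_neg (by positivity),
          show (-(1 / 2) : ℝ) = -(15 / 16) + -(-(7 / 16)) by norm_num,
          Real.rpow_add (by positivity), ENNReal.ofReal_mul (by positivity)]
        ring
    _ ≤ _ := by
        gcongr _ * (ENNReal.ofReal ?_ * _)
        exact Real.rpow_le_rpow_of_nonpos hη' (by linarith) (by norm_num)

theorem setLIntegral_shift (g : ℝ → ℝ≥0∞) (y₀ : ℝ) (S : Set ℝ) :
    ∫⁻ y in (fun y => y - y₀) ⁻¹' S, g (y - y₀) = ∫⁻ y in S, g y :=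
  (measurePreserving_sub_right volume y₀).setLIntegral_comp_preimage_emb
    (MeasurableEquiv.subRight y₀).measurableEmbedding g S

/-- On a ball of radius `B` where the derivative of the quadratic polynomial is at least `u`. -/
theorem exists_lintegral_sing_fiber_ball {μ : ℝ} (hμ : 0 ≤ μ) (hμ' : μ < 1) :
    ∃ C : ℝ≥0, ∀ c η y₀ θ B u : ℝ, 0 < B → 0 < u →
      ∫⁻ y in {y | |y - θ| ≤ B ∧ u ≤ |η| * |y - y₀|}, sing μ (c - 3 * η * (y - y₀) ^ 2) ≤
        C * (ENNReal.ofReal (u ^ (-μ)) * ENNReal.ofReal (B ^ (1 - μ))) := by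
  obtain ⟨C, hC⟩ := exists_lintegral_sing_quadratic_ball hμ hμ'
  refine ⟨C, fun c η y₀ θ B u hB hu => ?_⟩
  rcases eq_or_ne η 0 with rfl | hη
  · simp [hu.not_ge]
  have hη' := abs_pos.2 hη
  have h3 : |(-3 * η)| = 3 * |η| := by rw [abs_mul]; norm_num
  have hset : {y | |y - θ| ≤ B ∧ u ≤ |η| * |y - y₀|} =
      (fun y => y - y₀) ⁻¹' {y | |y - (θ - y₀)| ≤ B ∧ u / |η| ≤ |y|} := by
    ext y
    simp only [Set.mem_ofPred_eq, Set.mem_preimage, sub_sub_sub_cancel_right]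
    rw [div_le_iff₀ hη', mul_comm]
  rw [hset, setLIntegral_shift (fun y => sing μ (c - 3 * η * y ^ 2))]
  simp_rw [quadratic_eq hη, sing_mul (show -3 * η ≠ 0 by simpa using hη)]
  rw [lintegral_const_mul' _ _ ENNReal.ofReal_ne_top]
  grw [hC B (θ - y₀) (u / |η|) _ hB (by positivity)]
  rw [mul_left_comm, ← mul_assoc (ENNReal.ofReal _), ← ENNReal.ofReal_mul (by positivity), h3,
    ← Real.mul_rpow (by positivity) (by positivity)]
  gcongr _ * (ENNReal.ofReal ?_ * _)
  refine Real.rpow_le_rpow_of_nonpos hu ?_ (by linarith)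
  rw [mul_assoc, mul_div_cancel₀ _ hη'.ne']
  linarith

theorem exists_lintegral_sing_fiber_ball' :
    ∃ C : ℝ≥0, ∀ c ξ x₀ θ A : ℝ, ξ ≠ 0 → 0 < A →
      ∫⁻ x in {x | |x - θ| ≤ A}, sing (7 / 16) (c - 3 * ξ * (x - x₀) ^ 2) ≤
        C * (ENNReal.ofReal (|ξ| ^ (-(7 / 16) : ℝ)) * ENNReal.ofReal (A ^ (1 / 8 : ℝ))) := by
  obtain ⟨C, hC⟩ := exists_lintegral_sing_quadratic_ball' (μ := 7 / 16) (by norm_num) (by norm_num)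
  refine ⟨C, fun c ξ x₀ θ A hξ hA => ?_⟩
  have hξ' := abs_pos.2 hξ
  have hset : {x | |x - θ| ≤ A} = (fun x => x - x₀) ⁻¹' {x | |x - (θ - x₀)| ≤ A} := by
    ext x
    simp only [Set.mem_ofPred_eq, Set.mem_preimage, sub_sub_sub_cancel_right]
  rw [hset, setLIntegral_shift (fun x => sing (7 / 16) (c - 3 * ξ * x ^ 2))]
  simp_rw [quadratic_eq hξ, sing_mul (show -3 * ξ ≠ 0 by simpa using hξ)]
  rw [lintegral_const_mul' _ _ ENNReal.ofReal_ne_top]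
  grw [hC A (θ - x₀) _ hA]
  rw [mul_left_comm]
  norm_num
  gcongr _ * (ENNReal.ofReal ?_ * _)
  exact Real.rpow_le_rpow_of_nonpos hξ' (by linarith) (by norm_num)

/-- The weight of the resonance function on the fiber over the output frequency `(ξ, η)`, with
`(x₀, y₀) = (ξ, η) / 2`. -/
def resWeight (c ξ η x₀ y₀ x y : ℝ) : ℝ≥0∞ :=
  brk (15 / 16) (c - 3 * ξ * (x - x₀) ^ 2 - 3 * η * (y - y₀) ^ 2)

theorem measurable_resWeight (c ξ η x₀ y₀ : ℝ) :
    Measurable (Function.uncurry (resWeight c ξ η x₀ y₀)) := by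
  have := measurable_brk (15 / 16)
  unfold Function.uncurry resWeight
  fun_prop

theorem resWeight_swap (c ξ η x₀ y₀ x y : ℝ) :
    resWeight c ξ η x₀ y₀ x y = resWeight c η ξ y₀ x₀ y x := by
  unfold resWeight; congr 1; ring

theorem volume_abs_sub_le (θ A : ℝ) : volume {x : ℝ | |x - θ| ≤ A} = 2 * ENNReal.ofReal A := by
  have : {x | |x - θ| ≤ A} = Metric.closedBall θ A := by
    ext x; simp [Real.dist_eq]
  rw [this, Real.volume_closedBall, ENNReal.ofReal_mul (by norm_num)]
  simp

/-- The strip in `x`, with the integral over the whole line in `y` taken first. -/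
theorem exists_resWeight_strip : ∃ C : ℝ≥0, ∀ c ξ η x₀ y₀ θ A : ℝ, η ≠ 0 →
    ∫⁻ x in {x | |x - θ| ≤ A}, ∫⁻ y, resWeight c ξ η x₀ y₀ x y ≤
      C * (ENNReal.ofReal (|η| ^ (-(1 / 2) : ℝ)) * ENNReal.ofReal A) := by
  obtain ⟨C, hC⟩ := exists_lintegral_brk_fiber
  refine ⟨C * 2, fun c ξ η x₀ y₀ θ A hη => ?_⟩
  calc _ ≤ ∫⁻ x in {x | |x - θ| ≤ A}, C * ENNReal.ofReal (|η| ^ (-(1 / 2) : ℝ)) :=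
        lintegral_mono fun x => hC _ _ _ hη
    _ = _ := by
        rw [setLIntegral_const, volume_abs_sub_le]; push_cast; ring

/-- After the integral over the whole line in `y`, the weight with exponent `7/16` that is left is
integrated over the interval in `x`. -/
theorem exists_resWeight_strip_gain : ∃ C : ℝ≥0, ∀ c ξ η x₀ y₀ θ A : ℝ, ξ ≠ 0 → η ≠ 0 → 0 < A →
    ∫⁻ x in {x | |x - θ| ≤ A}, ∫⁻ y, resWeight c ξ η x₀ y₀ x y ≤
      C * (ENNReal.ofReal (|η| ^ (-(1 / 2) : ℝ)) *
        (ENNReal.ofReal (|ξ| ^ (-(7 / 16) : ℝ)) * ENNReal.ofReal (A ^ (1 / 8 : ℝ)))) := by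
  obtain ⟨C, hC⟩ := exists_lintegral_brk_fiber_sing
  obtain ⟨C', hC'⟩ := exists_lintegral_sing_fiber_ball'
  refine ⟨C * C', fun c ξ η x₀ y₀ θ A hξ hη hA => ?_⟩
  calc _ ≤ ∫⁻ x in {x | |x - θ| ≤ A}, C * (ENNReal.ofReal (|η| ^ (-(1 / 2) : ℝ)) *
          sing (7 / 16) (c - 3 * ξ * (x - x₀) ^ 2)) :=
        lintegral_mono fun x => hC _ _ _ hη
    _ = C * (ENNReal.ofReal (|η| ^ (-(1 / 2) : ℝ)) * ∫⁻ x in {x | |x - θ| ≤ A},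
          sing (7 / 16) (c - 3 * ξ * (x - x₀) ^ 2)) := by
        rw [lintegral_const_mul' _ _ ENNReal.coe_ne_top,
          lintegral_const_mul' _ _ ENNReal.ofReal_ne_top]
    _ ≤ _ := by
        grw [hC' c ξ x₀ θ A hξ hA]
        apply le_of_eq
        push_cast; ring

/-- The integral in `y` alone, where the derivative of the resonance function in `y` is at least
`u` up to a constant. -/
theorem exists_resWeight_ball : ∃ C : ℝ≥0, ∀ c ξ η x₀ y₀ θ B u x : ℝ, 0 < B → 0 < u →
    ∫⁻ y in {y | |y - θ| ≤ B ∧ u ≤ |η| * |y - y₀|}, resWeight c ξ η x₀ y₀ x y ≤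
      C * (ENNReal.ofReal (u ^ (-(15 / 16) : ℝ)) * ENNReal.ofReal (B ^ (1 / 16 : ℝ))) := by
  obtain ⟨C, hC⟩ := exists_lintegral_sing_fiber_ball (μ := 15 / 16) (by norm_num) (by norm_num)
  refine ⟨C, fun c ξ η x₀ y₀ θ B u x hB hu => ?_⟩
  refine (lintegral_mono fun y => brk_le_sing (by norm_num) _).trans ?_
  refine (hC _ η y₀ θ B u hB hu).trans ?_
  norm_num

/-- The integral in `y` is taken first, and the interval in `x` only contributes its length. -/
theorem exists_resWeight_box : ∃ C : ℝ≥0, ∀ c ξ η x₀ y₀ θ A θ' B u : ℝ, 0 < B → 0 < u →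
    ∫⁻ x in {x | |x - θ| ≤ A}, ∫⁻ y in {y | |y - θ'| ≤ B ∧ u ≤ |η| * |y - y₀|},
      resWeight c ξ η x₀ y₀ x y ≤
      C * (ENNReal.ofReal A *
        (ENNReal.ofReal (u ^ (-(15 / 16) : ℝ)) * ENNReal.ofReal (B ^ (1 / 16 : ℝ)))) := by
  obtain ⟨C, hC⟩ := exists_resWeight_ball
  refine ⟨C * 2, fun c ξ η x₀ y₀ θ A θ' B u hB hu => ?_⟩
  refine (lintegral_mono fun x => hC c ξ η x₀ y₀ θ' B u x hB hu).trans ?_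
  rw [setLIntegral_const, volume_abs_sub_le]
  apply le_of_eq
  push_cast; ring

/-- The integral over the whole line in `x` is taken first, and then the weight with exponent `7/16`
that is left is integrated in `y`. -/
theorem exists_resWeight_box_gain : ∃ C : ℝ≥0, ∀ c ξ η x₀ y₀ θ B u : ℝ, ξ ≠ 0 → 0 < B → 0 < u →
    ∫⁻ x, ∫⁻ y in {y | |y - θ| ≤ B ∧ u ≤ |η| * |y - y₀|}, resWeight c ξ η x₀ y₀ x y ≤
      C * (ENNReal.ofReal (|ξ| ^ (-(1 / 2) : ℝ)) *
        (ENNReal.ofReal (u ^ (-(7 / 16) : ℝ)) * ENNReal.ofReal (B ^ (9 / 16 : ℝ)))) := by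
  obtain ⟨C, hC⟩ := exists_lintegral_brk_fiber_sing
  obtain ⟨C', hC'⟩ := exists_lintegral_sing_fiber_ball (μ := 7 / 16) (by norm_num) (by norm_num)
  refine ⟨C * C', fun c ξ η x₀ y₀ θ B u hξ hB hu => ?_⟩
  rw [lintegral_lintegral_swap (measurable_resWeight c ξ η x₀ y₀).aemeasurable]
  calc _ ≤ ∫⁻ y in {y | |y - θ| ≤ B ∧ u ≤ |η| * |y - y₀|},
          C * (ENNReal.ofReal (|ξ| ^ (-(1 / 2) : ℝ)) *
            sing (7 / 16) (c - 3 * η * (y - y₀) ^ 2)) := by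
        refine lintegral_mono fun y => ?_
        simp_rw [resWeight_swap c ξ η x₀ y₀]
        exact hC (c - 3 * η * (y - y₀) ^ 2) ξ x₀ hξ
    _ = C * (ENNReal.ofReal (|ξ| ^ (-(1 / 2) : ℝ)) *
          ∫⁻ y in {y | |y - θ| ≤ B ∧ u ≤ |η| * |y - y₀|},
            sing (7 / 16) (c - 3 * η * (y - y₀) ^ 2)) := by
        rw [lintegral_const_mul' _ _ ENNReal.coe_ne_top,
          lintegral_const_mul' _ _ ENNReal.ofReal_ne_top]
    _ ≤ _ := by
        grw [hC' c η y₀ θ B u hB hu]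
        apply le_of_eq
        push_cast; norm_num; ring

/-- The strip in `y`, with the integral over the whole line in `x` taken first. -/
theorem exists_resWeight_strip' : ∃ C : ℝ≥0, ∀ c ξ η x₀ y₀ θ B : ℝ, ξ ≠ 0 →
    ∫⁻ x, ∫⁻ y in {y | |y - θ| ≤ B}, resWeight c ξ η x₀ y₀ x y ≤
      C * (ENNReal.ofReal (|ξ| ^ (-(1 / 2) : ℝ)) * ENNReal.ofReal B) := by
  obtain ⟨C, hC⟩ := exists_resWeight_strip
  refine ⟨C, fun c ξ η x₀ y₀ θ B hξ => ?_⟩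
  rw [lintegral_lintegral_swap (measurable_resWeight c ξ η x₀ y₀).aemeasurable]
  simp_rw [resWeight_swap c ξ η x₀ y₀]
  exact hC _ _ _ _ _ _ _ hξ

/-! ### Localization of the input frequencies -/

/-- The size `max (1, |ξ|, |η|)` of a frequency. -/
def freqSize (ξ η : ℝ) : ℝ := max 1 (max |ξ| |η|)

theorem one_le_freqSize (ξ η : ℝ) : 1 ≤ freqSize ξ η := le_max_left _ _
theorem abs_left_le_freqSize (ξ η : ℝ) : |ξ| ≤ freqSize ξ η :=
  (le_max_left _ _).trans (le_max_right _ _)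
theorem abs_right_le_freqSize (ξ η : ℝ) : |η| ≤ freqSize ξ η :=
  (le_max_right _ _).trans (le_max_right _ _)

/-- The size of the larger of the two input frequencies `v = (ξ₁, η₁, ξ₂, η₂)`. -/
def maxSize (v : ℝ × ℝ × ℝ × ℝ) : ℝ := max (freqSize v.1 v.2.1) (freqSize v.2.2.1 v.2.2.2)

theorem one_le_maxSize (v : ℝ × ℝ × ℝ × ℝ) : 1 ≤ maxSize v :=
  (one_le_freqSize _ _).trans (le_max_left _ _)

/-- The frequency weight `n₁ ^ (-1/4) n₂ ^ (1/2)` of the bilinear estimate. -/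
def freqWeight (v : ℝ × ℝ × ℝ × ℝ) : ℝ≥0∞ :=
  ENNReal.ofReal (freqSize v.1 v.2.1 ^ (-(1 / 4) : ℝ) * freqSize v.2.2.1 v.2.2.2 ^ (1 / 2 : ℝ))

@[fun_prop] theorem measurable_freqSize : Measurable fun v : ℝ × ℝ => freqSize v.1 v.2 := by
  unfold freqSize; fun_prop

@[fun_prop] theorem measurable_maxSize : Measurable maxSize := by
  unfold maxSize freqSize; fun_prop

@[fun_prop] theorem measurable_freqWeight : Measurable freqWeight := by
  unfold freqWeight freqSize; fun_prop

theorem freqWeight_sq (v : ℝ × ℝ × ℝ × ℝ) : freqWeight v ^ 2 =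
    ENNReal.ofReal (freqSize v.1 v.2.1 ^ (-(1 / 2) : ℝ) * freqSize v.2.2.1 v.2.2.2) := by
  have h1 := one_le_freqSize v.1 v.2.1
  have h2 := one_le_freqSize v.2.2.1 v.2.2.2
  rw [freqWeight, ← ENNReal.ofReal_pow (by positivity), mul_pow, ← Real.rpow_natCast,
    ← Real.rpow_natCast, ← Real.rpow_mul (by positivity), ← Real.rpow_mul (by positivity)]
  norm_num

/-- If the first input is comparable to the larger one, the squared weight is at most the square root
of the size. -/
theorem freqWeight_sq_le {v : ℝ × ℝ × ℝ × ℝ} {m : ℝ} (h : maxSize v / 2 ≤ |v.2.1|)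
    (hm : maxSize v ≤ 4 * m) : freqWeight v ^ 2 ≤ ENNReal.ofReal (4 * m ^ (1 / 2 : ℝ)) := by
  rw [freqWeight_sq]
  have h0 := one_le_maxSize v
  have h1 : maxSize v / 2 ≤ freqSize v.1 v.2.1 := h.trans (abs_right_le_freqSize _ _)
  have h2 : freqSize v.2.2.1 v.2.2.2 ≤ maxSize v := le_max_right _ _
  refine ENNReal.ofReal_le_ofReal ?_
  have hm0 : 0 ≤ m := by linarith
  have e : (4 * m) ^ (1 / 2 : ℝ) = 2 * m ^ (1 / 2 : ℝ) := by
    rw [Real.mul_rpow (by norm_num) hm0, ← Real.sqrt_eq_rpow,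
      show (4 : ℝ) = 2 ^ 2 by norm_num, Real.sqrt_sq (by norm_num)]
  have e2 : (1 / 2 : ℝ) ^ (-(1 / 2) : ℝ) ≤ 2 := by
    have := Real.rpow_le_rpow_of_exponent_ge (x := 1 / 2) (by norm_num) (by norm_num)
      (show (-1 : ℝ) ≤ -(1 / 2) by norm_num)
    rw [Real.rpow_neg_one] at this
    linarith
  calc freqSize v.1 v.2.1 ^ (-(1 / 2) : ℝ) * freqSize v.2.2.1 v.2.2.2
      ≤ (maxSize v / 2) ^ (-(1 / 2) : ℝ) * maxSize v := by
        refine mul_le_mul (Real.rpow_le_rpow_of_nonpos (by positivity) h1 (by norm_num)) h2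
          (zero_le_one.trans (one_le_freqSize _ _)) (by positivity)
    _ = (1 / 2 : ℝ) ^ (-(1 / 2) : ℝ) * maxSize v ^ (1 / 2 : ℝ) := by
        rw [div_eq_mul_one_div, Real.mul_rpow (by positivity) (by norm_num), mul_right_comm]
        nth_rewrite 2 [← Real.rpow_one (maxSize v)]
        rw [← Real.rpow_add (by positivity)]
        norm_num
        ring
    _ ≤ 2 * (4 * m) ^ (1 / 2 : ℝ) := by gcongr
    _ = _ := by rw [e]; ring

/-- The kernel of the bilinear estimate on the region `R` of input frequencies. -/
def regionKernel (R : Set (ℝ × ℝ × ℝ × ℝ)) : SpaceTime → SpaceTime → ℝ≥0∞ :=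
  freqKernel (R.indicator freqWeight)

theorem measurable_regionKernel {R : Set (ℝ × ℝ × ℝ × ℝ)} (hR : MeasurableSet R) :
    Measurable (Function.uncurry (regionKernel R)) :=
  measurable_freqKernel (measurable_freqWeight.indicator hR)

theorem regionKernel_ne_zero {R : Set (ℝ × ℝ × ℝ × ℝ)} {z₁ z₂ : SpaceTime}
    (h : regionKernel R z₁ z₂ ≠ 0) : (freqX z₁, freqY z₁, freqX z₂, freqY z₂) ∈ R := by
  by_contra h'
  exact h (by simp [regionKernel, freqKernel, Set.indicator_of_notMem h'])

theorem regionKernel_mul_indicator_le (R : Set (ℝ × ℝ × ℝ × ℝ)) {Q : Set (ℝ × ℝ × ℝ × ℝ)}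
    {z₁ z₂ : SpaceTime} {e : ℝ≥0∞} (he : e ≤ 1)
    (hQ : e ≠ 0 → (freqX z₁, freqY z₁, freqX z₂, freqY z₂) ∈ Q) :
    regionKernel R z₁ z₂ * e ≤ regionKernel (R ∩ Q) z₁ z₂ := by
  rcases eq_or_ne e 0 with rfl | h0
  · simp
  · refine (mul_le_mul_right he _).trans ?_
    rw [mul_one]
    unfold regionKernel freqKernel
    refine mul_le_mul_left ?_ _
    by_cases h1 : (freqX z₁, freqY z₁, freqX z₂, freqY z₂) ∈ R
    · rw [Set.indicator_of_mem h1, Set.indicator_of_mem (show _ ∈ R ∩ Q from ⟨h1, hQ h0⟩)]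
    · rw [Set.indicator_of_notMem h1]; exact zero_le

theorem indicator_one_le {α : Type*} (S : Set α) (x : α) : S.indicator (1 : α → ℝ≥0∞) x ≤ 1 := by
  by_cases h : x ∈ S <;> simp [h]

theorem mem_of_indicator_one_ne_zero {α : Type*} {S : Set α} {x : α}
    (h : S.indicator (1 : α → ℝ≥0∞) x ≠ 0) : x ∈ S := by
  by_contra h'; simp [h'] at h

/-- If the two coordinates add up to a number of size at most `A`, one may localize each of them
to intervals of length comparable to `A`. -/
theorem TriBound.localize_box {k : SpaceTime → SpaceTime → ℝ≥0∞}
    (hm : Measurable (Function.uncurry k)) {π : SpaceTime → ℝ} (hπ : Measurable π) {A : ℝ}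
    (hA : 0 < A) (hk : ∀ z₁ z₂, k z₁ z₂ ≠ 0 → |π z₁ + π z₂| ≤ A) {K : ℝ≥0∞}
    (h : ∀ θ, TriBound (fun z₁ z₂ => k z₁ z₂ *
      {p : ℝ × ℝ | |p.2 - p.1| ≤ A}.indicator 1 (θ, π z₁)) K) :
    TriBound k (K * 2) := by
  have hA2 : ENNReal.ofReal (2 * A) ≠ 0 := by simpa using hA
  have hS : MeasurableSet {p : ℝ × ℝ | |p.2 - p.1| ≤ A} :=
    measurableSet_le (by fun_prop) (by fun_prop)
  have hS' : MeasurableSet {p : ℝ × ℝ | |p.2 + p.1| ≤ 2 * A} :=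
    measurableSet_le (by fun_prop) (by fun_prop)
  have hI : ∀ x, ∫⁻ θ, (ENNReal.ofReal (2 * A))⁻¹ *
      {p : ℝ × ℝ | |p.2 - p.1| ≤ A}.indicator 1 (θ, x) = 1 := by
    intro x
    have e : ∀ θ, {p : ℝ × ℝ | |p.2 - p.1| ≤ A}.indicator (1 : ℝ × ℝ → ℝ≥0∞) (θ, x) =
        {θ | |θ - x| ≤ A}.indicator 1 θ := by
      intro θ; simp [Set.indicator, abs_sub_comm]
    simp_rw [e]
    rw [lintegral_const_mul' _ _ (by simpa using hA), lintegral_indicator_one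
      (measurableSet_le (by fun_prop) (by fun_prop)), volume_abs_sub_le,
      ENNReal.ofReal_mul (by norm_num)]
    rw [show ENNReal.ofReal 2 = 2 by simp]
    refine ENNReal.inv_mul_cancel ?_ ?_
    · simpa using hA
    · exact ENNReal.mul_ne_top (by simp) (by simp)
  have hI' : ∀ x, ∫⁻ θ, (ENNReal.ofReal (2 * A))⁻¹ *
      {p : ℝ × ℝ | |p.2 + p.1| ≤ 2 * A}.indicator 1 (θ, x) = 2 := by
    intro x
    have e : ∀ θ, {p : ℝ × ℝ | |p.2 + p.1| ≤ 2 * A}.indicator (1 : ℝ × ℝ → ℝ≥0∞) (θ, x) =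
        {θ | |θ - (-x)| ≤ 2 * A}.indicator 1 θ := by
      intro θ; simp [Set.indicator, add_comm]
    simp_rw [e]
    rw [lintegral_const_mul' _ _ (by simpa using hA), lintegral_indicator_one
      (measurableSet_le (by fun_prop) (by fun_prop)), volume_abs_sub_le, mul_comm, mul_assoc,
      ENNReal.mul_inv_cancel hA2 ENNReal.ofReal_ne_top, mul_one]
  refine (TriBound.localize hm hπ hS hS' (w := fun _ => (ENNReal.ofReal (2 * A))⁻¹)
    measurable_const (fun x => (hI x).le) (fun x => (hI' x).le) ?_ h).mono
    (fun _ _ => le_rfl) ?_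
  · intro z₁ z₂ hz
    rw [← hI (π z₁)]
    refine lintegral_mono fun θ => ?_
    gcongr
    by_cases h1 : |π z₁ - θ| ≤ A
    · have h2 : |π z₂ + θ| ≤ 2 * A := by
        have := abs_sub (π z₁ + π z₂) (π z₁ - θ)
        rw [show π z₁ + π z₂ - (π z₁ - θ) = π z₂ + θ by ring] at this
        linarith [hk z₁ z₂ hz]
      simp [h1, h2]
    · simp [h1]
  · gcongr
    rw [one_mul]
    calc (2 : ℝ≥0∞) ^ (1 / 2 : ℝ) ≤ 2 ^ (1 : ℝ) :=
          ENNReal.rpow_le_rpow_of_exponent_le (by norm_num) (by norm_num)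
      _ = 2 := by simp

/-- If the two coordinates are comparable, one may localize them to a dyadic scale `θ`. The scales are
integrated against the scale invariant measure `dθ / θ`. -/
theorem TriBound.localize_scale {k : SpaceTime → SpaceTime → ℝ≥0∞}
    (hm : Measurable (Function.uncurry k)) {π : SpaceTime → ℝ} (hπ : Measurable π)
    (hk : ∀ z₁ z₂, k z₁ z₂ ≠ 0 → π z₁ ≠ 0 ∧ |π z₁| ≤ 2 * |π z₂| ∧ |π z₂| ≤ 2 * |π z₁|) {K : ℝ≥0∞}
    (h : ∀ θ, TriBound (fun z₁ z₂ => k z₁ z₂ *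
      {p : ℝ × ℝ | 0 < p.1 ∧ p.1 ≤ |p.2| ∧ |p.2| ≤ 2 * p.1}.indicator 1 (θ, π z₁)) K) :
    TriBound k (K * 28) := by
  set w : ℝ → ℝ≥0∞ := fun θ => ENNReal.ofReal (2 / θ) with hw
  have m1 : MeasurableSet {p : ℝ × ℝ | 0 < p.1} := measurableSet_lt (by fun_prop) (by fun_prop)
  have m2 : MeasurableSet {p : ℝ × ℝ | p.1 ≤ |p.2|} :=
    measurableSet_le (by fun_prop) (by fun_prop)
  have m3 : MeasurableSet {p : ℝ × ℝ | |p.2| ≤ 2 * p.1} :=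
    measurableSet_le (by fun_prop) (by fun_prop)
  have m4 : MeasurableSet {p : ℝ × ℝ | p.1 / 2 ≤ |p.2|} :=
    measurableSet_le (by fun_prop) (by fun_prop)
  have m5 : MeasurableSet {p : ℝ × ℝ | |p.2| ≤ 4 * p.1} :=
    measurableSet_le (by fun_prop) (by fun_prop)
  have hS : MeasurableSet {p : ℝ × ℝ | 0 < p.1 ∧ p.1 ≤ |p.2| ∧ |p.2| ≤ 2 * p.1} :=
    m1.inter (m2.inter m3)
  have hS' : MeasurableSet {p : ℝ × ℝ | 0 < p.1 ∧ p.1 / 2 ≤ |p.2| ∧ |p.2| ≤ 4 * p.1} :=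
    m1.inter (m4.inter m5)
  have hI' : ∀ x, ∫⁻ θ, w θ *
      {p : ℝ × ℝ | 0 < p.1 ∧ p.1 / 2 ≤ |p.2| ∧ |p.2| ≤ 4 * p.1}.indicator 1 (θ, x) ≤ 16 := by
    intro x
    rcases eq_or_ne x 0 with rfl | hx
    · have e : ∀ θ, w θ * {p : ℝ × ℝ | 0 < p.1 ∧ p.1 / 2 ≤ |p.2| ∧ |p.2| ≤ 4 * p.1}.indicator
          (1 : ℝ × ℝ → ℝ≥0∞) (θ, 0) = 0 := by
        intro θ
        rw [Set.indicator_of_notMem, mul_zero]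
        rintro ⟨h1, h2, -⟩
        simp only [abs_zero] at h1 h2
        linarith
      simp_rw [e]
      simp
    have hx' := abs_pos.2 hx
    calc _ ≤ ∫⁻ θ, (Set.Icc (|x| / 4) (2 * |x|)).indicator
          (fun _ => ENNReal.ofReal (8 / |x|)) θ := by
          refine lintegral_mono fun θ => ?_
          by_cases h1 : (θ, x) ∈ {p : ℝ × ℝ | 0 < p.1 ∧ p.1 / 2 ≤ |p.2| ∧ |p.2| ≤ 4 * p.1}
          · have h2 := h1
            obtain ⟨h3, h4, h5⟩ := h2
            simp only at h3 h4 h5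
            rw [Set.indicator_of_mem h1, Set.indicator_of_mem
              (show θ ∈ Set.Icc (|x| / 4) (2 * |x|) from ⟨by linarith, by linarith⟩)]
            simp only [Pi.one_apply, mul_one, hw]
            refine ENNReal.ofReal_le_ofReal ?_
            rw [div_le_div_iff₀ h3 hx']
            linarith
          · rw [Set.indicator_of_notMem h1]; simp
      _ = ENNReal.ofReal (8 / |x| * (2 * |x| - |x| / 4)) := by
          rw [lintegral_indicator_const measurableSet_Icc, Real.volume_Icc,
            ← ENNReal.ofReal_mul (by positivity)]
      _ ≤ ENNReal.ofReal 16 := by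
          refine ENNReal.ofReal_le_ofReal ?_
          field_simp
          norm_num
      _ = 16 := by simp
  have hI : ∀ x, ∫⁻ θ, w θ *
      {p : ℝ × ℝ | 0 < p.1 ∧ p.1 ≤ |p.2| ∧ |p.2| ≤ 2 * p.1}.indicator 1 (θ, x) ≤ 16 := by
    intro x
    refine (lintegral_mono fun θ => mul_le_mul_right ?_ _).trans (hI' x)
    refine Set.indicator_le_indicator_of_subset ?_ (fun _ => zero_le) (θ, x)
    rintro ⟨a, b⟩ ⟨h1, h2, h3⟩
    simp only at h1 h2 h3
    refine ⟨h1, ?_, ?_⟩ <;> simp only <;> linarith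
  refine (TriBound.localize hm hπ hS hS' (w := w) (by fun_prop) hI hI' ?_ h).mono
    (fun _ _ => le_rfl) ?_
  · intro z₁ z₂ hz
    obtain ⟨h1, h2, h3⟩ := hk z₁ z₂ hz
    have hx' := abs_pos.2 h1
    calc (1 : ℝ≥0∞) = ENNReal.ofReal (2 / |π z₁| * (|π z₁| - |π z₁| / 2)) := by
          rw [← ENNReal.ofReal_one]; congr 1; field_simp; norm_num
      _ = ∫⁻ θ, (Set.Icc (|π z₁| / 2) |π z₁|).indicator (fun _ => ENNReal.ofReal (2 / |π z₁|)) θ := by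
          rw [lintegral_indicator_const measurableSet_Icc, Real.volume_Icc,
            ← ENNReal.ofReal_mul (by positivity)]
      _ ≤ _ := by
          refine lintegral_mono fun θ => ?_
          by_cases hθ : θ ∈ Set.Icc (|π z₁| / 2) |π z₁|
          · have h4 := hθ.1
            have h5 := hθ.2
            have hθ0 : 0 < θ := by linarith
            rw [Set.indicator_of_mem hθ, Set.indicator_of_mem, Set.indicator_of_mem]
            · simp only [Pi.one_apply, mul_one, hw]
              refine ENNReal.ofReal_le_ofReal ?_
              rw [div_le_div_iff₀ hx' hθ0]
              linarith
            · refine ⟨hθ0, ?_, ?_⟩ <;> simp only <;> linarith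
            · refine ⟨hθ0, ?_, ?_⟩ <;> simp only <;> linarith
          · rw [Set.indicator_of_notMem hθ]; exact zero_le
  · gcongr
    calc (16 * 16 : ℝ≥0∞) ^ (1 / 2 : ℝ) = 16 := by rw [← sq, sq_rpow_half]
      _ ≤ 28 := by norm_num

/-- Where `|ξ₁ + ξ₂| ≤ A`, one may restrict `ξ₁` to an interval of length `2 A`. -/
theorem triBound_region_localize_X {R : Set (ℝ × ℝ × ℝ × ℝ)} (hR : MeasurableSet R) {A : ℝ}
    (hA : 0 < A) (hRA : ∀ v ∈ R, |v.1 + v.2.2.1| ≤ A) {K : ℝ≥0∞}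
    (h : ∀ θ, TriBound (regionKernel (R ∩ {v | |v.1 - θ| ≤ A})) K) :
    TriBound (regionKernel R) (K * 2) :=
  TriBound.localize_box (measurable_regionKernel hR) measurable_freqX hA
    (fun _ _ hz => hRA _ (regionKernel_ne_zero hz)) fun θ =>
    (h θ).mono (fun _ _ => regionKernel_mul_indicator_le R (indicator_one_le _ _)
      fun h0 => mem_of_indicator_one_ne_zero h0) le_rfl

/-- Where `|η₁ + η₂| ≤ A`, one may restrict `η₁` to an interval of length `2 A`. -/
theorem triBound_region_localize_Y {R : Set (ℝ × ℝ × ℝ × ℝ)} (hR : MeasurableSet R) {A : ℝ}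
    (hA : 0 < A) (hRA : ∀ v ∈ R, |v.2.1 + v.2.2.2| ≤ A) {K : ℝ≥0∞}
    (h : ∀ θ, TriBound (regionKernel (R ∩ {v | |v.2.1 - θ| ≤ A})) K) :
    TriBound (regionKernel R) (K * 2) :=
  TriBound.localize_box (measurable_regionKernel hR) measurable_freqY hA
    (fun _ _ hz => hRA _ (regionKernel_ne_zero hz)) fun θ =>
    (h θ).mono (fun _ _ => regionKernel_mul_indicator_le R (indicator_one_le _ _)
      fun h0 => mem_of_indicator_one_ne_zero h0) le_rfl

/-- Where `|η₁|` and `|η₂|` are comparable, one may restrict `|η₁|` to `[θ, 2 θ]`. -/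
theorem triBound_region_localize_scale {R : Set (ℝ × ℝ × ℝ × ℝ)} (hR : MeasurableSet R)
    (hR' : ∀ v ∈ R, v.2.1 ≠ 0 ∧ |v.2.1| ≤ 2 * |v.2.2.2| ∧ |v.2.2.2| ≤ 2 * |v.2.1|) {K : ℝ≥0∞}
    (h : ∀ θ, 0 < θ → TriBound (regionKernel (R ∩ {v | θ ≤ |v.2.1| ∧ |v.2.1| ≤ 2 * θ})) K) :
    TriBound (regionKernel R) (K * 28) := by
  refine TriBound.localize_scale (measurable_regionKernel hR) measurable_freqY
    (fun z₁ z₂ hz => hR' _ (regionKernel_ne_zero hz)) fun θ => ?_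
  by_cases hθ : 0 < θ
  · exact (h θ hθ).mono (fun z₁ z₂ => regionKernel_mul_indicator_le R (indicator_one_le _ _)
      fun h0 => (mem_of_indicator_one_ne_zero h0).2) le_rfl
  · intro F G H _ _ _
    have e : ∀ z₁ : SpaceTime, {p : ℝ × ℝ | 0 < p.1 ∧ p.1 ≤ |p.2| ∧ |p.2| ≤ 2 * p.1}.indicator
        (1 : ℝ × ℝ → ℝ≥0∞) (θ, freqY z₁) = 0 := fun z₁ =>
      Set.indicator_of_notMem (fun h0 => hθ h0.1) _
    simp [e]

/-- The dyadic shells `[0, 2], [2, 4], [4, 8], …` for the absolute value. -/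
def shell (j : ℕ) : Set ℝ := {x | (j = 0 ∨ 2 ^ j ≤ |x|) ∧ |x| ≤ 2 ^ (j + 1)}

theorem measurableSet_shell (j : ℕ) : MeasurableSet (shell j) :=
  (((MeasurableSet.const (j = 0)).union
    (measurableSet_le (f := fun _ : ℝ => (2 : ℝ) ^ j) (by fun_prop) (by fun_prop : Measurable fun x : ℝ => |x|)))).inter
    (measurableSet_le (by fun_prop : Measurable fun x : ℝ => |x|) (by fun_prop))

theorem exists_mem_shell (x : ℝ) : ∃ j, x ∈ shell j := by
  rcases le_or_gt |x| 2 with h | h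
  · exact ⟨0, Or.inl rfl, by simpa using h⟩
  · obtain ⟨n, h1, h2⟩ := exists_nat_pow_near (x := |x|) (y := 2) (by linarith) (by norm_num)
    exact ⟨n, Or.inr h1, h2.le⟩

/-- Dyadic decomposition according to the size of `f`, without orthogonality: the bounds are summed. -/
theorem triBound_region_sum_shell {R : Set (ℝ × ℝ × ℝ × ℝ)} (hR : MeasurableSet R)
    {f : ℝ × ℝ × ℝ × ℝ → ℝ} (hf : Measurable f) {K : ℕ → ℝ≥0∞}
    (h : ∀ j, TriBound (regionKernel (R ∩ {v | f v ∈ shell j})) (K j)) :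
    TriBound (regionKernel R) (∑' j, K j) := by
  refine (TriBound.tsum (fun j => measurable_regionKernel
    (hR.inter (hf (measurableSet_shell j)))) h).mono (fun z₁ z₂ => ?_) le_rfl
  obtain ⟨j, hj⟩ := exists_mem_shell (f (freqX z₁, freqY z₁, freqX z₂, freqY z₂))
  refine le_trans ?_ (ENNReal.le_tsum j)
  have := regionKernel_mul_indicator_le R (Q := {v | f v ∈ shell j}) (z₁ := z₁) (z₂ := z₂)
    (e := 1) le_rfl (fun _ => hj)
  rwa [mul_one] at this

theorem lintegral_mul_le_box {a g : ℝ → ℝ → ℝ≥0∞} {W : ℝ≥0∞} (hW : W ≠ ⊤) {S T : Set ℝ}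
    (hS : MeasurableSet S) (hT : MeasurableSet T)
    (h : ∀ x y, a x y ≠ 0 → x ∈ S ∧ y ∈ T ∧ a x y ≤ W) :
    ∫⁻ x, ∫⁻ y, a x y * g x y ≤ W * ∫⁻ x in S, ∫⁻ y in T, g x y := by
  rw [← lintegral_indicator hS, ← lintegral_const_mul' _ _ hW]
  refine lintegral_mono fun x => ?_
  by_cases hx : x ∈ S
  · rw [Set.indicator_of_mem hx, ← lintegral_indicator hT, ← lintegral_const_mul' _ _ hW]
    refine lintegral_mono fun y => ?_
    by_cases h0 : a x y = 0
    · simp [h0]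
    · obtain ⟨-, h2, h3⟩ := h x y h0
      rw [Set.indicator_of_mem h2]
      gcongr
  · have : ∀ y, a x y * g x y = 0 := by
      intro y
      by_contra h0
      exact hx (h x y (left_ne_zero_of_mul h0)).1
    simp [this]

/-! ### The fiber criterion for regions of input frequencies -/

/-- The kernel on a region `R` is bounded if the integrals of the resonance weight over the fibers of
`R` are, uniformly in the output frequency. -/
theorem exists_triBound_region : ∃ C : ℝ≥0, ∀ R : Set (ℝ × ℝ × ℝ × ℝ), MeasurableSet R →
    ∀ M : ℝ≥0∞, (∀ c ξ η : ℝ, ∫⁻ x, ∫⁻ y, R.indicator freqWeight (x, y, ξ - x, η - y) ^ 2 *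
      resWeight c ξ η (ξ / 2) (η / 2) x y ≤ M) →
    TriBound (regionKernel R) (C * M ^ (1 / 2 : ℝ)) := by
  obtain ⟨C, hC⟩ := exists_triBound_freqKernel
  exact ⟨C, fun R hR M h => hC _ (measurable_freqWeight.indicator hR) M h⟩

theorem fiberPoint_indicator_sq_ne_zero {R : Set (ℝ × ℝ × ℝ × ℝ)} {v : ℝ × ℝ × ℝ × ℝ}
    (h : R.indicator freqWeight v ^ 2 ≠ 0) : v ∈ R := by
  by_contra h'
  simp [Set.indicator_of_notMem h'] at h

theorem indicator_freqWeight_sq_le (R : Set (ℝ × ℝ × ℝ × ℝ)) (v : ℝ × ℝ × ℝ × ℝ) :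
    R.indicator freqWeight v ^ 2 ≤ freqWeight v ^ 2 := by
  gcongr
  exact Set.indicator_le_self' (fun _ _ => zero_le) v

theorem measurableSet_strip (θ A : ℝ) : MeasurableSet {x : ℝ | |x - θ| ≤ A} :=
  measurableSet_le (by fun_prop) (by fun_prop)

theorem measurableSet_ball_slope (θ B u η y₀ : ℝ) :
    MeasurableSet {y : ℝ | |y - θ| ≤ B ∧ u ≤ |η| * |y - y₀|} :=
  (measurableSet_strip θ B).inter
    (measurableSet_le (by fun_prop) (by fun_prop : Measurable fun y : ℝ => |η| * |y - y₀|))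

theorem resWeight_le_one (c ξ η x₀ y₀ x y : ℝ) : resWeight c ξ η x₀ y₀ x y ≤ 1 :=
  brk_le_one (by norm_num) _

theorem lintegral_resWeight_box_le (c ξ η x₀ y₀ θ A θ' B : ℝ) :
    ∫⁻ x in {x | |x - θ| ≤ A}, ∫⁻ y in {y | |y - θ'| ≤ B}, resWeight c ξ η x₀ y₀ x y ≤
      4 * (ENNReal.ofReal A * ENNReal.ofReal B) := by
  calc _ ≤ ∫⁻ x in {x | |x - θ| ≤ A}, ∫⁻ y in {y | |y - θ'| ≤ B}, 1 :=
        lintegral_mono fun x => lintegral_mono fun y => resWeight_le_one _ _ _ _ _ _ _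
    _ = _ := by
        rw [setLIntegral_const, setLIntegral_const, volume_abs_sub_le, volume_abs_sub_le]
        ring

/-! ### Low frequencies -/

theorem exists_triBound_low :
    ∃ C : ℝ≥0, TriBound (regionKernel {v | maxSize v ≤ 1}) C := by
  obtain ⟨C, hC⟩ := exists_triBound_region
  refine ⟨C * 4 ^ (1 / 2 : ℝ), ?_⟩
  refine (hC _ (measurableSet_le (by fun_prop) (by fun_prop)) 4 fun c ξ η => ?_).mono
    (fun _ _ => le_rfl) (by rw [ENNReal.coe_mul, ENNReal.coe_rpow_of_nonneg _ (by norm_num)]; simp)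
  refine (lintegral_mul_le_box (W := 1) (by simp) (measurableSet_strip 0 1)
    (measurableSet_strip 0 1) fun x y h => ?_).trans ?_
  · have h1 := fiberPoint_indicator_sq_ne_zero h
    have h2 : freqSize x y ≤ 1 := (le_max_left _ _).trans h1
    have h3 : freqSize (ξ - x) (η - y) ≤ 1 := (le_max_right _ _).trans h1
    refine ⟨by simpa using (abs_left_le_freqSize x y).trans h2,
      by simpa using (abs_right_le_freqSize x y).trans h2,
      (indicator_freqWeight_sq_le _ _).trans ?_⟩
    rw [freqWeight_sq, ← ENNReal.ofReal_one]
    refine ENNReal.ofReal_le_ofReal ?_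
    refine mul_le_one₀ ?_ (zero_le_one.trans (one_le_freqSize _ _)) h3
    exact Real.rpow_le_one_of_one_le_of_nonpos (one_le_freqSize _ _) (by norm_num)
  · grw [lintegral_resWeight_box_le]
    simp

/-! ### Transversal frequencies -/

/-- The weight times the bound of `exists_resWeight_ball`, for the output frequency `h = |η|`,
`X = 1 + |ξ₁|`, the radius `8/3 h` and the slope `3/32 h²`. The power of `X` is below `-1`, so that
it is integrable in `ξ₁`. -/
theorem transversal_real_bound {h X : ℝ} (hX : 0 < X) (hh : 3 / 16 * X ≤ h) :
    8 / 3 * h * (X / 2) ^ (-(1 / 2) : ℝ) *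
      ((3 / 32 * h ^ 2) ^ (-(15 / 16) : ℝ) * (8 / 3 * h) ^ (1 / 16 : ℝ)) ≤
    (8 / 3 * (1 / 2) ^ (-(1 / 2) : ℝ) * (3 / 32) ^ (-(15 / 16) : ℝ) * (8 / 3) ^ (1 / 16 : ℝ) *
      (3 / 16) ^ (-(13 / 16) : ℝ)) * X ^ (-(21 / 16) : ℝ) := by
  have h0 : 0 < h := by linarith
  have e1 : (h ^ 2) ^ (-(15 / 16) : ℝ) = h ^ (-(15 / 8) : ℝ) := by
    rw [← Real.rpow_natCast, ← Real.rpow_mul h0.le]; norm_num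
  have e2 : h * h ^ (-(15 / 8) : ℝ) * h ^ (1 / 16 : ℝ) = h ^ (-(13 / 16) : ℝ) := by
    nth_rewrite 1 [← Real.rpow_one h]
    rw [← Real.rpow_add h0, ← Real.rpow_add h0]; norm_num
  have e3 : h ^ (-(13 / 16) : ℝ) ≤ (3 / 16) ^ (-(13 / 16) : ℝ) * X ^ (-(13 / 16) : ℝ) := by
    rw [← Real.mul_rpow (by norm_num) hX.le]
    exact Real.rpow_le_rpow_of_nonpos (by positivity) hh (by norm_num)
  have e4 : X ^ (-(13 / 16) : ℝ) * X ^ (-(1 / 2) : ℝ) = X ^ (-(21 / 16) : ℝ) := by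
    rw [← Real.rpow_add hX]; norm_num
  rw [Real.mul_rpow (by norm_num) (by positivity), Real.mul_rpow (by norm_num) h0.le, e1,
    div_eq_mul_one_div X 2, Real.mul_rpow hX.le (by norm_num), ← e4]
  calc _ = 8 / 3 * (1 / 2) ^ (-(1 / 2) : ℝ) * (3 / 32) ^ (-(15 / 16) : ℝ) *
          (8 / 3) ^ (1 / 16 : ℝ) * X ^ (-(1 / 2) : ℝ) *
          (h * h ^ (-(15 / 8) : ℝ) * h ^ (1 / 16 : ℝ)) := by ring
    _ ≤ 8 / 3 * (1 / 2) ^ (-(1 / 2) : ℝ) * (3 / 32) ^ (-(15 / 16) : ℝ) *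
          (8 / 3) ^ (1 / 16 : ℝ) * X ^ (-(1 / 2) : ℝ) *
          ((3 / 16) ^ (-(13 / 16) : ℝ) * X ^ (-(13 / 16) : ℝ)) := by rw [e2]; gcongr
    _ = _ := by ring

theorem lintegral_mul_le_set {a g : ℝ → ℝ≥0∞} {W : ℝ≥0∞} (hW : W ≠ ⊤) {T : Set ℝ}
    (hT : MeasurableSet T) (h : ∀ y, a y ≠ 0 → y ∈ T ∧ a y ≤ W) :
    ∫⁻ y, a y * g y ≤ W * ∫⁻ y in T, g y := by
  rw [← lintegral_indicator hT, ← lintegral_const_mul' _ _ hW]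
  refine lintegral_mono fun y => ?_
  by_cases h0 : a y = 0
  · simp [h0]
  · rw [Set.indicator_of_mem (h y h0).1]
    have := (h y h0).2
    gcongr

/-- Where the group velocities differ in the `η` direction by the square of the largest frequency,
that frequency is comparable to the output frequency `|η|` and to `|η₁ - η / 2|`. -/
theorem exists_triBound_transversal :
    ∃ C : ℝ≥0, TriBound (regionKernel
      {v | 3 / 4 * maxSize v ^ 2 ≤ |v.2.1 ^ 2 - v.2.2.2 ^ 2|}) C := by
  obtain ⟨C, hC⟩ := exists_triBound_region
  obtain ⟨C₁, hC₁⟩ := exists_resWeight_ball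
  set k : ℝ := 8 / 3 * (1 / 2) ^ (-(1 / 2) : ℝ) * (3 / 32) ^ (-(15 / 16) : ℝ) *
    (8 / 3) ^ (1 / 16 : ℝ) * (3 / 16) ^ (-(13 / 16) : ℝ) with hk
  have hI : ∫⁻ x, brk (21 / 16) x ≠ ⊤ := by
    have := (integrable_one_add_norm (E := ℝ) (r := 21 / 16) (by norm_num)
      (μ := volume)).lintegral_lt_top
    simpa [brk, Real.norm_eq_abs] using this.ne
  set I := ∫⁻ x, brk (21 / 16) x with hIdef
  have hM : (C₁ * ENNReal.ofReal k * I) ≠ ⊤ :=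
    ENNReal.mul_ne_top (ENNReal.mul_ne_top ENNReal.coe_ne_top ENNReal.ofReal_ne_top) hI
  refine ⟨C * (C₁ * ENNReal.ofReal k * I).toNNReal ^ (1 / 2 : ℝ), ?_⟩
  refine (hC _ (measurableSet_le (by fun_prop) (by fun_prop)) (C₁ * ENNReal.ofReal k * I)
    fun c ξ η => ?_).mono (fun _ _ => le_rfl) (by
      rw [ENNReal.coe_mul, ENNReal.coe_rpow_of_nonneg _ (by norm_num), ENNReal.coe_toNNReal hM])
  rw [hIdef, ← lintegral_const_mul _ (measurable_brk _)]
  refine lintegral_mono fun x => ?_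
  -- The size `m` of the larger input is at least `(1 + |x|) / 2` and comparable to `|η|`.
  have main : ∀ y, ((x, y, ξ - x, η - y) : ℝ × ℝ × ℝ × ℝ) ∈
      {v : ℝ × ℝ × ℝ × ℝ | 3 / 4 * maxSize v ^ 2 ≤ |v.2.1 ^ 2 - v.2.2.2 ^ 2|} →
      3 / 16 * (1 + |x|) ≤ |η| ∧ (1 + |x|) / 2 ≤ freqSize x y ∧
      freqSize (ξ - x) (η - y) ≤ 8 / 3 * |η| ∧ |y - η / 2| ≤ 8 / 3 * |η| ∧
      3 / 32 * |η| ^ 2 ≤ |η| * |y - η / 2| := by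
    intro y hy
    simp only [Set.mem_ofPred_eq] at hy
    set m := maxSize (x, y, ξ - x, η - y) with hm
    have a1 : freqSize x y ≤ m := le_max_left _ _
    have a2 : freqSize (ξ - x) (η - y) ≤ m := le_max_right _ _
    have a3 := one_le_freqSize x y
    have a4 := abs_left_le_freqSize x y
    have a5 := (abs_right_le_freqSize x y).trans a1
    have a6 := (abs_right_le_freqSize (ξ - x) (η - y)).trans a2
    have e1 : y ^ 2 - (η - y) ^ 2 = 2 * (η * (y - η / 2)) := by ring
    rw [e1, abs_mul, abs_mul, abs_two] at hy
    have b1 : |η| ≤ 2 * m := by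
      have := abs_add_le y (η - y); rw [add_sub_cancel] at this; linarith
    have b2 : |y - η / 2| ≤ m := by
      have := abs_sub y (η - y)
      rw [show y - (η - y) = 2 * (y - η / 2) by ring, abs_mul, abs_two] at this
      linarith
    have m0 : 0 < m := by linarith
    have b3 : 3 / 8 * m ≤ |η| := by
      have : |η| * |y - η / 2| ≤ |η| * m := by gcongr
      nlinarith
    have b4 : (1 + |x|) / 2 ≤ freqSize x y := by linarith
    refine ⟨by linarith, b4, by linarith, by linarith, ?_⟩
    have : |η| ^ 2 ≤ (2 * m) ^ 2 := by gcongr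
    nlinarith
  by_cases hx : 3 / 16 * (1 + |x|) ≤ |η|
  · have hη : 0 < |η| := by have := abs_nonneg x; linarith
    refine (lintegral_mul_le_set
      (W := ENNReal.ofReal (8 / 3 * |η| * ((1 + |x|) / 2) ^ (-(1 / 2) : ℝ))) ENNReal.ofReal_ne_top
      (measurableSet_ball_slope (η / 2) (8 / 3 * |η|) (3 / 32 * |η| ^ 2) η (η / 2))
      fun y hy => ?_).trans ?_
    · obtain ⟨h1, h2, h3, h4, h5⟩ := main y (fiberPoint_indicator_sq_ne_zero hy)
      refine ⟨⟨h4, h5⟩, (indicator_freqWeight_sq_le _ _).trans ?_⟩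
      rw [freqWeight_sq, mul_comm (8 / 3 * |η|)]
      refine ENNReal.ofReal_le_ofReal ?_
      refine mul_le_mul ?_ h3 (zero_le_one.trans (one_le_freqSize _ _)) (by positivity)
      exact Real.rpow_le_rpow_of_nonpos (by positivity) h2 (by norm_num)
    · grw [hC₁ c ξ η (ξ / 2) (η / 2) (η / 2) (8 / 3 * |η|) (3 / 32 * |η| ^ 2) x (by positivity)
        (by positivity)]
      rw [mul_left_comm, mul_assoc (C₁ : ℝ≥0∞), ← ENNReal.ofReal_mul (by positivity),
        ← ENNReal.ofReal_mul (by positivity), brk, ← ENNReal.ofReal_mul (by positivity)]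
      refine mul_le_mul_right (ENNReal.ofReal_le_ofReal ?_) _
      exact transversal_real_bound (by positivity) hx
  · have : ∀ y, ({v : ℝ × ℝ × ℝ × ℝ | 3 / 4 * maxSize v ^ 2 ≤ |v.2.1 ^ 2 - v.2.2.2 ^ 2|}.indicator
        freqWeight (x, y, ξ - x, η - y)) ^ 2 = 0 := by
      intro y
      by_contra h0
      exact hx (main y (fiberPoint_indicator_sq_ne_zero h0)).1
    simp [this]

/-! ### Parallel frequencies -/

/-- The decay `2 ^ (-j / 8)` in the dyadic scales. -/
def shellGain (j : ℕ) : ℝ≥0∞ := ENNReal.ofReal (((2 : ℝ) ^ j) ^ (-(1 / 8) : ℝ))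

theorem shellGain_zero : shellGain 0 = 1 := by simp [shellGain]

theorem tsum_shellGain_ne_top : ∑' j, shellGain j ^ (1 / 2 : ℝ) ≠ ⊤ := by
  have e : ∀ j, shellGain j ^ (1 / 2 : ℝ) = (ENNReal.ofReal (2 ^ (-(1 / 16) : ℝ))) ^ j := by
    intro j
    rw [shellGain, ENNReal.ofReal_rpow_of_pos (by positivity), ← ENNReal.ofReal_pow (by positivity),
      ← Real.rpow_mul (by positivity), ← Real.rpow_natCast, ← Real.rpow_natCast,
      ← Real.rpow_mul (by norm_num), ← Real.rpow_mul (by norm_num)]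
    congr 2; ring
  simp_rw [e]
  rw [ENNReal.tsum_geometric]
  refine ENNReal.inv_ne_top.2 (tsub_pos_of_lt ?_).ne'
  rw [← ENNReal.ofReal_one, ENNReal.ofReal_lt_ofReal_iff (by norm_num)]
  exact Real.rpow_lt_one_of_one_lt_of_neg (by norm_num) (by norm_num)

theorem measurableSet_parallel :
    MeasurableSet {v : ℝ × ℝ × ℝ × ℝ | maxSize v / 2 ≤ |v.2.1| ∧ maxSize v / 2 ≤ |v.2.2.2|} :=
  (measurableSet_le (f := fun v : ℝ × ℝ × ℝ × ℝ => maxSize v / 2) (g := fun v => |v.2.1|)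
    (by fun_prop) (by fun_prop)).inter
  (measurableSet_le (f := fun v : ℝ × ℝ × ℝ × ℝ => maxSize v / 2) (g := fun v => |v.2.2.2|)
    (by fun_prop) (by fun_prop))

/-- The weight times the bound of `exists_resWeight_strip_gain`, for the output frequency `h = |η|`,
`s = |ξ|` and the radius `A` of the interval in `ξ₁`. -/
theorem large_real_bound {h s A : ℝ} (hh : 0 < h) (hs : A / 2 ≤ s) (hA : 0 < A) :
    4 * h ^ (1 / 2 : ℝ) * (h ^ (-(1 / 2) : ℝ) * (s ^ (-(7 / 16) : ℝ) * A ^ (1 / 8 : ℝ))) ≤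
      8 * (A / 2) ^ (-(1 / 8) : ℝ) * (A / 2) ^ (-(3 / 16) : ℝ) := by
  have e1 : h ^ (1 / 2 : ℝ) * h ^ (-(1 / 2) : ℝ) = 1 := by
    rw [← Real.rpow_add hh]; norm_num
  have e2 : s ^ (-(7 / 16) : ℝ) ≤ (A / 2) ^ (-(7 / 16) : ℝ) :=
    Real.rpow_le_rpow_of_nonpos (by positivity) hs (by norm_num)
  have e3 : A ^ (1 / 8 : ℝ) ≤ 2 * (A / 2) ^ (1 / 8 : ℝ) := by
    have : A ^ (1 / 8 : ℝ) = 2 ^ (1 / 8 : ℝ) * (A / 2) ^ (1 / 8 : ℝ) := by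
      rw [← Real.mul_rpow (by norm_num) (by positivity)]; congr 1; ring
    rw [this]
    gcongr
    calc (2 : ℝ) ^ (1 / 8 : ℝ) ≤ 2 ^ (1 : ℝ) :=
          Real.rpow_le_rpow_of_exponent_le (by norm_num) (by norm_num)
      _ = 2 := by simp
  calc _ = 4 * (h ^ (1 / 2 : ℝ) * h ^ (-(1 / 2) : ℝ)) *
          (s ^ (-(7 / 16) : ℝ) * A ^ (1 / 8 : ℝ)) := by ring
    _ ≤ 4 * 1 * ((A / 2) ^ (-(7 / 16) : ℝ) * (2 * (A / 2) ^ (1 / 8 : ℝ))) := by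
        rw [e1]; gcongr
    _ = 8 * ((A / 2) ^ (-(7 / 16) : ℝ) * (A / 2) ^ (1 / 8 : ℝ)) := by ring
    _ = _ := by
        rw [← Real.rpow_add (by positivity), mul_assoc, ← Real.rpow_add (by positivity)]
        norm_num

/-- Parallel inputs with a large output frequency `|η|`. The integral in `η₁` gains `|η| ^ (-1/2)`,
which cancels the weight; the strips in `ξ₁` have the size of the output frequency `|ξ|`. -/
theorem exists_triBound_parallel_large :
    ∃ C : ℝ≥0, TriBound (regionKernel
      ({v | maxSize v / 2 ≤ |v.2.1| ∧ maxSize v / 2 ≤ |v.2.2.2|} ∩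
        {v | maxSize v / 4 ≤ |v.2.1 + v.2.2.2|})) C := by
  obtain ⟨C, hC⟩ := exists_triBound_region
  obtain ⟨C₁, hC₁⟩ := exists_resWeight_strip
  obtain ⟨C₂, hC₂⟩ := exists_resWeight_strip_gain
  set D : ℝ≥0 := 8 * (C₁ + C₂) with hD
  have hR1 : MeasurableSet ({v : ℝ × ℝ × ℝ × ℝ | maxSize v / 2 ≤ |v.2.1| ∧
      maxSize v / 2 ≤ |v.2.2.2|} ∩ {v | maxSize v / 4 ≤ |v.2.1 + v.2.2.2|}) :=
    measurableSet_parallel.inter (measurableSet_le (by fun_prop) (by fun_prop))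
  set R := {v : ℝ × ℝ × ℝ × ℝ | maxSize v / 2 ≤ |v.2.1| ∧
      maxSize v / 2 ≤ |v.2.2.2|} ∩ {v | maxSize v / 4 ≤ |v.2.1 + v.2.2.2|} with hRdef
  have hf : Measurable fun v : ℝ × ℝ × ℝ × ℝ => v.1 + v.2.2.1 := by fun_prop
  have step : ∀ j, TriBound (regionKernel (R ∩ {v | v.1 + v.2.2.1 ∈ shell j}))
      (C * (D * shellGain j) ^ (1 / 2 : ℝ) * 2) := by
    intro j
    have hR2 : MeasurableSet (R ∩ {v | v.1 + v.2.2.1 ∈ shell j}) :=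
      hR1.inter (hf (measurableSet_shell j))
    refine triBound_region_localize_X (A := 2 ^ (j + 1)) hR2 (by positivity) (fun v hv => hv.2.2)
      fun θ => ?_
    refine hC _ (hR2.inter (measurableSet_le (by fun_prop) (by fun_prop))) _ fun c ξ η => ?_
    have main : ∀ x y, ((x, y, ξ - x, η - y) : ℝ × ℝ × ℝ × ℝ) ∈
        (R ∩ {v | v.1 + v.2.2.1 ∈ shell j}) ∩ {v | |v.1 - θ| ≤ 2 ^ (j + 1)} →
        (0 < |η| ∧ ξ ∈ shell j) ∧ |x - θ| ≤ 2 ^ (j + 1) ∧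
        freqWeight (x, y, ξ - x, η - y) ^ 2 ≤ ENNReal.ofReal (4 * |η| ^ (1 / 2 : ℝ)) := by
      rintro x y ⟨⟨⟨⟨h1, -⟩, h3⟩, h4⟩, h5⟩
      simp only [Set.mem_ofPred_eq, add_sub_cancel] at h1 h3 h4 h5
      have := one_le_maxSize (x, y, ξ - x, η - y)
      exact ⟨⟨by linarith, h4⟩, h5, freqWeight_sq_le h1 (by linarith)⟩
    by_cases hne : 0 < |η| ∧ ξ ∈ shell j
    · obtain ⟨hη, hξ⟩ := hne
      refine (lintegral_mul_le_box (W := ENNReal.ofReal (4 * |η| ^ (1 / 2 : ℝ)))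
        ENNReal.ofReal_ne_top (measurableSet_strip θ (2 ^ (j + 1))) MeasurableSet.univ
        fun x y h => ?_).trans ?_
      · have h2 := main x y (fiberPoint_indicator_sq_ne_zero h)
        exact ⟨h2.2.1, Set.mem_univ _, (indicator_freqWeight_sq_le _ _).trans h2.2.2⟩
      simp only [setLIntegral_univ]
      rcases Nat.eq_zero_or_pos j with rfl | hj
      · grw [hC₁ c ξ η (ξ / 2) (η / 2) θ _ (abs_pos.1 hη)]
        rw [shellGain_zero, mul_one, mul_left_comm, ← mul_assoc (ENNReal.ofReal _),
          ← ENNReal.ofReal_mul (by positivity), mul_assoc 4, ← Real.rpow_add hη, hD]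
        norm_num
        rw [mul_comm]
        gcongr
        exact le_self_add
      · have hξ1 : (2 : ℝ) ^ j ≤ |ξ| := hξ.1.resolve_left hj.ne'
        have hξ0 : ξ ≠ 0 := by
          have : (0 : ℝ) < 2 ^ j := by positivity
          exact abs_pos.1 (by linarith)
        grw [hC₂ c ξ η (ξ / 2) (η / 2) θ _ hξ0 (abs_pos.1 hη) (by positivity)]
        rw [mul_left_comm, ← ENNReal.ofReal_mul (by positivity),
          ← ENNReal.ofReal_mul (by positivity), ← ENNReal.ofReal_mul (by positivity)]
        have e : (2 : ℝ) ^ (j + 1) / 2 = 2 ^ j := by rw [pow_succ]; ring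
        have := large_real_bound (s := |ξ|) (A := 2 ^ (j + 1)) hη (by rw [e]; exact hξ1) (by positivity)
        rw [e] at this
        have h1 : ((2 : ℝ) ^ j) ^ (-(3 / 16) : ℝ) ≤ 1 :=
          Real.rpow_le_one_of_one_le_of_nonpos (one_le_pow₀ (by norm_num)) (by norm_num)
        calc (C₂ : ℝ≥0∞) * _ ≤ C₂ * ENNReal.ofReal (8 * ((2 : ℝ) ^ j) ^ (-(1 / 8) : ℝ)) := by
              refine mul_le_mul_right (ENNReal.ofReal_le_ofReal ?_) _
              exact this.trans (mul_le_of_le_one_right (by positivity) h1)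
          _ = 8 * C₂ * shellGain j := by
              rw [ENNReal.ofReal_mul (by norm_num), shellGain]
              norm_num
              ring
          _ ≤ _ := by
              rw [hD]; push_cast
              gcongr
              exact le_add_self
    · have : ∀ x y, ((R ∩ {v | v.1 + v.2.2.1 ∈ shell j}) ∩
          {v | |v.1 - θ| ≤ 2 ^ (j + 1)}).indicator freqWeight (x, y, ξ - x, η - y) ^ 2 = 0 := by
        intro x y
        by_contra h0
        exact hne (main x y (fiberPoint_indicator_sq_ne_zero h0)).1
      simp [this]
  have hsum := triBound_region_sum_shell hR1 hf step
  have hS := tsum_shellGain_ne_top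
  refine ⟨(C * (D : ℝ≥0∞) ^ (1 / 2 : ℝ) * 2 * ∑' j, shellGain j ^ (1 / 2 : ℝ)).toNNReal,
    hsum.mono (fun _ _ => le_rfl) ?_⟩
  rw [ENNReal.coe_toNNReal]
  · rw [← ENNReal.tsum_mul_left]
    refine ENNReal.tsum_le_tsum fun j => ?_
    rw [ENNReal.mul_rpow_of_nonneg _ _ (by norm_num)]
    apply le_of_eq; ring
  · refine ENNReal.mul_ne_top (ENNReal.mul_ne_top (ENNReal.mul_ne_top ENNReal.coe_ne_top ?_)
      (by simp)) hS
    exact ENNReal.rpow_ne_top_of_nonneg (by norm_num) ENNReal.coe_ne_top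

theorem rpow_exp_log {α : ℝ} (hα : 0 < α) (t : ℝ) : α ^ t = Real.exp (t * Real.log α) := by
  rw [Real.rpow_def_of_pos hα, mul_comm]

theorem two_rpow_le {t : ℝ} (ht : t ≤ 1) : (2 : ℝ) ^ t ≤ 2 := by
  calc (2 : ℝ) ^ t ≤ 2 ^ (1 : ℝ) := Real.rpow_le_rpow_of_exponent_le (by norm_num) ht
    _ = 2 := by simp

theorem eight_rpow_le {t : ℝ} (ht : t ≤ 1) : (8 : ℝ) ^ t ≤ 8 := by
  calc (8 : ℝ) ^ t ≤ 8 ^ (1 : ℝ) := Real.rpow_le_rpow_of_exponent_le (by norm_num) ht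
    _ = 8 := by simp

/-- The weight times the bound of `exists_resWeight_box`, for inputs of size `θ = s²`, the radius `2 α`
in `ξ₁`, the radius `2 β / s` in `η₁`, and the slope `β s / 8`. The powers of `s` cancel. -/
theorem small_real_bound {α β s : ℝ} (hα : 0 < α) (hβ : 0 < β) (hs : 0 < s) :
    4 * s * (2 * α * ((β * s / 8) ^ (-(15 / 16) : ℝ) * (2 * β / s) ^ (1 / 16 : ℝ))) ≤
      128 * (α * β ^ (-(7 / 8) : ℝ)) := by
  have e1 : (β * s / 8) ^ (-(15 / 16) : ℝ) =
      β ^ (-(15 / 16) : ℝ) * s ^ (-(15 / 16) : ℝ) * 8 ^ (15 / 16 : ℝ) := by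
    rw [Real.div_rpow (by positivity) (by norm_num), Real.mul_rpow hβ.le hs.le,
      Real.rpow_neg (by norm_num : (0 : ℝ) ≤ 8), div_inv_eq_mul]
  have e2 : (2 * β / s) ^ (1 / 16 : ℝ) =
      2 ^ (1 / 16 : ℝ) * β ^ (1 / 16 : ℝ) * s ^ (-(1 / 16) : ℝ) := by
    rw [Real.div_rpow (by positivity) hs.le, Real.mul_rpow (by norm_num) hβ.le,
      Real.rpow_neg hs.le, div_eq_mul_inv]
  have e3 : s * (s ^ (-(15 / 16) : ℝ) * s ^ (-(1 / 16) : ℝ)) = 1 := by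
    rw [← Real.rpow_add hs]; norm_num [Real.rpow_neg_one, hs.ne']
  have e4 : β ^ (-(15 / 16) : ℝ) * β ^ (1 / 16 : ℝ) = β ^ (-(7 / 8) : ℝ) := by
    rw [← Real.rpow_add hβ]; norm_num
  rw [e1, e2]
  calc _ = 8 * 8 ^ (15 / 16 : ℝ) * 2 ^ (1 / 16 : ℝ) *
          (α * (β ^ (-(15 / 16) : ℝ) * β ^ (1 / 16 : ℝ))) *
          (s * (s ^ (-(15 / 16) : ℝ) * s ^ (-(1 / 16) : ℝ))) := by ring
    _ ≤ 8 * 8 * 2 * (α * β ^ (-(7 / 8) : ℝ)) * 1 := by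
        rw [e3, e4]
        gcongr
        · exact eight_rpow_le (by norm_num)
        · exact two_rpow_le (by norm_num)
    _ = _ := by ring

/-- The analogue of `small_real_bound` for `exists_resWeight_box_gain`, with the output frequency
`|ξ|` of size `α`. The powers of `s` cancel again. -/
theorem small_real_bound_gain {α β s : ℝ} (hα : 0 < α) (hβ : 0 < β) (hs : 0 < s) :
    4 * s * (α ^ (-(1 / 2) : ℝ) *
      ((β * s / 8) ^ (-(7 / 16) : ℝ) * (2 * β / s) ^ (9 / 16 : ℝ))) ≤
      128 * (α ^ (-(1 / 2) : ℝ) * β ^ (1 / 8 : ℝ)) := by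
  have e1 : (β * s / 8) ^ (-(7 / 16) : ℝ) =
      β ^ (-(7 / 16) : ℝ) * s ^ (-(7 / 16) : ℝ) * 8 ^ (7 / 16 : ℝ) := by
    rw [Real.div_rpow (by positivity) (by norm_num), Real.mul_rpow hβ.le hs.le,
      Real.rpow_neg (by norm_num : (0 : ℝ) ≤ 8), div_inv_eq_mul]
  have e2 : (2 * β / s) ^ (9 / 16 : ℝ) =
      2 ^ (9 / 16 : ℝ) * β ^ (9 / 16 : ℝ) * s ^ (-(9 / 16) : ℝ) := by
    rw [Real.div_rpow (by positivity) hs.le, Real.mul_rpow (by norm_num) hβ.le,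
      Real.rpow_neg hs.le, div_eq_mul_inv]
  have e3 : s * (s ^ (-(7 / 16) : ℝ) * s ^ (-(9 / 16) : ℝ)) = 1 := by
    rw [← Real.rpow_add hs]; norm_num [Real.rpow_neg_one, hs.ne']
  have e4 : β ^ (-(7 / 16) : ℝ) * β ^ (9 / 16 : ℝ) = β ^ (1 / 8 : ℝ) := by
    rw [← Real.rpow_add hβ]; norm_num
  rw [e1, e2]
  calc _ = 4 * 8 ^ (7 / 16 : ℝ) * 2 ^ (9 / 16 : ℝ) *
          (α ^ (-(1 / 2) : ℝ) * (β ^ (-(7 / 16) : ℝ) * β ^ (9 / 16 : ℝ))) *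
          (s * (s ^ (-(7 / 16) : ℝ) * s ^ (-(9 / 16) : ℝ))) := by ring
    _ ≤ 4 * 8 * 2 * (α ^ (-(1 / 2) : ℝ) * β ^ (1 / 8 : ℝ)) * 1 := by
        rw [e3, e4]
        gcongr
        · exact eight_rpow_le (by norm_num)
        · exact two_rpow_le (by norm_num)
    _ ≤ _ := by
        have : 0 < α ^ (-(1 / 2) : ℝ) * β ^ (1 / 8 : ℝ) := by positivity
        linarith

/-- The two bounds cross where `β = α ^ (3 / 2)`, and there both have decay in `α` and `β`. -/
theorem min_bound_le {α β : ℝ} (hα : 0 < α) (hβ : 0 < β) :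
    α * β ^ (-(7 / 8) : ℝ) ≤ α ^ (-(1 / 8) : ℝ) * β ^ (-(1 / 8) : ℝ) ∨
      α ^ (-(1 / 2) : ℝ) * β ^ (1 / 8 : ℝ) ≤ α ^ (-(1 / 8) : ℝ) * β ^ (-(1 / 8) : ℝ) := by
  rw [rpow_exp_log hβ, rpow_exp_log hβ, rpow_exp_log hα, rpow_exp_log hα, rpow_exp_log hβ]
  nth_rewrite 1 [← Real.exp_log hα]
  rw [← Real.exp_add, ← Real.exp_add, ← Real.exp_add, Real.exp_le_exp, Real.exp_le_exp]
  rcases le_total (3 / 2 * Real.log α) (Real.log β) with h | h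
  · left; linarith
  · right; linarith

/-- The fiber bound for parallel inputs of size comparable to `θ`, with output frequencies `|ξ|` of
size `2 ^ j` and `|η|` of size `2 ^ i θ ^ (-1/2)`, localized to intervals of these lengths. -/
theorem exists_parallel_fiber : ∃ D : ℝ≥0, ∀ (i j : ℕ) (θ θ₁ θ₂ c ξ η x₀ y₀ : ℝ), 0 < θ →
    ξ ∈ shell j →
    ENNReal.ofReal (4 * θ ^ (1 / 2 : ℝ)) * ∫⁻ x in {x | |x - θ₁| ≤ 2 ^ (j + 1)},
      ∫⁻ y in {y | |y - θ₂| ≤ 2 ^ (i + 1) / √θ ∧ (i = 0 ∨ 2 ^ i * √θ / 8 ≤ |η| * |y - y₀|)},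
        resWeight c ξ η x₀ y₀ x y ≤ D * (shellGain i * shellGain j) := by
  obtain ⟨C₁, hC₁⟩ := exists_resWeight_strip'
  obtain ⟨C₂, hC₂⟩ := exists_resWeight_box
  obtain ⟨C₃, hC₃⟩ := exists_resWeight_box_gain
  refine ⟨64 + 8 * C₁ + 128 * C₂ + 128 * C₃, fun i j θ θ₁ θ₂ c ξ η x₀ y₀ hθ hξ => ?_⟩
  set s := √θ with hs
  have hs0 : 0 < s := Real.sqrt_pos.2 hθ
  have hθs : θ ^ (1 / 2 : ℝ) = s := by rw [hs, Real.sqrt_eq_rpow]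
  rw [hθs]
  set α : ℝ := 2 ^ j with hα
  set β : ℝ := 2 ^ i with hβ
  have hα0 : 0 < α := by positivity
  have hβ0 : 0 < β := by positivity
  have hα1 : 1 ≤ α := one_le_pow₀ (by norm_num)
  have hβ1 : 1 ≤ β := one_le_pow₀ (by norm_num)
  have eα : (2 : ℝ) ^ (j + 1) = 2 * α := by rw [pow_succ, mul_comm]
  have eβ : (2 : ℝ) ^ (i + 1) = 2 * β := by rw [pow_succ, mul_comm]
  rw [eα, eβ]
  have hξj : 0 < j → α ≤ |ξ| := fun hj => hξ.1.resolve_left hj.ne'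
  have hξ0 : 0 < j → ξ ≠ 0 := fun hj => abs_pos.1 (hα0.trans_le (hξj hj))
  have hξr : 0 < j → |ξ| ^ (-(1 / 2) : ℝ) ≤ α ^ (-(1 / 2) : ℝ) := fun hj =>
    Real.rpow_le_rpow_of_nonpos hα0 (hξj hj) (by norm_num)
  have hgain : shellGain i * shellGain j =
      ENNReal.ofReal (α ^ (-(1 / 8) : ℝ) * β ^ (-(1 / 8) : ℝ)) := by
    rw [shellGain, shellGain, mul_comm, ENNReal.ofReal_mul (by positivity)]
  have hsub : {y | |y - θ₂| ≤ 2 * β / s ∧ (i = 0 ∨ β * s / 8 ≤ |η| * |y - y₀|)} ⊆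
      {y | |y - θ₂| ≤ 2 * β / s} := fun y hy => hy.1
  rcases Nat.eq_zero_or_pos i with hi | hi
  · have eβ1 : β = 1 := by rw [hβ, hi, pow_zero]
    rcases Nat.eq_zero_or_pos j with hj | hj
    · have eα1 : α = 1 := by rw [hα, hj, pow_zero]
      calc _ ≤ ENNReal.ofReal (4 * s) * (4 * (ENNReal.ofReal (2 * α) *
            ENNReal.ofReal (2 * β / s))) := by
            grw [lintegral_mono fun x => lintegral_mono_set hsub, lintegral_resWeight_box_le]
        _ = ENNReal.ofReal (4 * s * (4 * (2 * α * (2 * β / s)))) := by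
            rw [show (4 : ℝ≥0∞) = ENNReal.ofReal 4 by simp, ← ENNReal.ofReal_mul (by positivity),
              ← ENNReal.ofReal_mul (by positivity), ← ENNReal.ofReal_mul (by positivity)]
        _ = 64 := by
            rw [eα1, eβ1]
            field_simp
            norm_num
        _ ≤ _ := by
            rw [hgain, eα1, eβ1]
            push_cast
            simp only [Real.one_rpow, mul_one, ENNReal.ofReal_one]
            rw [add_assoc, add_assoc]
            exact le_self_add
    · calc _ ≤ ENNReal.ofReal (4 * s) * (C₁ * (ENNReal.ofReal (α ^ (-(1 / 2) : ℝ)) *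
            ENNReal.ofReal (2 * β / s))) := by
            refine mul_le_mul_right ?_ _
            refine (setLIntegral_le_lintegral _ _).trans ?_
            refine (lintegral_mono fun x => lintegral_mono_set hsub).trans ?_
            refine (hC₁ c ξ η x₀ y₀ θ₂ (2 * β / s) (hξ0 hj)).trans ?_
            exact mul_le_mul_right (mul_le_mul_left (ENNReal.ofReal_le_ofReal (hξr hj)) _) _
        _ = C₁ * ENNReal.ofReal (8 * α ^ (-(1 / 2) : ℝ)) := by
            rw [← ENNReal.ofReal_mul (by positivity), mul_left_comm,
              ← ENNReal.ofReal_mul (by positivity), eβ1]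
            congr 2
            field_simp; norm_num
        _ ≤ C₁ * ENNReal.ofReal (8 * (α ^ (-(1 / 8) : ℝ) * β ^ (-(1 / 8) : ℝ))) := by
            refine mul_le_mul_right (ENNReal.ofReal_le_ofReal ?_) _
            rw [eβ1, Real.one_rpow, mul_one]
            exact mul_le_mul_of_nonneg_left
              (Real.rpow_le_rpow_of_exponent_le hα1 (by norm_num)) (by norm_num)
        _ = 8 * C₁ * (shellGain i * shellGain j) := by
            rw [ENNReal.ofReal_mul (by norm_num), hgain]
            norm_num
            ring
        _ ≤ _ := by
            push_cast
            refine mul_le_mul_left ?_ _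
            exact le_add_right (le_add_right le_add_self)
  · have hset : {y | |y - θ₂| ≤ 2 * β / s ∧ (i = 0 ∨ β * s / 8 ≤ |η| * |y - y₀|)} =
        {y | |y - θ₂| ≤ 2 * β / s ∧ β * s / 8 ≤ |η| * |y - y₀|} := by
      ext y; simp [hi.ne']
    rw [hset]
    have bound₁ : ENNReal.ofReal (4 * s) * ∫⁻ x in {x | |x - θ₁| ≤ 2 * α},
        ∫⁻ y in {y | |y - θ₂| ≤ 2 * β / s ∧ β * s / 8 ≤ |η| * |y - y₀|},
          resWeight c ξ η x₀ y₀ x y ≤ C₂ * ENNReal.ofReal (128 * (α * β ^ (-(7 / 8) : ℝ))) := by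
      grw [hC₂ c ξ η x₀ y₀ θ₁ (2 * α) θ₂ (2 * β / s) (β * s / 8) (by positivity) (by positivity)]
      rw [mul_left_comm, ← ENNReal.ofReal_mul (by positivity),
        ← ENNReal.ofReal_mul (by positivity), ← ENNReal.ofReal_mul (by positivity)]
      exact mul_le_mul_right (ENNReal.ofReal_le_ofReal (small_real_bound hα0 hβ0 hs0)) _
    have fin₁ : α * β ^ (-(7 / 8) : ℝ) ≤ α ^ (-(1 / 8) : ℝ) * β ^ (-(1 / 8) : ℝ) →
        ENNReal.ofReal (4 * s) * ∫⁻ x in {x | |x - θ₁| ≤ 2 * α},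
        ∫⁻ y in {y | |y - θ₂| ≤ 2 * β / s ∧ β * s / 8 ≤ |η| * |y - y₀|},
          resWeight c ξ η x₀ y₀ x y ≤
        ((64 + 8 * C₁ + 128 * C₂ + 128 * C₃ : ℝ≥0) : ℝ≥0∞) * (shellGain i * shellGain j) := by
      intro h
      calc _ ≤ C₂ * ENNReal.ofReal (128 * (α ^ (-(1 / 8) : ℝ) * β ^ (-(1 / 8) : ℝ))) :=
            bound₁.trans (mul_le_mul_right (ENNReal.ofReal_le_ofReal (by linarith)) _)
        _ = 128 * C₂ * (shellGain i * shellGain j) := by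
            rw [ENNReal.ofReal_mul (by norm_num), hgain]
            norm_num
            ring
        _ ≤ _ := by
            push_cast
            refine mul_le_mul_left ?_ _
            rw [add_right_comm]
            exact le_add_self
    rcases Nat.eq_zero_or_pos j with hj | hj
    · have eα1 : α = 1 := by rw [hα, hj, pow_zero]
      apply fin₁
      rw [eα1, Real.one_rpow, one_mul, one_mul]
      exact Real.rpow_le_rpow_of_exponent_le hβ1 (by norm_num)
    · rcases min_bound_le hα0 hβ0 with h | h
      · exact fin₁ h
      · calc _ ≤ ENNReal.ofReal (4 * s) * (C₃ * (ENNReal.ofReal (α ^ (-(1 / 2) : ℝ)) *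
              (ENNReal.ofReal ((β * s / 8) ^ (-(7 / 16) : ℝ)) *
                ENNReal.ofReal ((2 * β / s) ^ (9 / 16 : ℝ))))) := by
              refine mul_le_mul_right ?_ _
              refine (setLIntegral_le_lintegral _ _).trans ?_
              refine (hC₃ c ξ η x₀ y₀ θ₂ (2 * β / s) (β * s / 8) (hξ0 hj) (by positivity)
                (by positivity)).trans ?_
              exact mul_le_mul_right (mul_le_mul_left (ENNReal.ofReal_le_ofReal (hξr hj)) _) _
          _ ≤ C₃ * ENNReal.ofReal (128 * (α ^ (-(1 / 8) : ℝ) * β ^ (-(1 / 8) : ℝ))) := by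
              rw [mul_left_comm, ← ENNReal.ofReal_mul (by positivity),
                ← ENNReal.ofReal_mul (by positivity), ← ENNReal.ofReal_mul (by positivity)]
              refine mul_le_mul_right (ENNReal.ofReal_le_ofReal ?_) _
              exact (small_real_bound_gain hα0 hβ0 hs0).trans (by linarith)
          _ = 128 * C₃ * (shellGain i * shellGain j) := by
              rw [ENNReal.ofReal_mul (by norm_num), hgain]
              norm_num
              ring
          _ ≤ _ := by
              push_cast
              refine mul_le_mul_left ?_ _
              exact le_add_self

/-- Parallel inputs with a small output frequency `|η|`. The dyadic decomposition is in `|ξ|` and in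
`|η| |η₁| ^ (1/2)`: the weight is `|η₁| ^ (1/2)`, which balances the length of the interval in `η₁`
when `|η|` has the size `|η₁| ^ (-1/2)`. -/
theorem exists_triBound_parallel_small :
    ∃ C : ℝ≥0, TriBound (regionKernel
      ({v | maxSize v / 2 ≤ |v.2.1| ∧ maxSize v / 2 ≤ |v.2.2.2|} ∩
        {v | |v.2.1 + v.2.2.2| ≤ maxSize v / 4})) C := by
  obtain ⟨C, hC⟩ := exists_triBound_region
  obtain ⟨D, hD⟩ := exists_parallel_fiber
  have hR1 : MeasurableSet ({v : ℝ × ℝ × ℝ × ℝ | maxSize v / 2 ≤ |v.2.1| ∧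
      maxSize v / 2 ≤ |v.2.2.2|} ∩ {v | |v.2.1 + v.2.2.2| ≤ maxSize v / 4}) :=
    measurableSet_parallel.inter (measurableSet_le (by fun_prop) (by fun_prop))
  set R := {v : ℝ × ℝ × ℝ × ℝ | maxSize v / 2 ≤ |v.2.1| ∧
      maxSize v / 2 ≤ |v.2.2.2|} ∩ {v | |v.2.1 + v.2.2.2| ≤ maxSize v / 4} with hRdef
  have hf : Measurable fun v : ℝ × ℝ × ℝ × ℝ => v.1 + v.2.2.1 := by fun_prop
  have hg : Measurable fun v : ℝ × ℝ × ℝ × ℝ => (v.2.1 + v.2.2.2) * √|v.2.1| := by fun_prop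
  have step : ∀ i j, TriBound (regionKernel ((R ∩ {v | (v.2.1 + v.2.2.2) * √|v.2.1| ∈ shell i}) ∩
      {v | v.1 + v.2.2.1 ∈ shell j}))
      (C * (D * (shellGain i * shellGain j)) ^ (1 / 2 : ℝ) * 2 * 2 * 28) := by
    intro i j
    have hR2 : MeasurableSet (R ∩ {v | (v.2.1 + v.2.2.2) * √|v.2.1| ∈ shell i}) :=
      hR1.inter (hg (measurableSet_shell i))
    have hR3 : MeasurableSet ((R ∩ {v | (v.2.1 + v.2.2.2) * √|v.2.1| ∈ shell i}) ∩
      {v | v.1 + v.2.2.1 ∈ shell j}) := hR2.inter (hf (measurableSet_shell j))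
    refine triBound_region_localize_scale hR3 ?_ fun θ hθ => ?_
    · rintro v ⟨⟨⟨⟨h1, h2⟩, -⟩, -⟩, -⟩
      have a1 := one_le_maxSize v
      have a2 : |v.2.1| ≤ maxSize v := (abs_right_le_freqSize _ _).trans (le_max_left _ _)
      have a3 : |v.2.2.2| ≤ maxSize v := (abs_right_le_freqSize _ _).trans (le_max_right _ _)
      exact ⟨abs_pos.1 (by linarith), by linarith, by linarith⟩
    have hR4 : MeasurableSet (((R ∩ {v | (v.2.1 + v.2.2.2) * √|v.2.1| ∈ shell i}) ∩
      {v | v.1 + v.2.2.1 ∈ shell j}) ∩ {v | θ ≤ |v.2.1| ∧ |v.2.1| ≤ 2 * θ}) :=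
      hR3.inter ((measurableSet_le (f := fun _ => θ) (g := fun v : ℝ × ℝ × ℝ × ℝ => |v.2.1|)
        (by fun_prop) (by fun_prop)).inter
        (measurableSet_le (f := fun v : ℝ × ℝ × ℝ × ℝ => |v.2.1|) (g := fun _ => 2 * θ)
          (by fun_prop) (by fun_prop)))
    have hsθ : 0 < √θ := Real.sqrt_pos.2 hθ
    refine triBound_region_localize_Y (A := 2 ^ (i + 1) / √θ) hR4 (by positivity) ?_ fun θ₂ => ?_
    · rintro v ⟨⟨⟨-, h1⟩, -⟩, h2, -⟩
      rw [le_div_iff₀ hsθ]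
      refine le_trans ?_ h1.2
      rw [abs_mul, abs_of_nonneg (Real.sqrt_nonneg _)]
      gcongr
    have hR5 := hR4.inter (measurableSet_le (f := fun v : ℝ × ℝ × ℝ × ℝ => |v.2.1 - θ₂|)
      (g := fun _ => 2 ^ (i + 1) / √θ) (by fun_prop) (by fun_prop))
    refine triBound_region_localize_X (A := 2 ^ (j + 1)) hR5 (by positivity)
      (fun v hv => hv.1.1.2.2) fun θ₁ => ?_
    refine hC _ (hR5.inter (measurableSet_le (by fun_prop) (by fun_prop))) _ fun c ξ η => ?_
    have main : ∀ x y, ((x, y, ξ - x, η - y) : ℝ × ℝ × ℝ × ℝ) ∈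
        ((((R ∩ {v | (v.2.1 + v.2.2.2) * √|v.2.1| ∈ shell i}) ∩
        {v | v.1 + v.2.2.1 ∈ shell j}) ∩ {v | θ ≤ |v.2.1| ∧ |v.2.1| ≤ 2 * θ}) ∩
        {v | |v.2.1 - θ₂| ≤ 2 ^ (i + 1) / √θ}) ∩ {v | |v.1 - θ₁| ≤ 2 ^ (j + 1)} →
        ξ ∈ shell j ∧ |x - θ₁| ≤ 2 ^ (j + 1) ∧
        (|y - θ₂| ≤ 2 ^ (i + 1) / √θ ∧ (i = 0 ∨ 2 ^ i * √θ / 8 ≤ |η| * |y - η / 2|)) ∧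
        freqWeight (x, y, ξ - x, η - y) ^ 2 ≤ ENNReal.ofReal (4 * θ ^ (1 / 2 : ℝ)) := by
      rintro x y ⟨⟨⟨⟨⟨⟨⟨h1, -⟩, h3⟩, h4⟩, h5⟩, h6, h7⟩, h8⟩, h9⟩
      simp only [Set.mem_ofPred_eq, add_sub_cancel] at h1 h3 h4 h5 h6 h7 h8 h9
      have a2 : |y| ≤ maxSize (x, y, ξ - x, η - y) :=
        (abs_right_le_freqSize x y).trans (le_max_left _ _)
      refine ⟨h5, h9, ⟨h8, ?_⟩, freqWeight_sq_le h1 (by linarith)⟩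
      refine h4.1.imp_right fun h => ?_
      rw [abs_mul, abs_of_nonneg (Real.sqrt_nonneg _)] at h
      have b1 : |y| ≤ |y - η / 2| + |η| / 2 := by
        have := abs_add_le (y - η / 2) (η / 2)
        rw [sub_add_cancel, abs_div, abs_two] at this
        exact this
      have b2 : 3 / 8 * θ ≤ |y - η / 2| := by linarith
      have b3 : √|y| ≤ 2 * √θ := by
        rw [show (2 : ℝ) * √θ = √(4 * θ) by
          rw [Real.sqrt_mul (by norm_num), show (4 : ℝ) = 2 ^ 2 by norm_num,
            Real.sqrt_sq (by norm_num)]]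
        exact Real.sqrt_le_sqrt (by linarith)
      have b4 : 2 ^ i ≤ |η| * (2 * √θ) := h.trans (by gcongr)
      calc 2 ^ i * √θ / 8 ≤ |η| * (2 * √θ) * √θ / 8 := by gcongr
        _ = |η| * (θ / 4) := by
            rw [show |η| * (2 * √θ) * √θ / 8 = |η| * (√θ * √θ) / 4 by ring,
              Real.mul_self_sqrt hθ.le]; ring
        _ ≤ |η| * |y - η / 2| := by gcongr; linarith
    by_cases hξ : ξ ∈ shell j
    · refine (lintegral_mul_le_box (W := ENNReal.ofReal (4 * θ ^ (1 / 2 : ℝ)))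
        ENNReal.ofReal_ne_top (measurableSet_strip θ₁ (2 ^ (j + 1)))
        (T := {y | |y - θ₂| ≤ 2 ^ (i + 1) / √θ ∧ (i = 0 ∨ 2 ^ i * √θ / 8 ≤ |η| * |y - η / 2|)})
        ?_ fun x y h => ?_).trans (hD i j θ θ₁ θ₂ c ξ η (ξ / 2) (η / 2) hθ hξ)
      · exact (measurableSet_strip _ _).inter ((MeasurableSet.const _).union
          (measurableSet_le (by fun_prop) (by fun_prop : Measurable fun y : ℝ => |η| * |y - η / 2|)))
      · have h2 := main x y (fiberPoint_indicator_sq_ne_zero h)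
        exact ⟨h2.2.1, h2.2.2.1, (indicator_freqWeight_sq_le _ _).trans h2.2.2.2⟩
    · have : ∀ x y, (((((R ∩ {v | (v.2.1 + v.2.2.2) * √|v.2.1| ∈ shell i}) ∩
        {v | v.1 + v.2.2.1 ∈ shell j}) ∩ {v | θ ≤ |v.2.1| ∧ |v.2.1| ≤ 2 * θ}) ∩
        {v | |v.2.1 - θ₂| ≤ 2 ^ (i + 1) / √θ}) ∩ {v | |v.1 - θ₁| ≤ 2 ^ (j + 1)}).indicator
          freqWeight (x, y, ξ - x, η - y) ^ 2 = 0 := by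
        intro x y
        by_contra h0
        exact hξ (main x y (fiberPoint_indicator_sq_ne_zero h0)).1
      simp [this]
  have hsum := triBound_region_sum_shell hR1 hg fun i => triBound_region_sum_shell
    (hR1.inter (hg (measurableSet_shell i))) hf (step i)
  have hS := tsum_shellGain_ne_top
  set S := ∑' j, shellGain j ^ (1 / 2 : ℝ) with hSdef
  refine ⟨(C * (D : ℝ≥0∞) ^ (1 / 2 : ℝ) * 2 * 2 * 28 * S * S).toNNReal,
    hsum.mono (fun _ _ => le_rfl) ?_⟩
  rw [ENNReal.coe_toNNReal]
  · have e : ∀ i, ∑' j, (C : ℝ≥0∞) * (D * (shellGain i * shellGain j)) ^ (1 / 2 : ℝ) * 2 * 2 * 28 =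
        C * (D : ℝ≥0∞) ^ (1 / 2 : ℝ) * 2 * 2 * 28 * S * shellGain i ^ (1 / 2 : ℝ) := by
      intro i
      rw [hSdef, mul_right_comm, ← ENNReal.tsum_mul_left]
      refine tsum_congr fun j => ?_
      rw [ENNReal.mul_rpow_of_nonneg _ _ (by norm_num), ENNReal.mul_rpow_of_nonneg _ _ (by norm_num)]
      ring
    simp_rw [e]
    rw [ENNReal.tsum_mul_left]
  · have : (D : ℝ≥0∞) ^ (1 / 2 : ℝ) ≠ ⊤ :=
      ENNReal.rpow_ne_top_of_nonneg (by norm_num) ENNReal.coe_ne_top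
    finiteness

/-! ### Exchange of the spatial coordinates -/

/-- The isometry of space-time that exchanges the two spatial coordinates. -/
def swapXY : SpaceTime ≃ₗᵢ[ℝ] SpaceTime :=
  LinearIsometryEquiv.piLpCongrLeft 2 ℝ ℝ (Equiv.swap 1 2)

theorem freqX_swapXY (z : SpaceTime) : freqX (swapXY z) = freqY z := by
  simp [swapXY, freqX, freqY, LinearIsometryEquiv.piLpCongrLeft_apply]

theorem freqY_swapXY (z : SpaceTime) : freqY (swapXY z) = freqX z := by
  simp [swapXY, freqX, freqY, LinearIsometryEquiv.piLpCongrLeft_apply]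

theorem modulation_swapXY (z : SpaceTime) : modulation (swapXY z) = modulation z := by
  have h : swapXY z 0 = z 0 := by
    simp [swapXY, LinearIsometryEquiv.piLpCongrLeft_apply, Equiv.swap_apply_of_ne_of_ne]
  have h1 := freqX_swapXY z
  have h2 := freqY_swapXY z
  unfold freqX freqY at h1 h2
  rw [modulation, modulation, h, h1, h2]
  ring

theorem lintegral_isometry (e : SpaceTime ≃ₗᵢ[ℝ] SpaceTime) (f : SpaceTime → ℝ≥0∞) :
    ∫⁻ z, f (e z) = ∫⁻ z, f z :=
  e.measurePreserving.lintegral_comp_emb e.toHomeomorph.measurableEmbedding f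

theorem TriBound.comp_isometry {k : SpaceTime → SpaceTime → ℝ≥0∞} {K : ℝ≥0∞} (h : TriBound k K)
    (e : SpaceTime ≃ₗᵢ[ℝ] SpaceTime) : TriBound (fun z₁ z₂ => k (e z₁) (e z₂)) K := by
  intro F G H hF hG hH
  have hc : Measurable e.symm := e.symm.continuous.measurable
  have := h (F ∘ e.symm) (G ∘ e.symm) (H ∘ e.symm) (hF.comp hc) (hG.comp hc) (hH.comp hc)
  have hn : ∀ f : SpaceTime → ℝ≥0∞, nrm volume (f ∘ e.symm) = nrm volume f := fun f => by
    unfold nrm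
    congr 1
    exact lintegral_isometry e.symm fun z => f z ^ 2
  rw [hn, hn, hn, ← lintegral_isometry e] at this
  refine le_trans (le_of_eq (lintegral_congr fun z₁ => ?_)) this
  refine Eq.trans ?_ (lintegral_isometry e fun z₂ => k (e z₁) z₂ *
    ((F ∘ e.symm) (e z₁) * (G ∘ e.symm) z₂ * (H ∘ e.symm) (e z₁ + z₂)))
  simp

/-- Exchange of `ξ` and `η` for both input frequencies. -/
def swapFreq (v : ℝ × ℝ × ℝ × ℝ) : ℝ × ℝ × ℝ × ℝ := (v.2.1, v.1, v.2.2.2, v.2.2.1)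

theorem freqSize_comm (ξ η : ℝ) : freqSize ξ η = freqSize η ξ := by
  rw [freqSize, max_comm |ξ|, freqSize]

/-- The modulation and the frequency weight are symmetric in the two spatial coordinates. -/
theorem triBound_region_swap {R : Set (ℝ × ℝ × ℝ × ℝ)} {K : ℝ≥0∞}
    (h : TriBound (regionKernel R) K) : TriBound (regionKernel (swapFreq ⁻¹' R)) K := by
  refine (h.comp_isometry swapXY).mono (fun z₁ z₂ => le_of_eq ?_) le_rfl
  unfold regionKernel freqKernel
  rw [freqX_swapXY, freqX_swapXY, freqY_swapXY, freqY_swapXY, modulation_swapXY, modulation_swapXY]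
  congr 1
  have hw : ∀ v, freqWeight (swapFreq v) = freqWeight v := fun v => by
    unfold freqWeight swapFreq
    rw [freqSize_comm v.2.1, freqSize_comm v.2.2.2]
  set v : ℝ × ℝ × ℝ × ℝ := (freqX z₁, freqY z₁, freqX z₂, freqY z₂) with hv
  change _ = R.indicator freqWeight (swapFreq v)
  by_cases h1 : swapFreq v ∈ R
  · rw [Set.indicator_of_mem h1, Set.indicator_of_mem (show v ∈ swapFreq ⁻¹' R from h1), hw]
  · rw [Set.indicator_of_notMem h1, Set.indicator_of_notMem (show v ∉ swapFreq ⁻¹' R from h1)]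

theorem triBound_region_union {R R' : Set (ℝ × ℝ × ℝ × ℝ)} {K K' : ℝ≥0∞} (hR : MeasurableSet R)
    (h : TriBound (regionKernel R) K) (h' : TriBound (regionKernel R') K') :
    TriBound (regionKernel (R ∪ R')) (K + K') := by
  refine (h.add h' (measurable_regionKernel hR)).mono (fun z₁ z₂ => ?_) le_rfl
  unfold regionKernel freqKernel
  rw [← add_mul]
  gcongr
  set v : ℝ × ℝ × ℝ × ℝ := (freqX z₁, freqY z₁, freqX z₂, freqY z₂)
  by_cases h1 : v ∈ R
  · rw [Set.indicator_of_mem h1, Set.indicator_of_mem (show v ∈ R ∪ R' from Or.inl h1)]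
    exact le_self_add
  · by_cases h2 : v ∈ R'
    · rw [Set.indicator_of_mem h2, Set.indicator_of_mem (show v ∈ R ∪ R' from Or.inr h2)]
      exact le_add_self
    · rw [Set.indicator_of_notMem (by rintro (h | h); exacts [h1 h, h2 h])]
      exact zero_le

/-- The input frequencies with the largest component in `η` are transversal or parallel. -/
theorem mem_region_of_max_right {v : ℝ × ℝ × ℝ × ℝ}
    (h : maxSize v ≤ |v.2.1| ∨ maxSize v ≤ |v.2.2.2|) :
    3 / 4 * maxSize v ^ 2 ≤ |v.2.1 ^ 2 - v.2.2.2 ^ 2| ∨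
      (maxSize v / 2 ≤ |v.2.1| ∧ maxSize v / 2 ≤ |v.2.2.2|) := by
  have h0 := one_le_maxSize v
  by_cases h1 : maxSize v / 2 ≤ |v.2.1|
  · by_cases h2 : maxSize v / 2 ≤ |v.2.2.2|
    · exact Or.inr ⟨h1, h2⟩
    · left
      have h3 : maxSize v ≤ |v.2.1| := h.resolve_right (by linarith)
      rw [← sq_abs v.2.1, ← sq_abs v.2.2.2]
      refine le_trans ?_ (le_abs_self _)
      nlinarith [abs_nonneg v.2.2.2]
  · left
    have h3 : maxSize v ≤ |v.2.2.2| := h.resolve_left (by linarith)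
    rw [← sq_abs v.2.1, ← sq_abs v.2.2.2, abs_sub_comm]
    refine le_trans ?_ (le_abs_self _)
    nlinarith [abs_nonneg v.2.1]

/-- The low, transversal and parallel regions and their images under the exchange of `ξ` and `η` cover
all input frequencies. -/
theorem exists_triBound_univ : ∃ C : ℝ≥0, TriBound (regionKernel Set.univ) C := by
  obtain ⟨C₀, h₀⟩ := exists_triBound_low
  obtain ⟨C₁, h₁⟩ := exists_triBound_transversal
  obtain ⟨C₂, h₂⟩ := exists_triBound_parallel_large
  obtain ⟨C₃, h₃⟩ := exists_triBound_parallel_small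
  set R₀ : Set (ℝ × ℝ × ℝ × ℝ) := {v | maxSize v ≤ 1} with hR₀
  set R₁ : Set (ℝ × ℝ × ℝ × ℝ) := {v | 3 / 4 * maxSize v ^ 2 ≤ |v.2.1 ^ 2 - v.2.2.2 ^ 2|} with hR₁
  set R₂ : Set (ℝ × ℝ × ℝ × ℝ) := {v | maxSize v / 2 ≤ |v.2.1| ∧ maxSize v / 2 ≤ |v.2.2.2|} ∩
    {v | maxSize v / 4 ≤ |v.2.1 + v.2.2.2|} with hR₂
  set R₃ : Set (ℝ × ℝ × ℝ × ℝ) := {v | maxSize v / 2 ≤ |v.2.1| ∧ maxSize v / 2 ≤ |v.2.2.2|} ∩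
    {v | |v.2.1 + v.2.2.2| ≤ maxSize v / 4} with hR₃
  have m₀ : MeasurableSet R₀ := measurableSet_le (by fun_prop) (by fun_prop)
  have m₁ : MeasurableSet R₁ := measurableSet_le (by fun_prop) (by fun_prop)
  have m₂ : MeasurableSet R₂ :=
    measurableSet_parallel.inter (measurableSet_le (by fun_prop) (by fun_prop))
  have m₃ : MeasurableSet R₃ :=
    measurableSet_parallel.inter (measurableSet_le (by fun_prop) (by fun_prop))
  have hU := triBound_region_union (m₁.union m₂)
    (triBound_region_union m₁ h₁ h₂) h₃
  have mU : MeasurableSet (R₁ ∪ R₂ ∪ R₃) := (m₁.union m₂).union m₃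
  have hall := triBound_region_union m₀ h₀
    (triBound_region_union mU hU (triBound_region_swap hU))
  refine ⟨C₀ + (C₁ + C₂ + C₃ + (C₁ + C₂ + C₃)), ?_⟩
  have hcov : ∀ v : ℝ × ℝ × ℝ × ℝ, (maxSize v ≤ |v.2.1| ∨ maxSize v ≤ |v.2.2.2|) →
      v ∈ R₁ ∪ R₂ ∪ R₃ := by
    intro v hv
    rcases mem_region_of_max_right hv with h | h
    · exact Or.inl (Or.inl h)
    · rcases le_total (maxSize v / 4) |v.2.1 + v.2.2.2| with h' | h'
      · exact Or.inl (Or.inr ⟨h, h'⟩)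
      · exact Or.inr ⟨h, h'⟩
  have : R₀ ∪ (R₁ ∪ R₂ ∪ R₃ ∪ swapFreq ⁻¹' (R₁ ∪ R₂ ∪ R₃)) = Set.univ := by
    refine Set.eq_univ_of_forall fun v => ?_
    by_cases h0 : maxSize v ≤ 1
    · exact Or.inl h0
    right
    have hs : maxSize (swapFreq v) = maxSize v := by
      unfold maxSize swapFreq
      rw [freqSize_comm v.2.1, freqSize_comm v.2.2.2]
    have hmax : maxSize v ≤ |v.1| ∨ maxSize v ≤ |v.2.1| ∨ maxSize v ≤ |v.2.2.1| ∨
        maxSize v ≤ |v.2.2.2| := by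
      by_contra! hc
      obtain ⟨c1, c2, c3, c4⟩ := hc
      refine lt_irrefl (maxSize v) ?_
      nth_rewrite 1 [maxSize]
      exact max_lt (max_lt (by linarith) (max_lt c1 c2)) (max_lt (by linarith) (max_lt c3 c4))
    rcases hmax with h | h | h | h
    · exact Or.inr (hcov (swapFreq v) (Or.inl (by rw [hs]; exact h)))
    · exact Or.inl (hcov v (Or.inl h))
    · exact Or.inr (hcov (swapFreq v) (Or.inr (by rw [hs]; exact h)))
    · exact Or.inl (hcov v (Or.inr h))
  rw [this] at hall
  exact_mod_cast hall

/-! ### Weights and convolutions -/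

/-- The Fourier weight `n ^ s ⟨τ - ξ³ - η³⟩ ^ b` of `X^{s,b}`, with `n = max (1, |ξ|, |η|)`. -/
def wt (s b : ℝ) (z : SpaceTime) : ℝ≥0∞ :=
  ENNReal.ofReal (freqSize (freqX z) (freqY z) ^ s * (1 + |modulation z|) ^ b)

theorem freqSize_pos (ξ η : ℝ) : 0 < freqSize ξ η := zero_lt_one.trans_le (one_le_freqSize ξ η)

@[fun_prop] theorem measurable_wt (s b : ℝ) : Measurable (wt s b) := by
  have : Measurable fun z => freqSize (freqX z) (freqY z) :=
    measurable_freqSize.comp (f := fun z => (freqX z, freqY z)) (by fun_prop)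
  unfold wt
  fun_prop

theorem wt_mul_wt (s b s' b' : ℝ) (z : SpaceTime) :
    wt s b z * wt s' b' z = wt (s + s') (b + b') z := by
  have h := freqSize_pos (freqX z) (freqY z)
  have h' : 0 < 1 + |modulation z| := by positivity
  rw [wt, wt, wt, ← ENNReal.ofReal_mul (by positivity), Real.rpow_add h, Real.rpow_add h']
  congr 1; ring

theorem wt_zero (z : SpaceTime) : wt 0 0 z = 1 := by simp [wt]

theorem wt_mul_wt_neg (s b : ℝ) (z : SpaceTime) : wt (-s) (-b) z * wt s b z = 1 := by
  rw [wt_mul_wt]; simp [wt_zero]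

theorem wt_mono {s s' b b' : ℝ} (hs : s ≤ s') (hb : b ≤ b') (z : SpaceTime) :
    wt s b z ≤ wt s' b' z := by
  have h := freqSize_pos (freqX z) (freqY z)
  refine ENNReal.ofReal_le_ofReal (mul_le_mul ?_ ?_ (by positivity) (by positivity))
  · exact Real.rpow_le_rpow_of_exponent_le (one_le_freqSize _ _) hs
  · exact Real.rpow_le_rpow_of_exponent_le (by linarith [abs_nonneg (modulation z)]) hb

theorem wt_neg_apply (s b : ℝ) (z : SpaceTime) : wt s b (-z) = wt s b z := by
  have h1 : freqX (-z) = -freqX z := by simp [freqX]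
  have h2 : freqY (-z) = -freqY z := by simp [freqY]
  have h3 : modulation (-z) = -modulation z := by simp only [modulation, PiLp.neg_apply]; ring
  rw [wt, wt, h1, h2, h3, abs_neg, freqSize, freqSize, abs_neg, abs_neg]

/-- The convolution of `[0, ∞]`-valued functions. -/
def cnv (F G : SpaceTime → ℝ≥0∞) (z : SpaceTime) : ℝ≥0∞ := ∫⁻ x, F x * G (z - x)

theorem measurable_cnv {F G : SpaceTime → ℝ≥0∞} (hF : Measurable F) (hG : Measurable G) :
    Measurable (cnv F G) :=
  Measurable.lintegral_prod_right' (f := fun p : SpaceTime × SpaceTime => F p.2 * G (p.1 - p.2))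
    (by fun_prop)

theorem cnv_comm (F G : SpaceTime → ℝ≥0∞) : cnv F G = cnv G F := by
  funext z
  unfold cnv
  rw [← lintegral_sub_left_eq_self _ z]
  simp [mul_comm]

theorem cnv_assoc {F G H : SpaceTime → ℝ≥0∞} (hF : Measurable F) (hG : Measurable G)
    (hH : Measurable H) : cnv (cnv F G) H = cnv F (cnv G H) := by
  funext z
  unfold cnv
  calc ∫⁻ y, (∫⁻ x, F x * G (y - x)) * H (z - y)
      = ∫⁻ y, ∫⁻ x, F x * G (y - x) * H (z - y) :=
        lintegral_congr fun y => (lintegral_mul_const _ (by fun_prop)).symm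
    _ = ∫⁻ x, ∫⁻ y, F x * G (y - x) * H (z - y) :=
        lintegral_lintegral_swap (Measurable.aemeasurable (by fun_prop))
    _ = ∫⁻ x, F x * ∫⁻ y, G y * H (z - x - y) := by
        refine lintegral_congr fun x => ?_
        rw [← lintegral_const_mul _ (by fun_prop), ← lintegral_add_right_eq_self _ x]
        refine lintegral_congr fun y => ?_
        rw [add_sub_cancel_right, mul_assoc, sub_sub, add_comm x y]

theorem cnv_right_comm {F G H : SpaceTime → ℝ≥0∞} (hF : Measurable F) (hG : Measurable G)
    (hH : Measurable H) : cnv (cnv F G) H = cnv (cnv F H) G := by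
  rw [cnv_assoc hF hG hH, cnv_assoc hF hH hG, cnv_comm G H]

theorem lintegral_mul_cnv {F G H : SpaceTime → ℝ≥0∞} (hF : Measurable F) (hG : Measurable G)
    (hH : Measurable H) : ∫⁻ z, H z * cnv F G z = ∫⁻ x, ∫⁻ y, F x * G y * H (x + y) := by
  unfold cnv
  calc ∫⁻ z, H z * ∫⁻ x, F x * G (z - x) = ∫⁻ z, ∫⁻ x, F x * G (z - x) * H z :=
        lintegral_congr fun z => by
          rw [← lintegral_const_mul _ (by fun_prop)]
          exact lintegral_congr fun x => by ring
    _ = ∫⁻ x, ∫⁻ z, F x * G (z - x) * H z :=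
        lintegral_lintegral_swap (Measurable.aemeasurable (by fun_prop))
    _ = _ := by
        refine lintegral_congr fun x => ?_
        rw [← lintegral_add_left_eq_self _ x]
        simp

/-! ### The bilinear and trilinear estimates on the Fourier side -/

theorem regionKernel_univ (z₁ z₂ : SpaceTime) : regionKernel Set.univ z₁ z₂ =
    wt (-(1 / 4)) (-(33 / 64)) z₁ * wt (1 / 2) (-(15 / 32)) z₂ := by
  have h1 := freqSize_pos (freqX z₁) (freqY z₁)
  have h2 := freqSize_pos (freqX z₂) (freqY z₂)
  rw [regionKernel, freqKernel, Set.indicator_univ, freqWeight, brk, brk, wt, wt,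
    ← ENNReal.ofReal_mul (by positivity), ← ENNReal.ofReal_mul (by positivity),
    ← ENNReal.ofReal_mul (by positivity)]
  congr 1; ring

/-- The bilinear estimate
`‖u v‖_{L²} ≲ ‖u‖_{X^{1/4, 33/64}} ‖v‖_{X^{-1/2, 15/32}}` on the Fourier side. -/
theorem exists_nrm_cnv_le : ∃ C : ℝ≥0, ∀ F G : SpaceTime → ℝ≥0∞, Measurable F → Measurable G →
    nrm volume (cnv F G) ≤ C * (nrm volume (fun z => wt (1 / 4) (33 / 64) z * F z) *
      nrm volume (fun z => wt (-(1 / 2)) (15 / 32) z * G z)) := by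
  obtain ⟨C, hC⟩ := exists_triBound_univ
  refine ⟨C, fun F G hF hG => nrm_le_of_forall_lintegral_mul_le (measurable_cnv hF hG)
    fun H hH => ?_⟩
  rw [lintegral_mul_cnv hF hG hH, mul_assoc]
  refine le_trans (le_of_eq ?_) (hC _ _ H ((measurable_wt (1 / 4) (33 / 64)).mul hF)
    ((measurable_wt (-(1 / 2)) (15 / 32)).mul hG) hH)
  refine lintegral_congr fun z₁ => lintegral_congr fun z₂ => ?_
  have e1 := wt_mul_wt_neg (1 / 4) (33 / 64) z₁
  have e2 := wt_mul_wt_neg (-(1 / 2)) (15 / 32) z₂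
  rw [neg_neg] at e2
  rw [regionKernel_univ]
  calc F z₁ * G z₂ * H (z₁ + z₂)
      = (wt (-(1 / 4)) (-(33 / 64)) z₁ * wt (1 / 4) (33 / 64) z₁) *
        (wt (1 / 2) (-(15 / 32)) z₂ * wt (-(1 / 2)) (15 / 32) z₂) *
          (F z₁ * G z₂ * H (z₁ + z₂)) := by rw [e1, e2]; ring
    _ = _ := by ring

theorem nrm_wt_mono {s s' b b' : ℝ} (hs : s ≤ s') (hb : b ≤ b') (F : SpaceTime → ℝ≥0∞) :
    nrm volume (fun z => wt s b z * F z) ≤ nrm volume (fun z => wt s' b' z * F z) :=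
  nrm_mono fun z => mul_le_mul_left (wt_mono hs hb z) _

/-- The trilinear estimate with half a derivative on the output, where the second factor is measured
with half a derivative less. By duality, the estimate is one for the integral of four functions, and
the test function is paired with the third factor. -/
theorem exists_nrm_cnv_cnv_le : ∃ C : ℝ≥0, ∀ A B D : SpaceTime → ℝ≥0∞,
    Measurable A → Measurable B → Measurable D →
    nrm volume (fun z => wt (1 / 2) (-(15 / 32)) z * cnv (cnv A B) D z) ≤
      C * (nrm volume (fun z => wt (1 / 4) (33 / 64) z * A z) *
        nrm volume (fun z => wt (-(1 / 2)) (33 / 64) z * B z) *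
        nrm volume (fun z => wt (1 / 4) (33 / 64) z * D z)) := by
  obtain ⟨C, hC⟩ := exists_nrm_cnv_le
  refine ⟨C * C, fun A B D hA hB hD => ?_⟩
  have hAB := measurable_cnv hA hB
  refine nrm_le_of_forall_lintegral_mul_le
    ((measurable_wt _ _).mul (measurable_cnv hAB hD)) fun H hH => ?_
  set H' : SpaceTime → ℝ≥0∞ := fun z => H z * wt (1 / 2) (-(15 / 32)) z with hH'
  have hH'm : Measurable H' := by fun_prop
  set D' : SpaceTime → ℝ≥0∞ := fun z => D (-z) with hD'
  have hD'm : Measurable D' := by fun_prop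
  have e1 : nrm volume (fun z => wt (-(1 / 2)) (15 / 32) z * H' z) = nrm volume H := by
    congr 1
    funext z
    have := wt_mul_wt_neg (-(1 / 2)) (15 / 32) z
    rw [neg_neg] at this
    rw [hH']
    calc _ = (wt (1 / 2) (-(15 / 32)) z * wt (-(1 / 2)) (15 / 32) z) * H z := by ring
      _ = _ := by rw [this, one_mul]
  have e2 : nrm volume (fun z => wt (1 / 4) (33 / 64) z * D' z) =
      nrm volume (fun z => wt (1 / 4) (33 / 64) z * D z) := by
    unfold nrm
    congr 1
    rw [← lintegral_isometry (LinearIsometryEquiv.neg ℝ)]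
    simp [hD', wt_neg_apply]
  calc ∫⁻ z, H z * (wt (1 / 2) (-(15 / 32)) z * cnv (cnv A B) D z)
      = ∫⁻ z, H' z * cnv (cnv A B) D z := lintegral_congr fun z => by rw [hH']; ring
    _ = ∫⁻ x, ∫⁻ y, cnv A B x * D y * H' (x + y) := lintegral_mul_cnv hAB hD hH'm
    _ = ∫⁻ x, cnv A B x * cnv D' H' x := by
        refine lintegral_congr fun x => ?_
        simp only [mul_assoc]
        rw [lintegral_const_mul _ (show Measurable fun y => D y * H' (x + y) by fun_prop)]
        congr 1
        refine (lintegral_isometry (LinearIsometryEquiv.neg ℝ) fun y => D y * H' (x + y)).symm.trans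
          (lintegral_congr fun y => ?_)
        simp [hD', sub_eq_add_neg]
    _ ≤ nrm volume (cnv A B) * nrm volume (cnv D' H') :=
        lintegral_mul_le_nrm hAB.aemeasurable (measurable_cnv hD'm hH'm).aemeasurable
    _ ≤ (C * (nrm volume (fun z => wt (1 / 4) (33 / 64) z * A z) *
          nrm volume (fun z => wt (-(1 / 2)) (33 / 64) z * B z))) *
        (C * (nrm volume (fun z => wt (1 / 4) (33 / 64) z * D z) * nrm volume H)) := by
        refine mul_le_mul' ((hC A B hA hB).trans ?_) ((hC D' H' hD'm hH'm).trans ?_)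
        · gcongr
          exact nrm_wt_mono le_rfl (by norm_num) B
        · rw [e1, e2]
    _ = _ := by push_cast; ring

theorem freqSize_add_le (z w : SpaceTime) : freqSize (freqX (z + w)) (freqY (z + w)) ≤
    freqSize (freqX z) (freqY z) + freqSize (freqX w) (freqY w) := by
  have a1 := one_le_freqSize (freqX z) (freqY z)
  have a2 := one_le_freqSize (freqX w) (freqY w)
  have b1 := abs_left_le_freqSize (freqX z) (freqY z)
  have b2 := abs_left_le_freqSize (freqX w) (freqY w)
  have c1 := abs_right_le_freqSize (freqX z) (freqY z)
  have c2 := abs_right_le_freqSize (freqX w) (freqY w)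
  rw [freqX_add, freqY_add]
  exact max_le (by linarith) (max_le ((abs_add_le _ _).trans (by linarith))
    ((abs_add_le _ _).trans (by linarith)))

theorem wt_add_le {t : ℝ} (ht : 0 ≤ t) (x y w : SpaceTime) : wt t 0 (x + y + w) ≤
    ENNReal.ofReal (3 ^ t) * (wt t 0 x + wt t 0 y + wt t 0 w) := by
  have h1 := freqSize_add_le (x + y) w
  have h2 := freqSize_add_le x y
  simp only [wt, Real.rpow_zero, mul_one]
  set n := freqSize (freqX (x + y + w)) (freqY (x + y + w))
  set a := freqSize (freqX x) (freqY x)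
  set b := freqSize (freqX y) (freqY y)
  set c := freqSize (freqX w) (freqY w)
  have ha : 0 < a := freqSize_pos _ _
  have hb : 0 < b := freqSize_pos _ _
  have hc : 0 < c := freqSize_pos _ _
  have hn : 0 < n := freqSize_pos _ _
  rw [← ENNReal.ofReal_add (by positivity) (by positivity),
    ← ENNReal.ofReal_add (by positivity) (by positivity), ← ENNReal.ofReal_mul (by positivity)]
  refine ENNReal.ofReal_le_ofReal ?_
  have key : ∀ m, 0 < m → n ≤ 3 * m → n ^ t ≤ 3 ^ t * m ^ t := fun m hm h => by
    rw [← Real.mul_rpow (by norm_num) hm.le]; gcongr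
  have pa : 0 < a ^ t := by positivity
  have pb : 0 < b ^ t := by positivity
  have pc : 0 < c ^ t := by positivity
  rcases le_total a b with hab | hab
  · rcases le_total b c with hbc | hbc
    · refine (key c hc (by linarith)).trans ?_; gcongr; linarith
    · refine (key b hb (by linarith)).trans ?_; gcongr; linarith
  · rcases le_total a c with hac | hac
    · refine (key c hc (by linarith)).trans ?_; gcongr; linarith
    · refine (key a ha (by linarith)).trans ?_; gcongr; linarith

theorem nrm_add_le {f g : SpaceTime → ℝ≥0∞} (hf : Measurable f) (hg : Measurable g) :
    nrm volume (fun z => f z + g z) ≤ nrm volume f + nrm volume g := by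
  have := ENNReal.lintegral_Lp_add_le (μ := volume) hf.aemeasurable hg.aemeasurable
    (p := 2) (by norm_num)
  simpa [nrm] using this

/-- A non-negative power of the output frequency is distributed over the three factors. -/
theorem wt_mul_cnv_cnv_le {t : ℝ} (ht : 0 ≤ t) {A B D : SpaceTime → ℝ≥0∞} (hA : Measurable A)
    (hB : Measurable B) (hD : Measurable D) (z : SpaceTime) :
    wt t 0 z * cnv (cnv A B) D z ≤ ENNReal.ofReal (3 ^ t) *
      (cnv (cnv (fun x => wt t 0 x * A x) B) D z + cnv (cnv A fun x => wt t 0 x * B x) D z +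
        cnv (cnv A B) (fun x => wt t 0 x * D x) z) := by
  have e : ∀ A B D : SpaceTime → ℝ≥0∞, Measurable A → Measurable B → Measurable D →
      cnv (cnv A B) D z = ∫⁻ y, ∫⁻ x, A x * B (y - x) * D (z - y) := fun A B D hA hB hD => by
    unfold cnv
    exact lintegral_congr fun y => (lintegral_mul_const _ (by fun_prop)).symm
  have hm : ∀ A B D : SpaceTime → ℝ≥0∞, Measurable A → Measurable B → Measurable D →
      Measurable fun y => ∫⁻ x, A x * B (y - x) * D (z - y) := fun A B D hA hB hD =>
    Measurable.lintegral_prod_right'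
      (f := fun p : SpaceTime × SpaceTime => A p.2 * B (p.1 - p.2) * D (z - p.1)) (by fun_prop)
  have hwt := measurable_wt t 0
  rw [e _ _ _ hA hB hD, e _ _ _ (by fun_prop) hB hD, e _ _ _ hA (by fun_prop) hD,
    e _ _ _ hA hB (by fun_prop)]
  rw [← lintegral_const_mul _ (hm _ _ _ hA hB hD),
    ← lintegral_add_left (hm _ _ _ (by fun_prop) hB hD),
    ← lintegral_add_left (show Measurable fun y =>
        (∫⁻ x, wt t 0 x * A x * B (y - x) * D (z - y)) +
          ∫⁻ x, A x * (wt t 0 (y - x) * B (y - x)) * D (z - y) from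
      (hm _ _ _ (hwt.mul hA) hB hD).add (hm _ _ _ hA (hwt.mul hB) hD)),
    ← lintegral_const_mul' _ _ ENNReal.ofReal_ne_top]
  refine lintegral_mono fun y => ?_
  rw [← lintegral_const_mul _ (by fun_prop), ← lintegral_add_left (by fun_prop),
    ← lintegral_add_left (by fun_prop), ← lintegral_const_mul' _ _ ENNReal.ofReal_ne_top]
  refine lintegral_mono fun x => ?_
  have h := wt_add_le ht x (y - x) (z - y)
  rw [show x + (y - x) + (z - y) = z by abel] at h
  calc wt t 0 z * (A x * B (y - x) * D (z - y)) ≤ (ENNReal.ofReal (3 ^ t) *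
        (wt t 0 x + wt t 0 (y - x) + wt t 0 (z - y))) * (A x * B (y - x) * D (z - y)) := by gcongr
    _ = _ := by ring

/-- The trilinear estimate with the full derivative on the output, on the Fourier side. -/
theorem exists_trilinear {s : ℝ} (hs : 1 / 4 ≤ s) :
    ∃ C : ℝ≥0, ∀ F₁ F₂ F₃ : SpaceTime → ℝ≥0∞, Measurable F₁ → Measurable F₂ → Measurable F₃ →
    nrm volume (fun z => wt (s + 1) (-(15 / 32)) z * cnv (cnv F₁ F₂) F₃ z) ≤
      C * (nrm volume (fun z => wt s (33 / 64) z * F₁ z) *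
        nrm volume (fun z => wt s (33 / 64) z * F₂ z) *
        nrm volume (fun z => wt s (33 / 64) z * F₃ z)) := by
  obtain ⟨C, hC⟩ := exists_nrm_cnv_cnv_le
  set t := s + 1 / 2 with ht
  refine ⟨(3 ^ t : ℝ).toNNReal * (3 * C), fun F₁ F₂ F₃ h₁ h₂ h₃ => ?_⟩
  have hwt := measurable_wt t 0
  have hw2 := measurable_wt (1 / 2) (-(15 / 32))
  have one : ∀ A B D : SpaceTime → ℝ≥0∞, Measurable A → Measurable B → Measurable D →
      nrm volume (fun z => wt (1 / 2) (-(15 / 32)) z *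
        cnv (cnv A fun x => wt t 0 x * B x) D z) ≤
      C * (nrm volume (fun z => wt s (33 / 64) z * A z) *
        nrm volume (fun z => wt s (33 / 64) z * B z) *
        nrm volume (fun z => wt s (33 / 64) z * D z)) := by
    intro A B D hA hB hD
    refine (hC A _ D hA (by fun_prop) hD).trans ?_
    refine mul_le_mul_right (mul_le_mul' (mul_le_mul' ?_ ?_) ?_) _
    · exact nrm_wt_mono hs le_rfl A
    · apply le_of_eq
      congr 1
      funext z
      rw [← mul_assoc, wt_mul_wt, ht]
      congr 2 <;> ring
    · exact nrm_wt_mono hs le_rfl D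
  set T₁ := cnv (cnv (fun x => wt t 0 x * F₁ x) F₂) F₃ with hT₁
  set T₂ := cnv (cnv F₁ fun x => wt t 0 x * F₂ x) F₃ with hT₂
  set T₃ := cnv (cnv F₁ F₂) (fun x => wt t 0 x * F₃ x) with hT₃
  have m₁ : Measurable T₁ := measurable_cnv (measurable_cnv (by fun_prop) h₂) h₃
  have m₂ : Measurable T₂ := measurable_cnv (measurable_cnv h₁ (by fun_prop)) h₃
  have m₃ : Measurable T₃ := measurable_cnv (measurable_cnv h₁ h₂) (by fun_prop)
  set P := nrm volume (fun z => wt s (33 / 64) z * F₁ z) *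
        nrm volume (fun z => wt s (33 / 64) z * F₂ z) *
        nrm volume (fun z => wt s (33 / 64) z * F₃ z) with hP
  have b₂ : nrm volume (fun z => wt (1 / 2) (-(15 / 32)) z * T₂ z) ≤ C * P := one _ _ _ h₁ h₂ h₃
  have b₁ : nrm volume (fun z => wt (1 / 2) (-(15 / 32)) z * T₁ z) ≤ C * P := by
    rw [hT₁, cnv_comm (fun x => wt t 0 x * F₁ x) F₂]
    refine (one _ _ _ h₂ h₁ h₃).trans (le_of_eq ?_)
    rw [hP]; ring
  have b₃ : nrm volume (fun z => wt (1 / 2) (-(15 / 32)) z * T₃ z) ≤ C * P := by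
    rw [hT₃, cnv_right_comm h₁ h₂ (by fun_prop)]
    refine (one _ _ _ h₁ h₃ h₂).trans (le_of_eq ?_)
    rw [hP]; ring
  calc nrm volume (fun z => wt (s + 1) (-(15 / 32)) z * cnv (cnv F₁ F₂) F₃ z)
      ≤ nrm volume (fun z => ENNReal.ofReal (3 ^ t) * (wt (1 / 2) (-(15 / 32)) z * T₁ z +
          wt (1 / 2) (-(15 / 32)) z * T₂ z + wt (1 / 2) (-(15 / 32)) z * T₃ z)) := by
        refine nrm_mono fun z => ?_
        calc wt (s + 1) (-(15 / 32)) z * cnv (cnv F₁ F₂) F₃ z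
            = wt (1 / 2) (-(15 / 32)) z * (wt t 0 z * cnv (cnv F₁ F₂) F₃ z) := by
              rw [← mul_assoc, wt_mul_wt, ht]
              congr 2 <;> ring
          _ ≤ wt (1 / 2) (-(15 / 32)) z * (ENNReal.ofReal (3 ^ t) * (T₁ z + T₂ z + T₃ z)) := by
              exact mul_le_mul_right
                (wt_mul_cnv_cnv_le (t := t) (by linarith) h₁ h₂ h₃ z) _
          _ = _ := by ring
    _ = ENNReal.ofReal (3 ^ t) * nrm volume (fun z => wt (1 / 2) (-(15 / 32)) z * T₁ z +
          wt (1 / 2) (-(15 / 32)) z * T₂ z + wt (1 / 2) (-(15 / 32)) z * T₃ z) :=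
        nrm_const_mul _ (by fun_prop)
    _ ≤ ENNReal.ofReal (3 ^ t) * (C * P + C * P + C * P) := by
        gcongr
        refine (nrm_add_le (by fun_prop) (by fun_prop)).trans ?_
        gcongr
        refine (nrm_add_le (by fun_prop) (by fun_prop)).trans ?_
        gcongr
    _ = _ := by
        rw [ENNReal.ofReal]; push_cast; ring

/-! ### Density of compactly supported Schwartz functions -/

/-- Schwartz functions are approximated by their cutoffs. -/
theorem exists_tendsto_hasCompactSupport (φ : 𝓢(SpaceTime, ℂ)) :
    ∃ a : ℕ → 𝓢(SpaceTime, ℂ), (∀ n, HasCompactSupport (a n)) ∧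
      Filter.Tendsto a Filter.atTop (nhds φ) := by
  let χ : ContDiffBump (0 : SpaceTime) := ⟨1, 2, one_pos, one_lt_two⟩
  have hcs : HasCompactSupport (Complex.ofRealCLM ∘ χ) := χ.hasCompactSupport.comp_left rfl
  have hcd : ContDiff ℝ ∞ (Complex.ofRealCLM ∘ χ) := Complex.ofRealCLM.contDiff.comp χ.contDiff
  let h : 𝓢(SpaceTime, ℂ) := hcs.toSchwartzMap hcd
  have hh : ∀ x, h x = ((χ x : ℝ) : ℂ) := fun x => rfl
  let c : ℕ → ℝ := fun n => (n + 1 : ℝ)⁻¹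
  have hc : ∀ n, 0 < c n := fun n => by positivity
  have hc1 : ∀ n, c n ≤ 1 := fun n => inv_le_one_of_one_le₀ (by linarith [n.cast_nonneg (α := ℝ)])
  let g : ℕ → SpaceTime → ℂ := fun n x => h (c n • x)
  have hgs : ∀ n, ContDiff ℝ ∞ (g n) := fun n => (h.smooth ⊤).comp (contDiff_const_smul (c n))
  have hgc : ∀ n, HasCompactSupport (g n) := fun n => hcs.comp_smul (hc n).ne'
  have hfc : ∀ n, HasCompactSupport (fun y => g n y * φ y) := fun n => (hgc n).mul_right
  have hfs : ∀ n, ContDiff ℝ ∞ (fun y => g n y * φ y) := fun n => (hgs n).mul (φ.smooth ⊤)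
  refine ⟨fun n => (hfc n).toSchwartzMap (hfs n), fun n => hfc n, ?_⟩
  rw [(schwartz_withSeminorms ℝ SpaceTime ℂ).tendsto_nhds]
  rintro ⟨k, m⟩ ε hε
  -- Outside the ball of radius `1 / c`, a spare power of `‖x‖` gains the factor `c`.
  obtain ⟨C, hC⟩ : ∃ C : ℝ, ∀ n, SchwartzMap.seminorm ℝ k m
      ((hfc n).toSchwartzMap (hfs n) - φ) ≤ c n * C := by
    set B : ℝ := ∑ i ∈ Finset.range (m + 1), (m.choose i : ℝ) *
      SchwartzMap.seminorm ℝ 0 i h * SchwartzMap.seminorm ℝ (k + 1) (m - i) φ with hB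
    have hB0 : 0 ≤ B := Finset.sum_nonneg fun i _ => by positivity
    refine ⟨B + SchwartzMap.seminorm ℝ (k + 1) m φ, fun n => ?_⟩
    refine SchwartzMap.seminorm_le_bound ℝ k m _
      (mul_nonneg (hc n).le (add_nonneg hB0 (by positivity))) fun x => ?_
    rcases lt_or_ge ‖c n • x‖ 1 with hx | hx
    · have : ((hfc n).toSchwartzMap (hfs n) - φ : 𝓢(SpaceTime, ℂ)) =ᶠ[nhds x] fun _ => 0 := by
        have hcont : Continuous fun y : SpaceTime => ‖c n • y‖ := by fun_prop
        filter_upwards [hcont.continuousAt.eventually_lt continuousAt_const hx] with y hy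
        have : χ (c n • y) = 1 := χ.one_of_mem_closedBall (by simpa [χ] using hy.le)
        simp [g, hh, this]
      rw [this.iteratedFDeriv ℝ m |>.eq_of_nhds]
      have h0 : iteratedFDeriv ℝ m (fun _ : SpaceTime => (0 : ℂ)) x = 0 := by
        simp
      rw [h0, norm_zero, mul_zero]
      exact mul_nonneg (hc n).le (add_nonneg hB0 (by positivity))
    · have e : ∀ i, ‖iteratedFDeriv ℝ i (g n) x‖ ≤ SchwartzMap.seminorm ℝ 0 i h := fun i => by
        have := iteratedFDeriv_comp_const_smul (𝕜 := ℝ) (i := i) (c n) (h.smooth i)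
        have h2 := congrFun this x
        change ‖iteratedFDeriv ℝ i (fun x => h (c n • x)) x‖ ≤ _
        rw [h2, norm_smul, norm_pow, Real.norm_of_nonneg (hc n).le]
        have h3 := h.norm_iteratedFDeriv_le_seminorm ℝ i (c n • x)
        calc c n ^ i * _ ≤ 1 * SchwartzMap.seminorm ℝ 0 i h :=
              mul_le_mul (pow_le_one₀ (hc n).le (hc1 n)) h3 (norm_nonneg _) zero_le_one
          _ = _ := one_mul _
      have hle : ‖iteratedFDeriv ℝ m (((hfc n).toSchwartzMap (hfs n) - φ : 𝓢(SpaceTime, ℂ))) x‖ ≤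
          ‖iteratedFDeriv ℝ m (fun y => g n y * φ y) x‖ + ‖iteratedFDeriv ℝ m φ x‖ := by
        have : iteratedFDeriv ℝ m (fun y => g n y * φ y - φ y) x =
            iteratedFDeriv ℝ m (fun y => g n y * φ y) x - iteratedFDeriv ℝ m φ x :=
          iteratedFDeriv_sub_apply ((hfs n).of_le (by exact_mod_cast le_top)).contDiffAt
            (φ.smooth m).contDiffAt
        calc _ = ‖iteratedFDeriv ℝ m (fun y => g n y * φ y - φ y) x‖ := rfl
          _ ≤ _ := by rw [this]; exact norm_sub_le _ _
      have hx1 : ‖x‖ ^ k ≤ c n * ‖x‖ ^ (k + 1) := by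
        rw [norm_smul, Real.norm_of_nonneg (hc n).le] at hx
        calc ‖x‖ ^ k = 1 * ‖x‖ ^ k := (one_mul _).symm
          _ ≤ (c n * ‖x‖) * ‖x‖ ^ k := by gcongr
          _ = _ := by ring
      have hL : ‖x‖ ^ (k + 1) * ‖iteratedFDeriv ℝ m (fun y => g n y * φ y) x‖ ≤ B := by
        calc ‖x‖ ^ (k + 1) * ‖iteratedFDeriv ℝ m (fun y => g n y * φ y) x‖
            ≤ ‖x‖ ^ (k + 1) * ∑ i ∈ Finset.range (m + 1), (m.choose i : ℝ) *
              ‖iteratedFDeriv ℝ i (g n) x‖ * ‖iteratedFDeriv ℝ (m - i) φ x‖ := by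
              refine mul_le_mul_of_nonneg_left ?_ (by positivity)
              exact norm_iteratedFDeriv_mul_le (hgs n) (φ.smooth ⊤) x (by exact_mod_cast le_top)
          _ ≤ B := by
              rw [Finset.mul_sum, hB]
              refine Finset.sum_le_sum fun i _ => ?_
              have := φ.le_seminorm ℝ (k + 1) (m - i) x
              calc _ = (m.choose i : ℝ) * ‖iteratedFDeriv ℝ i (g n) x‖ *
                    (‖x‖ ^ (k + 1) * ‖iteratedFDeriv ℝ (m - i) φ x‖) := by ring
                _ ≤ _ := by gcongr; exact e i
      calc _ ≤ c n * ‖x‖ ^ (k + 1) *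
            (‖iteratedFDeriv ℝ m (fun y => g n y * φ y) x‖ + ‖iteratedFDeriv ℝ m φ x‖) :=
              mul_le_mul hx1 hle (norm_nonneg _) (mul_nonneg (hc n).le (by positivity))
        _ = c n * (‖x‖ ^ (k + 1) * ‖iteratedFDeriv ℝ m (fun y => g n y * φ y) x‖ +
              ‖x‖ ^ (k + 1) * ‖iteratedFDeriv ℝ m φ x‖) := by ring
        _ ≤ _ := by
          refine mul_le_mul_of_nonneg_left (add_le_add hL ?_) (hc n).le
          exact φ.le_seminorm ℝ (k + 1) m x
  have hlim : Filter.Tendsto (fun n => c n * C) Filter.atTop (nhds 0) := by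
    have : Filter.Tendsto c Filter.atTop (nhds 0) := by
      simpa [c] using tendsto_one_div_add_atTop_nhds_zero_nat (𝕜 := ℝ)
    simpa using this.mul_const C
  filter_upwards [hlim.eventually_lt_const hε] with n hn
  exact (hC n).trans_lt hn

/-- A tempered distribution is determined by its values on compactly supported test functions. -/
theorem temperedDistribution_ext {v w : 𝓢'(SpaceTime, ℂ)}
    (h : ∀ φ : 𝓢(SpaceTime, ℂ), HasCompactSupport φ → v φ = w φ) : v = w := by
  ext φ
  obtain ⟨a, ha, hlim⟩ := exists_tendsto_hasCompactSupport φ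
  have hv := (v.continuous.tendsto φ).comp hlim
  have hw := (w.continuous.tendsto φ).comp hlim
  refine tendsto_nhds_unique hv (hw.congr fun n => ?_)
  exact (h _ (ha n)).symm

/-! ### Products and convolutions -/

open FourierTransform

theorem continuous_integral_mul {α : SpaceTime → ℂ} (hα : MemLp α 2) :
    Continuous fun g : Lp ℂ 2 (volume : Measure SpaceTime) => ∫ z, α z * g z := by
  have hc : MemLp (fun z => (starRingEnd ℂ) (α z)) 2 := hα.star
  have : (fun g : Lp ℂ 2 (volume : Measure SpaceTime) => ∫ z, α z * g z) =
      fun g => inner ℂ hc.toLp g := by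
    funext g
    rw [L2.inner_def]
    refine integral_congr_ae ?_
    filter_upwards [hc.coeFn_toLp] with z hz
    rw [hz]
    simp [mul_comm]
  rw [this]
  exact continuous_const.inner continuous_id

theorem memLp_comp_sub_left {f : SpaceTime → ℂ} (hf : MemLp f 2) (ζ : SpaceTime) :
    MemLp (fun y => f (ζ - y)) 2 :=
  hf.comp_measurePreserving (Measure.measurePreserving_sub_left volume ζ)

theorem memLp_fourierChar_smul {f : SpaceTime → ℂ} (hf : MemLp f 2) (ζ : SpaceTime) :
    MemLp (fun z => Real.fourierChar (-inner ℝ z ζ) • f z) 2 := by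
  refine hf.of_le ?_ (Filter.Eventually.of_forall fun z => by simp)
  have : Continuous fun z : SpaceTime => Real.fourierChar (-inner ℝ z ζ) :=
    Real.continuous_fourierChar.comp (by fun_prop)
  exact this.aestronglyMeasurable.smul hf.1

/-- The Fourier transform of a product of two `L²` functions is, at every point, the convolution
of their Fourier transforms. -/
theorem fourier_mul_eq_integral (f g : Lp ℂ 2 (volume : Measure SpaceTime)) (ζ : SpaceTime) :
    𝓕 (fun z => f z * g z) ζ = ∫ y, (𝓕 f : Lp ℂ 2 (volume : Measure SpaceTime)) y *
      (𝓕 g : Lp ℂ 2 (volume : Measure SpaceTime)) (ζ - y) := by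
  set F : Lp ℂ 2 (volume : Measure SpaceTime) := 𝓕 f with hF
  have e1 : ∀ g : Lp ℂ 2 (volume : Measure SpaceTime), 𝓕 (fun z => f z * g z) ζ =
      ∫ z, (Real.fourierChar (-inner ℝ z ζ) • f z) * g z := fun g => by
    simp only [Real.fourier_eq, smul_mul_assoc]
  have e2 : ∀ G : Lp ℂ 2 (volume : Measure SpaceTime), ∫ y, F y * G (ζ - y) =
      ∫ y, F (ζ - y) * G y := fun G => by
    rw [← integral_sub_left_eq_self _ volume ζ]
    simp
  rw [e1, e2]
  refine (SchwartzMap.denseRange_toLpCLM (E := SpaceTime) (F := ℂ) (p := 2) (μ := volume)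
    ENNReal.ofNat_ne_top).induction_on (p := fun g : Lp ℂ 2 (volume : Measure SpaceTime) =>
      ∫ z, (Real.fourierChar (-inner ℝ z ζ) • f z) * g z = ∫ y, F (ζ - y) *
        (𝓕 g : Lp ℂ 2 (volume : Measure SpaceTime)) y) g ?_ fun φ => ?_
  · exact isClosed_eq (continuous_integral_mul (memLp_fourierChar_smul (Lp.memLp f) ζ))
      ((continuous_integral_mul (memLp_comp_sub_left (Lp.memLp F) ζ)).comp
        (Lp.fourierTransformₗᵢ SpaceTime ℂ).continuous)
  -- For a Schwartz function, test `𝓕 f` with the reflected translate of `𝓕 φ`.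
  let θ : 𝓢(SpaceTime, ℂ) := (𝓕⁻ φ).compSubConstCLM ℂ ζ
  have hθ : ∀ y, θ y = (𝓕 φ) (ζ - y) := fun y => by
    change (𝓕⁻ φ) (y - ζ) = _
    rw [SchwartzMap.fourierInv_coe, SchwartzMap.fourier_coe, Real.fourierInv_eq_fourier_neg,
      neg_sub]
  have hFθ : ∀ z, (𝓕 θ) z = Real.fourierChar (-inner ℝ z ζ) • φ z := fun z => by
    have h1 : φ z = 𝓕⁻ (⇑(𝓕 φ : 𝓢(SpaceTime, ℂ))) z := by
      rw [← SchwartzMap.fourierInv_coe, fourierInv_fourier_eq]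
    rw [SchwartzMap.fourier_coe, Real.fourier_eq, h1, Real.fourierInv_eq]
    simp only [Circle.smul_def]
    rw [← integral_smul, ← integral_sub_left_eq_self _ volume ζ]
    refine integral_congr_ae (Filter.Eventually.of_forall fun y => ?_)
    simp only [hθ, sub_sub_cancel]
    rw [smul_smul, ← Circle.coe_mul, ← AddChar.map_add_eq_mul]
    congr 3
    rw [inner_sub_left, real_inner_comm z ζ]
    ring
  have key := congrArg (fun v : 𝓢'(SpaceTime, ℂ) => v θ) (Lp.fourier_toTemperedDistribution_eq f)
  simp only [TemperedDistribution.fourier_apply, Lp.toTemperedDistribution_apply] at key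
  rw [← hF] at key
  have l1 : ∫ z, (Real.fourierChar (-inner ℝ z ζ) • f z) * (φ.toLp 2 : SpaceTime → ℂ) z =
      ∫ z, (𝓕 θ) z • f z := by
    refine integral_congr_ae ?_
    filter_upwards [φ.coeFn_toLp 2] with z hz
    rw [hz, hFθ, smul_mul_assoc, smul_assoc, smul_eq_mul, mul_comm]
  have l2 : ∫ y, F (ζ - y) * ((𝓕 φ).toLp 2 : SpaceTime → ℂ) y = ∫ y, θ y • F y := by
    have : ∫ y, F (ζ - y) * ((𝓕 φ).toLp 2 : SpaceTime → ℂ) y = ∫ y, F (ζ - y) * (𝓕 φ) y := by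
      refine integral_congr_ae ?_
      filter_upwards [(𝓕 φ).coeFn_toLp 2] with y hy
      rw [hy]
    rw [this, ← integral_sub_left_eq_self _ volume ζ]
    refine integral_congr_ae (Filter.Eventually.of_forall fun y => ?_)
    simp [hθ, mul_comm]
  rw [SchwartzMap.toLpCLM_apply, SchwartzMap.toLp_fourier_eq, l1, l2, key]

theorem eLpNorm_two_eq_nrm (f : SpaceTime → ℂ) : eLpNorm f 2 = nrm volume fun z => ‖f z‖ₑ := by
  rw [eLpNorm_eq_lintegral_rpow_enorm_toReal (by norm_num) (by norm_num), nrm]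
  simp

theorem isFunction_lp_two (f : Lp ℂ 2 (volume : Measure SpaceTime)) :
    IsFunction (f : 𝓢'(SpaceTime, ℂ)) f := by
  refine ⟨(Lp.memLp f).locallyIntegrable (by norm_num), fun φ => ⟨?_, by simp⟩⟩
  exact (φ.memLp 2).integrable_mul (Lp.memLp f)

/-- The tempered distribution of an integrable function. -/
def distOfIntegrable {k : SpaceTime → ℂ} (hk : Integrable k) : 𝓢'(SpaceTime, ℂ) :=
  Lp.toTemperedDistribution (memLp_one_iff_integrable.2 hk).toLp

theorem distOfIntegrable_apply {k : SpaceTime → ℂ} (hk : Integrable k) (φ : 𝓢(SpaceTime, ℂ)) :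
    distOfIntegrable hk φ = ∫ z, φ z * k z := by
  rw [distOfIntegrable, Lp.toTemperedDistribution_apply]
  refine integral_congr_ae ?_
  filter_upwards [(memLp_one_iff_integrable.2 hk).coeFn_toLp] with z hz
  rw [hz, smul_eq_mul]

theorem isFunction_distOfIntegrable {k : SpaceTime → ℂ} (hk : Integrable k) :
    IsFunction (distOfIntegrable hk) k := by
  refine ⟨hk.locallyIntegrable, fun φ => ⟨?_, distOfIntegrable_apply hk φ⟩⟩
  exact hk.bdd_mul φ.continuous.aestronglyMeasurable
    (Filter.Eventually.of_forall fun z => φ.norm_le_seminorm ℝ z)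

theorem integral_fourier_mul_eq {k : SpaceTime → ℂ} (hk : Integrable k) (φ : 𝓢(SpaceTime, ℂ)) :
    ∫ z, (𝓕 φ) z * k z = ∫ ζ, φ ζ * 𝓕 k ζ := by
  simpa using! VectorFourier.integral_bilin_fourierIntegral_eq_flip (ContinuousLinearMap.mul ℂ ℂ)
    (L := innerₗ SpaceTime) Real.continuous_fourierChar continuous_inner φ.integrable hk

theorem continuous_fourier_of_integrable {k : SpaceTime → ℂ} (hk : Integrable k) :
    Continuous (𝓕 k) :=
  VectorFourier.fourierIntegral_continuous Real.continuous_fourierChar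
    (L := innerₗ SpaceTime) continuous_inner hk

/-- An integrable function whose Fourier transform is square integrable is square integrable. -/
theorem exists_lp_of_fourier_memLp {k : SpaceTime → ℂ} (hk : Integrable k) (hK : MemLp (𝓕 k) 2) :
    ∃ H : Lp ℂ 2 (volume : Measure SpaceTime), H =ᵐ[volume] k ∧
      (𝓕 H : Lp ℂ 2 (volume : Measure SpaceTime)) =ᵐ[volume] 𝓕 k := by
  refine ⟨𝓕⁻ hK.toLp, ?_, ?_⟩
  · have h : ∀ φ : 𝓢(SpaceTime, ℂ), (Lp.toTemperedDistribution
        (𝓕⁻ hK.toLp : Lp ℂ 2 (volume : Measure SpaceTime)) : 𝓢'(SpaceTime, ℂ)) φ =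
        distOfIntegrable hk φ := fun φ => by
      rw [← Lp.fourierInv_toTemperedDistribution_eq, TemperedDistribution.fourierInv_apply,
        Lp.toTemperedDistribution_apply, distOfIntegrable_apply]
      calc ∫ ζ, (𝓕⁻ φ) ζ • (hK.toLp : SpaceTime → ℂ) ζ = ∫ ζ, (𝓕⁻ φ) ζ * 𝓕 k ζ := by
            refine integral_congr_ae ?_
            filter_upwards [hK.coeFn_toLp] with ζ hζ
            rw [hζ, smul_eq_mul]
        _ = ∫ z, φ z * k z := by
            rw [← integral_fourier_mul_eq hk, fourier_fourierInv_eq]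
    have e : (Lp.toTemperedDistribution (𝓕⁻ hK.toLp : Lp ℂ 2 (volume : Measure SpaceTime)) :
        𝓢'(SpaceTime, ℂ)) = distOfIntegrable hk := by
      ext φ; exact h φ
    have h1 := isFunction_lp_two (𝓕⁻ hK.toLp)
    rw [e] at h1
    exact h1.ae_eq (isFunction_distOfIntegrable hk)
  · rw [fourier_fourierInv_eq]
    exact hK.coeFn_toLp

/-- The absolute value of the Fourier transform of a square integrable function. -/
def absFourier (f : Lp ℂ 2 (volume : Measure SpaceTime)) (ζ : SpaceTime) : ℝ≥0∞ :=
  ‖(𝓕 f : Lp ℂ 2 (volume : Measure SpaceTime)) ζ‖ₑ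

theorem measurable_absFourier (f : Lp ℂ 2 (volume : Measure SpaceTime)) :
    Measurable (absFourier f) :=
  (Lp.stronglyMeasurable _).measurable.enorm

theorem integrable_mul_lp (f g : Lp ℂ 2 (volume : Measure SpaceTime)) :
    Integrable fun z => f z * g z :=
  (Lp.memLp f).integrable_mul (Lp.memLp g)

theorem enorm_fourier_mul_le (f g : Lp ℂ 2 (volume : Measure SpaceTime)) (ζ : SpaceTime) :
    ‖𝓕 (fun z => f z * g z) ζ‖ₑ ≤ cnv (absFourier f) (absFourier g) ζ := by
  rw [fourier_mul_eq_integral]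
  refine (enorm_integral_le_lintegral_enorm _).trans (le_of_eq ?_)
  simp only [enorm_mul]
  rfl

/-- The product is square integrable because the convolution of the Fourier transforms is. -/
theorem exists_lp_mul {f g : Lp ℂ 2 (volume : Measure SpaceTime)}
    (h : nrm volume (cnv (absFourier f) (absFourier g)) < ⊤) :
    ∃ H : Lp ℂ 2 (volume : Measure SpaceTime), (H =ᵐ[volume] fun z => f z * g z) ∧
      ∀ᵐ ζ, absFourier H ζ ≤ cnv (absFourier f) (absFourier g) ζ := by
  have hk := integrable_mul_lp f g
  have hK : MemLp (𝓕 fun z => f z * g z) 2 := by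
    refine ⟨(continuous_fourier_of_integrable hk).aestronglyMeasurable, ?_⟩
    rw [eLpNorm_two_eq_nrm]
    exact (nrm_mono fun ζ => enorm_fourier_mul_le f g ζ).trans_lt h
  obtain ⟨H, h1, h2⟩ := exists_lp_of_fourier_memLp hk hK
  refine ⟨H, h1, ?_⟩
  filter_upwards [h2] with ζ hζ
  rw [absFourier, hζ]
  exact enorm_fourier_mul_le f g ζ

/-- Since the product of two of the functions is square integrable, the convolution theorem for `L²`
functions applies to its product with the third. -/
theorem enorm_fourier_mul_mul_le {f g h : Lp ℂ 2 (volume : Measure SpaceTime)}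
    (hfg : nrm volume (cnv (absFourier f) (absFourier g)) < ⊤) :
    Integrable (fun z => f z * g z * h z) ∧ ∀ ζ, ‖𝓕 (fun z => f z * g z * h z) ζ‖ₑ ≤
      cnv (cnv (absFourier f) (absFourier g)) (absFourier h) ζ := by
  obtain ⟨H, h1, h2⟩ := exists_lp_mul hfg
  have e : (fun z => H z * h z) =ᵐ[volume] fun z => f z * g z * h z := by
    filter_upwards [h1] with z hz
    rw [hz]
  refine ⟨(integrable_mul_lp H h).congr e, fun ζ => ?_⟩
  rw [← Real.fourier_congr_ae e]
  refine (enorm_fourier_mul_le H h ζ).trans (lintegral_mono_ae ?_)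
  filter_upwards [h2] with y hy
  gcongr

/-! ### The dyadic partition of unity -/

theorem IsCutoff.eq_zero {ψ : ℝ → ℝ} (h : IsCutoff ψ) {r : ℝ} (hr : 2 ≤ |r|) : ψ r = 0 := by
  by_contra h0
  have := h.tsupport_subset (subset_tsupport ψ h0)
  exact absurd (abs_lt.2 ⟨this.1, this.2⟩) (not_lt.2 hr)

theorem IsCutoff.exists_dyadic_le {ψ : ℝ → ℝ} (h : IsCutoff ψ) :
    ∃ B : ℝ, ∀ n r, |dyadic ψ n r| ≤ B := by
  obtain ⟨B, hB⟩ := h.contDiff.continuous.bounded_above_of_compact_support h.hasCompactSupport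
  refine ⟨B + B, fun n r => ?_⟩
  have hB' : ∀ r, |ψ r| ≤ B := hB
  have h0 : 0 ≤ B := (abs_nonneg _).trans (hB' 0)
  cases n with
  | zero => exact (hB' r).trans (by linarith)
  | succ n => exact (abs_sub _ _).trans (add_le_add (hB' _) (hB' _))

theorem dyadic_succ (ψ : ℝ → ℝ) (n : ℕ) (r : ℝ) :
    dyadic ψ (n + 1) r = ψ (r / 2 ^ (n + 1)) - ψ (2 * r / 2 ^ (n + 1)) := rfl

/-- The partial sums telescope. -/
theorem sum_dyadic (ψ : ℝ → ℝ) (M : ℕ) (r : ℝ) :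
    ∑ n ∈ Finset.range (M + 1), dyadic ψ n r = ψ (r / 2 ^ M) := by
  induction M with
  | zero => simp [dyadic]
  | succ M ih =>
    rw [Finset.sum_range_succ, ih, dyadic_succ, pow_succ']
    have : 2 * r / (2 * 2 ^ M) = r / 2 ^ M := by field_simp
    rw [this]; ring

theorem IsCutoff.lt_of_dyadic_ne_zero {ψ : ℝ → ℝ} (h : IsCutoff ψ) {n : ℕ} {r : ℝ}
    (h0 : dyadic ψ n r ≠ 0) : |r| < 2 * 2 ^ n := by
  by_contra! hr
  refine h0 ?_
  cases n with
  | zero => exact h.eq_zero (by simpa using hr)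
  | succ n =>
    have hp : (0 : ℝ) < 2 ^ (n + 1) := by positivity
    have h1 : 2 ≤ |r / 2 ^ (n + 1)| := by
      rwa [abs_div, abs_of_pos hp, le_div_iff₀ hp]
    have h2 : 2 ≤ |2 * r / 2 ^ (n + 1)| := by
      rw [mul_div_assoc, abs_mul, abs_two]; linarith
    rw [dyadic_succ, h.eq_zero h1, h.eq_zero h2, sub_zero]

theorem IsCutoff.le_of_dyadic_ne_zero {ψ : ℝ → ℝ} (h : IsCutoff ψ) {n : ℕ} {r : ℝ}
    (h0 : dyadic ψ (n + 1) r ≠ 0) : 2 ^ n < |r| := by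
  by_contra! hr
  refine h0 ?_
  have hp : (0 : ℝ) < 2 ^ (n + 1) := by positivity
  have h2 : |2 * r / 2 ^ (n + 1)| ≤ 1 := by
    rw [abs_div, abs_of_pos hp, div_le_one hp, abs_mul, abs_two, pow_succ']; linarith
  have h1 : |r / 2 ^ (n + 1)| ≤ 1 := by
    rw [mul_div_assoc, abs_mul, abs_two] at h2; linarith [abs_nonneg (r / 2 ^ (n + 1))]
  rw [dyadic_succ, h.eq_one _ h1, h.eq_one _ h2, sub_self]

/-- At every point at most two consecutive members of the dyadic partition are nonzero, and these
add up to `1`. -/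
theorem IsCutoff.exists_dyadic_pair {ψ : ℝ → ℝ} (h : IsCutoff ψ) (r : ℝ) :
    ∃ k, (∀ n, n ≠ k → n ≠ k + 1 → dyadic ψ n r = 0) ∧
      dyadic ψ k r + dyadic ψ (k + 1) r = 1 := by
  obtain ⟨k, hk⟩ : ∃ k : ℕ, |r| ≤ 2 ^ (k + 1) ∧ (k = 0 ∨ 2 ^ k < |r|) := by
    have hex : ∃ k : ℕ, |r| ≤ 2 ^ (k + 1) := by
      obtain ⟨k, hk⟩ := pow_unbounded_of_one_lt |r| (one_lt_two (α := ℝ))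
      exact ⟨k, hk.le.trans (pow_le_pow_right₀ one_le_two k.le_succ)⟩
    refine ⟨Nat.find hex, Nat.find_spec hex, ?_⟩
    rcases Nat.eq_zero_or_eq_succ_pred (Nat.find hex) with h0 | h0
    · exact Or.inl h0
    · right
      have := Nat.find_min hex (m := (Nat.find hex).pred) (by omega)
      rw [← Nat.succ_eq_add_one, ← h0] at this
      exact not_le.1 this
  have hz : ∀ n, n ≠ k → n ≠ k + 1 → dyadic ψ n r = 0 := by
    intro n h1 h2
    by_contra h0
    rcases lt_or_gt_of_ne h1 with hlt | hgt
    · have a := h.lt_of_dyadic_ne_zero h0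
      have b := hk.2.resolve_left (by omega)
      have c : (2 : ℝ) ^ (n + 1) ≤ 2 ^ k := pow_le_pow_right₀ one_le_two hlt
      rw [pow_succ'] at c
      linarith
    · obtain ⟨m, rfl⟩ : ∃ m, n = m + 1 := ⟨n - 1, by omega⟩
      have a := h.le_of_dyadic_ne_zero h0
      have c : (2 : ℝ) ^ (k + 1) ≤ 2 ^ m := pow_le_pow_right₀ one_le_two (by omega)
      linarith [hk.1]
  refine ⟨k, hz, ?_⟩
  have hs := sum_dyadic ψ (k + 1) r
  have hp : (0 : ℝ) < 2 ^ (k + 1) := by positivity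
  rw [h.eq_one (r / 2 ^ (k + 1)) (by rw [abs_div, abs_of_pos hp, div_le_one hp]; exact hk.1),
    Finset.sum_range_succ, Finset.sum_range_succ, Finset.sum_eq_zero, zero_add] at hs
  · exact hs
  · intro n hn
    rw [Finset.mem_range] at hn
    exact hz n (by omega) (by omega)

theorem rpow_le_of_comparable {x y A p : ℝ} (hx : 0 < x) (hy : 0 < y) (hA : 1 ≤ A)
    (h1 : x ≤ A * y) (h2 : y ≤ A * x) : x ^ p ≤ A ^ |p| * y ^ p := by
  have hA0 : 0 < A := by linarith
  rcases le_total 0 p with hp | hp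
  · rw [abs_of_nonneg hp, ← Real.mul_rpow hA0.le hy.le]
    exact Real.rpow_le_rpow hx.le h1 hp
  · have h3 : x ^ p ≤ (A⁻¹ * y) ^ p := by
      refine Real.rpow_le_rpow_of_nonpos (by positivity) ?_ hp
      rw [inv_mul_le_iff₀ hA0]; exact h2
    rw [abs_of_nonpos hp, Real.rpow_neg hA0.le, ← Real.inv_rpow hA0.le,
      ← Real.mul_rpow (by positivity) hy.le]
    exact h3

/-- The square function of the dyadic partition with the weights `N ^ (2 σ)`. -/
def dyadicSum (ψ : ℝ → ℝ) (σ r : ℝ) : ℝ≥0∞ :=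
  ∑' n : ℕ, ((2 : ℝ≥0∞) ^ n) ^ (2 * σ) * ‖(dyadic ψ n r : ℂ)‖ₑ ^ 2

theorem two_pow_rpow (n : ℕ) (p : ℝ) :
    ((2 : ℝ≥0∞) ^ n) ^ p = ENNReal.ofReal (((2 : ℝ) ^ n) ^ p) := by
  rw [← ENNReal.ofReal_rpow_of_pos (by positivity), ENNReal.ofReal_pow (by norm_num),
    ENNReal.ofReal_ofNat]

theorem enorm_ofReal_sq (x : ℝ) : ‖(x : ℂ)‖ₑ ^ 2 = ENNReal.ofReal (x ^ 2) := by
  rw [← ofReal_norm, ← ENNReal.ofReal_pow (norm_nonneg _), Complex.norm_real,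
    Real.norm_eq_abs, sq_abs]

/-- The square function has the size of `x ^ (2 σ)` for any `x` comparable to `1 + |r|`; the comparison
covers `x = 1 + |r|` as well as `x = max (1, |ξ|, |η|)` with `r = |(ξ, η)|`. -/
theorem IsCutoff.exists_dyadicSum {ψ : ℝ → ℝ} (h : IsCutoff ψ) (σ : ℝ) :
    ∃ C : ℝ≥0, ∀ r x : ℝ, 1 ≤ x → x ≤ 2 * (1 + |r|) → 1 + |r| ≤ 3 * x →
      ENNReal.ofReal (x ^ (2 * σ)) ≤ C * dyadicSum ψ σ r ∧
        dyadicSum ψ σ r ≤ C * ENNReal.ofReal (x ^ (2 * σ)) := by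
  obtain ⟨B, hB⟩ := h.exists_dyadic_le
  set A : ℝ := 6 ^ |2 * σ| with hA
  have hA0 : 0 < A := by positivity
  refine ⟨(4 * A + 2 * (A * B ^ 2)).toNNReal, fun r x hx hx1 hx2 => ?_⟩
  change _ ≤ ENNReal.ofReal _ * _ ∧ _ ≤ ENNReal.ofReal _ * _
  have hx0 : 0 < x := by linarith
  have hxp : 0 < x ^ (2 * σ) := by positivity
  -- On the support of `ψ_N` the numbers `N` and `1 + |r|` are comparable.
  have comp : ∀ n, dyadic ψ n r ≠ 0 → x ≤ 6 * 2 ^ n ∧ (2 : ℝ) ^ n ≤ 6 * x := fun n hn => by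
    have a := h.lt_of_dyadic_ne_zero hn
    have c : (1 : ℝ) ≤ 2 ^ n := one_le_pow₀ one_le_two
    refine ⟨by linarith, ?_⟩
    cases n with
    | zero => simp; linarith
    | succ n =>
      have b := h.le_of_dyadic_ne_zero hn
      rw [pow_succ']; linarith
  obtain ⟨k, hz, hsum⟩ := h.exists_dyadic_pair r
  constructor
  · obtain ⟨n, hn⟩ : ∃ n, 1 / 2 ≤ |dyadic ψ n r| := by
      by_contra! hc
      have a := hc k
      have b := hc (k + 1)
      rw [abs_lt] at a b
      linarith
    have hne : dyadic ψ n r ≠ 0 := fun h0 => by rw [h0, abs_zero] at hn; norm_num at hn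
    obtain ⟨c1, c2⟩ := comp n hne
    have hle := rpow_le_of_comparable (p := 2 * σ) hx0 (by positivity) (by norm_num) c1 c2
    rw [← hA] at hle
    calc ENNReal.ofReal (x ^ (2 * σ))
        ≤ ENNReal.ofReal ((4 * A + 2 * (A * B ^ 2)) *
            (((2 : ℝ) ^ n) ^ (2 * σ) * dyadic ψ n r ^ 2)) := by
          refine ENNReal.ofReal_le_ofReal (hle.trans ?_)
          have hsq : 1 / 4 ≤ dyadic ψ n r ^ 2 := by
            rw [← sq_abs]; nlinarith
          have hp : 0 < ((2 : ℝ) ^ n) ^ (2 * σ) := by positivity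
          have hB2 : 0 ≤ 2 * (A * B ^ 2) := by positivity
          calc A * ((2 : ℝ) ^ n) ^ (2 * σ) = (4 * A) * (((2 : ℝ) ^ n) ^ (2 * σ) * (1 / 4)) := by
                ring
            _ ≤ _ := by gcongr; linarith
      _ ≤ _ := by
          rw [ENNReal.ofReal_mul (by positivity), ENNReal.ofReal_mul (by positivity),
            ← enorm_ofReal_sq, ← two_pow_rpow]
          exact mul_le_mul_right (ENNReal.le_tsum n) _
  · have term : ∀ n, ((2 : ℝ≥0∞) ^ n) ^ (2 * σ) * ‖(dyadic ψ n r : ℂ)‖ₑ ^ 2 ≤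
        ENNReal.ofReal (A * x ^ (2 * σ) * B ^ 2) := fun n => by
      rw [enorm_ofReal_sq, two_pow_rpow, ← ENNReal.ofReal_mul (by positivity)]
      refine ENNReal.ofReal_le_ofReal ?_
      rcases eq_or_ne (dyadic ψ n r) 0 with h0 | h0
      · rw [h0]; simp only [ne_eq, OfNat.ofNat_ne_zero, not_false_eq_true, zero_pow, mul_zero]
        positivity
      · obtain ⟨c1, c2⟩ := comp n h0
        have hle := rpow_le_of_comparable (p := 2 * σ) (by positivity) hx0 (by norm_num) c2 c1
        have hsq : dyadic ψ n r ^ 2 ≤ B ^ 2 := by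
          rw [← sq_abs]; exact pow_le_pow_left₀ (abs_nonneg _) (hB n r) 2
        exact mul_le_mul hle hsq (by positivity) (by positivity)
    rw [dyadicSum, tsum_eq_sum (s := {k, k + 1}) fun n hn => by
      simp only [Finset.mem_insert, Finset.mem_singleton, not_or] at hn
      rw [hz n hn.1 hn.2]; simp]
    rw [Finset.sum_pair (by omega), ← ENNReal.ofReal_mul (by positivity)]
    refine (add_le_add (term _) (term _)).trans ?_
    rw [← ENNReal.ofReal_add (by positivity) (by positivity)]
    refine ENNReal.ofReal_le_ofReal ?_
    have : 0 < 4 * A * x ^ (2 * σ) := by positivity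
    nlinarith

/-- The symbol of `P_N Q_L`. -/
def projSymbol (ψ : ℝ → ℝ) (p : ℕ × ℕ) (ζ : SpaceTime) : ℂ :=
  freqSymbol ψ p.1 ζ * modSymbol ψ p.2 ζ

/-- The weight `N ^ (2 s) L ^ (2 b)` of `P_N Q_L` in the `X^{s,b}` norm. -/
def dyadicWeight (s b : ℝ) (p : ℕ × ℕ) : ℝ≥0∞ :=
  ((2 : ℝ≥0∞) ^ p.1) ^ (2 * s) * ((2 : ℝ≥0∞) ^ p.2) ^ (2 * b)

theorem tsum_dyadicWeight_mul (ψ : ℝ → ℝ) (s b : ℝ) (ζ : SpaceTime) :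
    ∑' p, dyadicWeight s b p * ‖projSymbol ψ p ζ‖ₑ ^ 2 =
      dyadicSum ψ s (Real.sqrt (freqX ζ ^ 2 + freqY ζ ^ 2)) * dyadicSum ψ b (modulation ζ) := by
  rw [ENNReal.tsum_prod', dyadicSum, ← ENNReal.tsum_mul_right]
  refine tsum_congr fun n => ?_
  rw [dyadicSum, ← ENNReal.tsum_mul_left]
  refine tsum_congr fun l => ?_
  rw [dyadicWeight, projSymbol, enorm_mul, mul_pow, freqSymbol, modSymbol, modulation, freqX, freqY]
  ring

theorem wt_sq (s b : ℝ) (z : SpaceTime) : wt s b z ^ 2 =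
    ENNReal.ofReal (freqSize (freqX z) (freqY z) ^ (2 * s)) *
      ENNReal.ofReal ((1 + |modulation z|) ^ (2 * b)) := by
  have h := freqSize_pos (freqX z) (freqY z)
  rw [sq, wt_mul_wt, wt, ENNReal.ofReal_mul (by positivity)]
  congr 3 <;> ring

/-- The square function of the projections `P_N Q_L` is comparable with the weight of
`X^{s,b}`. -/
theorem IsCutoff.exists_wt_comparable {ψ : ℝ → ℝ} (h : IsCutoff ψ) (s b : ℝ) :
    ∃ C : ℝ≥0, ∀ ζ, wt s b ζ ^ 2 ≤ C * ∑' p, dyadicWeight s b p * ‖projSymbol ψ p ζ‖ₑ ^ 2 ∧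
      ∑' p, dyadicWeight s b p * ‖projSymbol ψ p ζ‖ₑ ^ 2 ≤ C * wt s b ζ ^ 2 := by
  obtain ⟨C₁, h₁⟩ := h.exists_dyadicSum s
  obtain ⟨C₂, h₂⟩ := h.exists_dyadicSum b
  refine ⟨C₁ * C₂, fun ζ => ?_⟩
  set r := Real.sqrt (freqX ζ ^ 2 + freqY ζ ^ 2) with hr
  have hr0 : 0 ≤ r := Real.sqrt_nonneg _
  have hrs : r ^ 2 = freqX ζ ^ 2 + freqY ζ ^ 2 := Real.sq_sqrt (by positivity)
  have f1 := one_le_freqSize (freqX ζ) (freqY ζ)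
  have f2 := abs_left_le_freqSize (freqX ζ) (freqY ζ)
  have f3 := abs_right_le_freqSize (freqX ζ) (freqY ζ)
  have hx : |freqX ζ| ≤ r := abs_le_of_sq_le_sq (by nlinarith [sq_nonneg (freqY ζ)]) hr0
  have hy : |freqY ζ| ≤ r := abs_le_of_sq_le_sq (by nlinarith [sq_nonneg (freqX ζ)]) hr0
  have hup : r ≤ |freqX ζ| + |freqY ζ| := by
    refine abs_le_of_sq_le_sq' ?_ (by positivity) |>.2
    nlinarith [sq_abs (freqX ζ), sq_abs (freqY ζ), abs_nonneg (freqX ζ), abs_nonneg (freqY ζ)]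
  have a := h₁ r (freqSize (freqX ζ) (freqY ζ)) f1
    (max_le (by linarith [abs_nonneg r]) (max_le (by rw [abs_of_nonneg hr0]; linarith)
      (by rw [abs_of_nonneg hr0]; linarith))) (by rw [abs_of_nonneg hr0]; linarith)
  have hm := abs_nonneg (modulation ζ)
  have c := h₂ (modulation ζ) (1 + |modulation ζ|) (by linarith) (by linarith) (by linarith)
  rw [tsum_dyadicWeight_mul, wt_sq, ← hr, ENNReal.coe_mul]
  constructor
  · refine (mul_le_mul' a.1 c.1).trans (le_of_eq (by ring))
  · refine (mul_le_mul' a.2 c.2).trans (le_of_eq (by ring))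

/-! ### Square integrable representatives -/

theorem toTemperedDistribution_injective {f g : Lp ℂ 2 (volume : Measure SpaceTime)}
    (h : (f : 𝓢'(SpaceTime, ℂ)) = g) : f = g :=
  LinearMap.ker_eq_bot.1 Lp.ker_toTemperedDistributionCLM_eq_bot h

theorem l2Norm_coe (g : Lp ℂ 2 (volume : Measure SpaceTime)) :
    l2Norm (g : 𝓢'(SpaceTime, ℂ)) = ‖g‖ₑ := by
  refine le_antisymm (iInf₂_le (f := fun (g' : Lp ℂ 2 (volume : Measure SpaceTime))
    (_ : (g' : 𝓢'(SpaceTime, ℂ)) = g) => ‖g'‖ₑ) g rfl) (le_iInf₂ fun g' h => ?_)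
  rw [toTemperedDistribution_injective h]

theorem exists_lp_of_l2Norm_lt_top {v : 𝓢'(SpaceTime, ℂ)} (h : l2Norm v < ⊤) :
    ∃ g : Lp ℂ 2 (volume : Measure SpaceTime), (g : 𝓢'(SpaceTime, ℂ)) = v := by
  by_contra! hc
  refine h.ne ?_
  simp only [l2Norm, iInf_eq_top]
  exact fun g hg => absurd hg (hc g)

/-- Multiplication of a locally integrable function by a smooth function of temperate growth. -/
theorem IsFunction.smulLeft {v : 𝓢'(SpaceTime, ℂ)} {f g : SpaceTime → ℂ} (hf : IsFunction v f)
    (hg : g.HasTemperateGrowth) : IsFunction (smulLeftCLM ℂ g v) fun z => g z * f z := by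
  refine ⟨?_, fun φ => ?_⟩
  · exact hf.1.continuous_smul hg.1.continuous
  · have h := hf.2 (SchwartzMap.smulLeftCLM ℂ g φ)
    have e : (fun z => (SchwartzMap.smulLeftCLM ℂ g φ) z * f z) = fun z => φ z * (g z * f z) := by
      funext z
      rw [SchwartzMap.smulLeftCLM_apply_apply hg, smul_eq_mul]; ring
    rw [e] at h
    exact h

theorem fourier_projP (ψ : ℝ → ℝ) (n : ℕ) (u : 𝓢'(SpaceTime, ℂ)) :
    𝓕 (projP ψ n u) = smulLeftCLM ℂ (freqSymbol ψ n) (𝓕 u) := by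
  rw [projP, fourierMultiplierCLM_apply, fourier_fourierInv_eq]

theorem fourier_projQ (ψ : ℝ → ℝ) (l : ℕ) (u : 𝓢'(SpaceTime, ℂ)) :
    𝓕 (projQ ψ l u) = smulLeftCLM ℂ (modSymbol ψ l) (𝓕 u) := by
  rw [projQ, fourierMultiplierCLM_apply, fourier_fourierInv_eq]

theorem IsCutoff.temperate_projSymbol {ψ : ℝ → ℝ} (h : IsCutoff ψ) (p : ℕ × ℕ) :
    (projSymbol ψ p).HasTemperateGrowth :=
  (h.temperate_freqSymbol p.1).mul (h.temperate_modSymbol p.2)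

theorem IsCutoff.fourier_proj {ψ : ℝ → ℝ} (h : IsCutoff ψ) (p : ℕ × ℕ) (u : 𝓢'(SpaceTime, ℂ)) :
    𝓕 (projP ψ p.1 (projQ ψ p.2 u)) = smulLeftCLM ℂ (projSymbol ψ p) (𝓕 u) := by
  rw [fourier_projP, fourier_projQ, smulLeftCLM_smulLeftCLM_apply (h.temperate_modSymbol p.2)
    (h.temperate_freqSymbol p.1), mul_comm]
  rfl

theorem xNorm_sq (ψ : ℝ → ℝ) (s b : ℝ) (u : 𝓢'(SpaceTime, ℂ)) : xNorm ψ s b u ^ 2 =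
    ∑' p : ℕ × ℕ, dyadicWeight s b p * l2Norm (projP ψ p.1 (projQ ψ p.2 u)) ^ 2 := by
  rw [xNorm, rpow_half_sq, ENNReal.tsum_prod']
  rfl

theorem two_pow_rpow_ne_zero (n : ℕ) (p : ℝ) : ((2 : ℝ≥0∞) ^ n) ^ p ≠ 0 := by
  rw [two_pow_rpow]
  exact (ENNReal.ofReal_pos.2 (by positivity)).ne'

theorem two_pow_rpow_ne_top (n : ℕ) (p : ℝ) : ((2 : ℝ≥0∞) ^ n) ^ p ≠ ⊤ := by
  rw [two_pow_rpow]
  exact ENNReal.ofReal_ne_top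

theorem dyadicWeight_ne_zero (s b : ℝ) (p : ℕ × ℕ) : dyadicWeight s b p ≠ 0 :=
  mul_ne_zero (two_pow_rpow_ne_zero _ _) (two_pow_rpow_ne_zero _ _)

theorem dyadicWeight_ne_top (s b : ℝ) (p : ℕ × ℕ) : dyadicWeight s b p ≠ ⊤ :=
  ENNReal.mul_ne_top (two_pow_rpow_ne_top _ _) (two_pow_rpow_ne_top _ _)

theorem tsum_two_pow_rpow_inv {p : ℝ} (hp : 0 < p) :
    ∑' n : ℕ, (((2 : ℝ≥0∞) ^ n) ^ p)⁻¹ ≠ ⊤ := by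
  have : ∀ n : ℕ, (((2 : ℝ≥0∞) ^ n) ^ p)⁻¹ = (((2 : ℝ≥0∞) ^ p)⁻¹) ^ n := fun n => by
    rw [← ENNReal.rpow_natCast, ← ENNReal.rpow_mul, mul_comm (n : ℝ) p, ENNReal.rpow_mul,
      ENNReal.rpow_natCast, ENNReal.inv_pow]
  simp only [this, ENNReal.tsum_geometric]
  rw [ENNReal.inv_ne_top]
  refine (tsub_pos_of_lt ?_).ne'
  exact ENNReal.inv_lt_one.2 (ENNReal.one_lt_rpow ENNReal.one_lt_two hp)

theorem tsum_dyadicWeight_inv {s b : ℝ} (hs : 0 < s) (hb : 0 < b) :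
    ∑' p, (dyadicWeight s b p)⁻¹ ≠ ⊤ := by
  have : ∀ n l : ℕ, (dyadicWeight s b (n, l))⁻¹ =
      (((2 : ℝ≥0∞) ^ n) ^ (2 * s))⁻¹ * (((2 : ℝ≥0∞) ^ l) ^ (2 * b))⁻¹ := fun n l =>
    ENNReal.mul_inv (Or.inl (two_pow_rpow_ne_zero _ _)) (Or.inl (two_pow_rpow_ne_top _ _))
  rw [ENNReal.tsum_prod']
  simp only [this, ENNReal.tsum_mul_left, ENNReal.tsum_mul_right]
  exact ENNReal.mul_ne_top (tsum_two_pow_rpow_inv (by linarith))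
    (tsum_two_pow_rpow_inv (by linarith))

/-- Linear terms are bounded by a weight and the weighted square; this turns square summability with
growing weights into absolute summability. -/
theorem le_inv_add_mul_sq {c : ℝ≥0∞} (hc : c ≠ 0) (hc' : c ≠ ⊤) (x : ℝ≥0∞) :
    x ≤ c⁻¹ + c * x ^ 2 := by
  rcases le_total x c⁻¹ with h | h
  · exact h.trans le_self_add
  · refine le_trans ?_ le_add_self
    calc x = c * c⁻¹ * x := by rw [ENNReal.mul_inv_cancel hc hc', one_mul]
      _ ≤ c * x * x := by gcongr
      _ = _ := by ring

/-- On a compact set, finitely many of the symbols of `P_N Q_L` add up to `1`, and the others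
vanish. -/
theorem IsCutoff.exists_finset_projSymbol {ψ : ℝ → ℝ} (h : IsCutoff ψ) {K : Set SpaceTime}
    (hK : IsCompact K) : ∃ s : Finset (ℕ × ℕ), (∀ ζ ∈ K, ∑ p ∈ s, projSymbol ψ p ζ = 1) ∧
      ∀ ζ ∈ K, ∀ p ∉ s, projSymbol ψ p ζ = 0 := by
  have c1 : Continuous fun ζ : SpaceTime =>
      |Real.sqrt ((2 * Real.pi * ζ 1) ^ 2 + (2 * Real.pi * ζ 2) ^ 2)| := by fun_prop
  have c2 : Continuous fun ζ : SpaceTime =>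
      |2 * Real.pi * ζ 0 - (2 * Real.pi * ζ 1) ^ 3 - (2 * Real.pi * ζ 2) ^ 3| := by fun_prop
  obtain ⟨a, ha⟩ := hK.bddAbove_image c1.continuousOn
  obtain ⟨b, hb⟩ := hK.bddAbove_image c2.continuousOn
  obtain ⟨M, hM⟩ := pow_unbounded_of_one_lt (max a b) (one_lt_two (α := ℝ))
  have hp : (0 : ℝ) < 2 ^ M := by positivity
  have key : ∀ r : ℝ, |r| ≤ 2 ^ M → ∑ n ∈ Finset.range (M + 1), dyadic ψ n r = 1 ∧
      ∀ n ∉ Finset.range (M + 1), dyadic ψ n r = 0 := fun r hr => by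
    constructor
    · rw [sum_dyadic, h.eq_one]
      rw [abs_div, abs_of_pos hp, div_le_one hp]
      exact hr
    · intro n hn
      by_contra h0
      rw [Finset.mem_range, not_lt] at hn
      obtain ⟨m, rfl⟩ : ∃ m, n = m + 1 := ⟨n - 1, by omega⟩
      have l := h.le_of_dyadic_ne_zero h0
      have : (2 : ℝ) ^ M ≤ 2 ^ m := pow_le_pow_right₀ one_le_two (by omega)
      linarith
  have k1 : ∀ ζ ∈ K, _ := fun ζ hζ => key (Real.sqrt ((2 * Real.pi * ζ 1) ^ 2 +
    (2 * Real.pi * ζ 2) ^ 2))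
    ((ha ⟨ζ, hζ, rfl⟩).trans ((le_max_left a b).trans hM.le))
  have k2 : ∀ ζ ∈ K, _ := fun ζ hζ => key (2 * Real.pi * ζ 0 - (2 * Real.pi * ζ 1) ^ 3 -
    (2 * Real.pi * ζ 2) ^ 3) ((hb ⟨ζ, hζ, rfl⟩).trans ((le_max_right a b).trans hM.le))
  refine ⟨Finset.range (M + 1) ×ˢ Finset.range (M + 1), fun ζ hζ => ?_, fun ζ hζ p hp => ?_⟩
  · simp only [projSymbol, freqSymbol, modSymbol]
    rw [Finset.sum_product]
    dsimp only
    rw [← Finset.sum_mul_sum, ← Complex.ofReal_sum, ← Complex.ofReal_sum, (k1 ζ hζ).1, (k2 ζ hζ).1]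
    simp
  · rw [Finset.mem_product, not_and_or] at hp
    simp only [projSymbol, freqSymbol, modSymbol]
    rcases hp with hp | hp
    · rw [(k1 ζ hζ).2 _ hp]; simp
    · rw [(k2 ζ hζ).2 _ hp]; simp

theorem l2Norm_proj_lt_top {ψ : ℝ → ℝ} {s b : ℝ} {u : 𝓢'(SpaceTime, ℂ)} (hu : u ∈ xSpace ψ s b)
    (p : ℕ × ℕ) : l2Norm (projP ψ p.1 (projQ ψ p.2 u)) < ⊤ := by
  have h1 : xNorm ψ s b u ^ 2 < ⊤ := ENNReal.pow_lt_top hu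
  rw [xNorm_sq] at h1
  have h2 := (ENNReal.le_tsum p).trans_lt h1
  by_contra hc
  rw [not_lt_top_iff] at hc
  rw [hc, ENNReal.top_pow two_ne_zero, ENNReal.mul_top (dyadicWeight_ne_zero s b p)] at h2
  exact lt_irrefl _ h2

/-- For positive exponents, the elements of `X^{s,b}` are square integrable functions: the projections
`P_N Q_L u` are absolutely summable in `L²`. -/
theorem IsCutoff.exists_lp_of_mem_xSpace {ψ : ℝ → ℝ} (h : IsCutoff ψ) {s b : ℝ} (hs : 0 < s)
    (hb : 0 < b) {u : 𝓢'(SpaceTime, ℂ)} (hu : u ∈ xSpace ψ s b) :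
    ∃ f : Lp ℂ 2 (volume : Measure SpaceTime), (f : 𝓢'(SpaceTime, ℂ)) = u := by
  choose g hg using fun p => exists_lp_of_l2Norm_lt_top (l2Norm_proj_lt_top hu p)
  set G : ℕ × ℕ → Lp ℂ 2 (volume : Measure SpaceTime) := fun p => 𝓕 (g p) with hGdef
  have hG : ∀ p, (G p : 𝓢'(SpaceTime, ℂ)) = smulLeftCLM ℂ (projSymbol ψ p) (𝓕 u) := fun p => by
    rw [hGdef, ← Lp.fourier_toTemperedDistribution_eq, hg, h.fourier_proj]
  have hsum : Summable G := by
    refine Summable.of_enorm (ne_top_of_le_ne_top ?_ (ENNReal.tsum_le_tsum fun p =>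
      le_inv_add_mul_sq (dyadicWeight_ne_zero s b p) (dyadicWeight_ne_top s b p) ‖G p‖ₑ))
    rw [ENNReal.tsum_add]
    refine ENNReal.add_ne_top.2 ⟨tsum_dyadicWeight_inv hs hb, ?_⟩
    have e : ∀ p, ‖G p‖ₑ = l2Norm (projP ψ p.1 (projQ ψ p.2 u)) := fun p => by
      rw [← hg, l2Norm_coe, ← ofReal_norm, ← ofReal_norm, hGdef, Lp.norm_fourier_eq]
    simp only [e]
    rw [← xNorm_sq]
    exact (ENNReal.pow_lt_top hu).ne
  -- On a compactly supported test function, all but finitely many terms of the series vanish.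
  have hF : ((∑' p, G p : Lp ℂ 2 (volume : Measure SpaceTime)) : 𝓢'(SpaceTime, ℂ)) = 𝓕 u := by
    refine temperedDistribution_ext fun φ hφ => ?_
    let ev : Lp ℂ 2 (volume : Measure SpaceTime) →+ ℂ :=
      AddMonoidHom.mk' (fun g => Lp.toTemperedDistributionCLM ℂ volume 2 g φ)
        fun a b => by simp only [map_add]; rfl
    have hev : Continuous ev := by
      have := continuous_integral_mul (φ.memLp 2)
      simpa [ev] using this
    have h1 := hsum.hasSum.map ev hev
    obtain ⟨t, ht1, ht2⟩ := h.exists_finset_projSymbol hφ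
    have hterm : ∀ p, (ev ∘ G) p = 𝓕 u (SchwartzMap.smulLeftCLM ℂ (projSymbol ψ p) φ) := fun p => by
      change (G p : 𝓢'(SpaceTime, ℂ)) φ = _
      rw [hG]; rfl
    have h2 : HasSum (ev ∘ G) (∑ p ∈ t, (ev ∘ G) p) := by
      refine hasSum_sum_of_ne_finset_zero fun p hp => ?_
      rw [hterm]
      have : SchwartzMap.smulLeftCLM ℂ (projSymbol ψ p) φ = 0 := by
        ext ζ
        rw [SchwartzMap.smulLeftCLM_apply_apply (h.temperate_projSymbol p)]
        by_cases hζ : ζ ∈ tsupport φ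
        · rw [ht2 ζ hζ p hp, zero_smul]; rfl
        · rw [image_eq_zero_of_notMem_tsupport hζ, smul_zero]; rfl
      rw [this, map_zero]
    have h3 := h1.unique h2
    change ev (∑' p, G p) = _
    rw [h3]
    simp only [hterm]
    rw [← map_sum]
    congr 1
    ext ζ
    rw [_root_.sum_apply]
    simp only [SchwartzMap.smulLeftCLM_apply_apply (h.temperate_projSymbol _)]
    rw [← Finset.sum_smul]
    by_cases hζ : ζ ∈ tsupport φ
    · rw [ht1 ζ hζ, one_smul]
    · rw [image_eq_zero_of_notMem_tsupport hζ, smul_zero]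
  refine ⟨𝓕⁻ (∑' p, G p), ?_⟩
  rw [← Lp.fourierInv_toTemperedDistribution_eq, hF, fourierInv_fourier_eq]

/-! ### The `X^{s,b}` norm on the Fourier side -/

/-- Plancherel's theorem for a distribution whose Fourier transform is a function. -/
theorem l2Norm_eq_nrm {v : 𝓢'(SpaceTime, ℂ)} {G : SpaceTime → ℂ} (hG : IsFunction (𝓕 v) G) :
    l2Norm v = nrm volume fun ζ => ‖G ζ‖ₑ := by
  refine le_antisymm ?_ (le_iInf₂ fun g hg => ?_)
  · by_cases ht : nrm volume (fun ζ => ‖G ζ‖ₑ) = ⊤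
    · rw [ht]; exact le_top
    · have hm : MemLp G 2 := by
        refine ⟨hG.1.aestronglyMeasurable, ?_⟩
        rw [eLpNorm_two_eq_nrm]
        exact lt_top_iff_ne_top.2 ht
      have e : (hm.toLp : 𝓢'(SpaceTime, ℂ)) = 𝓕 v := by
        ext φ
        rw [Lp.toTemperedDistribution_apply, (hG.2 φ).2]
        refine integral_congr_ae ?_
        filter_upwards [hm.coeFn_toLp] with ζ hζ
        rw [hζ, smul_eq_mul]
      have e' : ((𝓕⁻ hm.toLp : Lp ℂ 2 (volume : Measure SpaceTime)) : 𝓢'(SpaceTime, ℂ)) = v := by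
        rw [← Lp.fourierInv_toTemperedDistribution_eq, e, fourierInv_fourier_eq]
      rw [← e', l2Norm_coe, ← ofReal_norm, ← Lp.norm_fourier_eq, fourier_fourierInv_eq, ofReal_norm,
        Lp.enorm_def, eLpNorm_congr_ae hm.coeFn_toLp, eLpNorm_two_eq_nrm]
  · have h1 := isFunction_lp_two (𝓕 g)
    rw [← Lp.fourier_toTemperedDistribution_eq, hg] at h1
    rw [← ofReal_norm, ← Lp.norm_fourier_eq, ofReal_norm, Lp.enorm_def,
      eLpNorm_congr_ae (h1.ae_eq hG), eLpNorm_two_eq_nrm]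

/-- Plancherel's theorem for each of the projections, summed under the integral. -/
theorem IsCutoff.xNorm_sq_eq_lintegral {ψ : ℝ → ℝ} (h : IsCutoff ψ) (s b : ℝ)
    {v : 𝓢'(SpaceTime, ℂ)} {G : SpaceTime → ℂ} (hG : IsFunction (𝓕 v) G) : xNorm ψ s b v ^ 2 =
      ∫⁻ ζ, (∑' p, dyadicWeight s b p * ‖projSymbol ψ p ζ‖ₑ ^ 2) * ‖G ζ‖ₑ ^ 2 := by
  have hm : AEMeasurable (fun ζ => ‖G ζ‖ₑ) := hG.1.aestronglyMeasurable.enorm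
  have hs : ∀ p, Measurable fun ζ => ‖projSymbol ψ p ζ‖ₑ := fun p =>
    (h.temperate_projSymbol p).1.continuous.measurable.enorm
  rw [xNorm_sq]
  simp only [← ENNReal.tsum_mul_right]
  rw [lintegral_tsum fun p => by
    exact ((((hs p).pow_const 2).const_mul _).aemeasurable.mul (hm.pow_const 2))]
  refine tsum_congr fun p => ?_
  have hp : IsFunction (𝓕 (projP ψ p.1 (projQ ψ p.2 v))) fun ζ => projSymbol ψ p ζ * G ζ := by
    rw [h.fourier_proj]
    exact hG.smulLeft (h.temperate_projSymbol p)
  rw [l2Norm_eq_nrm hp, nrm_sq, ← lintegral_const_mul' _ _ (dyadicWeight_ne_top s b p)]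
  refine lintegral_congr fun ζ => ?_
  rw [enorm_mul]; ring

theorem le_of_sq_le_mul_sq {x y : ℝ≥0∞} {C : ℝ≥0} (h : x ^ 2 ≤ C * y ^ 2) :
    x ≤ ((C + 1 : ℝ≥0) : ℝ≥0∞) * y := by
  rw [← ENNReal.pow_le_pow_left_iff two_ne_zero]
  refine h.trans ?_
  rw [mul_pow]
  refine mul_le_mul_left ?_ _
  have : C ≤ (C + 1) ^ 2 := by nlinarith [C.2, sq_nonneg C]
  exact_mod_cast this

/-- The `X^{s,b}` norm as a weighted `L²` norm of the Fourier transform. -/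
theorem IsCutoff.exists_xNorm_comparable {ψ : ℝ → ℝ} (h : IsCutoff ψ) (s b : ℝ) :
    ∃ C : ℝ≥0, ∀ (v : 𝓢'(SpaceTime, ℂ)) (G : SpaceTime → ℂ), IsFunction (𝓕 v) G →
      nrm volume (fun ζ => wt s b ζ * ‖G ζ‖ₑ) ≤ C * xNorm ψ s b v ∧
        xNorm ψ s b v ≤ C * nrm volume (fun ζ => wt s b ζ * ‖G ζ‖ₑ) := by
  obtain ⟨C, hC⟩ := h.exists_wt_comparable s b
  refine ⟨C + 1, fun v G hG => ⟨le_of_sq_le_mul_sq ?_, le_of_sq_le_mul_sq ?_⟩⟩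
  · rw [h.xNorm_sq_eq_lintegral s b hG, nrm_sq, ← lintegral_const_mul' _ _ ENNReal.coe_ne_top]
    refine lintegral_mono fun ζ => ?_
    rw [mul_pow, ← mul_assoc]
    exact mul_le_mul_left (hC ζ).1 _
  · rw [h.xNorm_sq_eq_lintegral s b hG, nrm_sq, ← lintegral_const_mul' _ _ ENNReal.coe_ne_top]
    refine lintegral_mono fun ζ => ?_
    rw [mul_pow, ← mul_assoc]
    exact mul_le_mul_left (hC ζ).2 _

theorem isFunction_fourier_distOfIntegrable {k : SpaceTime → ℂ} (hk : Integrable k) :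
    IsFunction (𝓕 (distOfIntegrable hk)) (𝓕 k) := by
  have hc := continuous_fourier_of_integrable hk
  refine ⟨hc.locallyIntegrable, fun φ => ⟨?_, ?_⟩⟩
  · exact φ.integrable.mul_bdd hc.aestronglyMeasurable (Filter.Eventually.of_forall fun ζ =>
      VectorFourier.norm_fourierIntegral_le_integral_norm _ _ _ _ ζ)
  · rw [TemperedDistribution.fourier_apply, distOfIntegrable_apply, integral_fourier_mul_eq hk]

theorem IsFunction.add {u v : 𝓢'(SpaceTime, ℂ)} {f g : SpaceTime → ℂ} (hf : IsFunction u f)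
    (hg : IsFunction v g) : IsFunction (u + v) fun z => f z + g z := by
  refine ⟨hf.1.add hg.1, fun φ => ?_⟩
  simp only [mul_add]
  refine ⟨(hf.2 φ).1.add (hg.2 φ).1, ?_⟩
  rw [integral_add (hf.2 φ).1 (hg.2 φ).1, ← (hf.2 φ).2, ← (hg.2 φ).2]
  rfl

theorem IsFunction.const_smul {u : 𝓢'(SpaceTime, ℂ)} {f : SpaceTime → ℂ} (hf : IsFunction u f)
    (c : ℂ) : IsFunction (c • u) fun z => c * f z := by
  refine ⟨hf.1.smul c, fun φ => ?_⟩
  simp only [mul_left_comm _ c]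
  refine ⟨(hf.2 φ).1.const_mul c, ?_⟩
  rw [integral_const_mul, ← (hf.2 φ).2]
  rfl

/-- On the Fourier side `∂_x + ∂_y` is the multiplication by `i (ξ + η)`. -/
theorem isFunction_fourier_dxAddDy {v : 𝓢'(SpaceTime, ℂ)} {G : SpaceTime → ℂ}
    (hG : IsFunction (𝓕 v) G) : IsFunction (𝓕 (dxAddDy v)) fun ζ =>
      (((freqX ζ + freqY ζ : ℝ) : ℂ) * Complex.I) * G ζ := by
  have h : ∀ i : Fin 3, IsFunction (𝓕 (lineDerivOp (EuclideanSpace.single i 1 : SpaceTime) v))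
      fun ζ => (2 * Real.pi * Complex.I) * (((ζ i : ℝ) : ℂ) * G ζ) := fun i => by
    rw [fourier_lineDerivOp_eq]
    have ht : (fun ζ : SpaceTime => ((inner ℝ ζ (EuclideanSpace.single i 1 : SpaceTime) : ℝ) : ℂ)) =
        fun ζ => ((ζ i : ℝ) : ℂ) := by
      funext ζ
      simp [EuclideanSpace.inner_single_right]
    have hg : Function.HasTemperateGrowth fun ζ : SpaceTime => ((ζ i : ℝ) : ℂ) :=
      Function.Complex.hasTemperateGrowth_ofReal.comp (temperate_coord i)
    simp only [ht]
    exact (hG.smulLeft hg).const_smul _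
  have h12 := (h 1).add (h 2)
  rw [dxAddDy, FourierTransform.fourier_add]
  convert h12 using 2 with ζ
  rw [freqX, freqY]
  push_cast
  ring

theorem enorm_derivSymbol_le (ζ : SpaceTime) :
    ‖((freqX ζ + freqY ζ : ℝ) : ℂ) * Complex.I‖ₑ ≤ 2 * wt 1 0 ζ := by
  have f2 := abs_left_le_freqSize (freqX ζ) (freqY ζ)
  have f3 := abs_right_le_freqSize (freqX ζ) (freqY ζ)
  rw [← ofReal_norm, norm_mul, Complex.norm_I, mul_one, Complex.norm_real, Real.norm_eq_abs, wt,
    ← ENNReal.ofReal_ofNat 2, ← ENNReal.ofReal_mul (by norm_num), Real.rpow_one, Real.rpow_zero,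
    mul_one]
  exact ENNReal.ofReal_le_ofReal ((abs_add_le _ _).trans (by linarith))

/-- The trilinear estimate for square integrable functions: the product is integrable, and the
`X^{s,b-1+ε}` norm of its derivative is bounded, with `b = 33 / 64` and `ε = 1 / 64`. -/
theorem IsCutoff.exists_xNorm_dxAddDy_le {ψ : ℝ → ℝ} (h : IsCutoff ψ) {s : ℝ} (hs : 1 / 4 ≤ s) :
    ∃ C : ℝ≥0, ∀ f₁ f₂ f₃ : Lp ℂ 2 (volume : Measure SpaceTime),
      (f₁ : 𝓢'(SpaceTime, ℂ)) ∈ xSpace ψ s (33 / 64) →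
      (f₂ : 𝓢'(SpaceTime, ℂ)) ∈ xSpace ψ s (33 / 64) →
      ∃ hk : Integrable (fun z : SpaceTime => f₁ z * f₂ z * f₃ z) volume,
        xNorm ψ s (-(15 / 32)) (dxAddDy (distOfIntegrable hk)) ≤
          C * (xNorm ψ s (33 / 64) (f₁ : 𝓢'(SpaceTime, ℂ)) *
            xNorm ψ s (33 / 64) (f₂ : 𝓢'(SpaceTime, ℂ)) *
              xNorm ψ s (33 / 64) (f₃ : 𝓢'(SpaceTime, ℂ))) := by
  -- `-(15 / 32) = 33 / 64 - 1 + 1 / 64` is the exponent `b - 1 + ε`.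
  obtain ⟨C₁, h₁⟩ := h.exists_xNorm_comparable s (33 / 64)
  obtain ⟨C₂, h₂⟩ := h.exists_xNorm_comparable s (-(15 / 32))
  obtain ⟨C₃, h₃⟩ := exists_nrm_cnv_le
  obtain ⟨C₄, h₄⟩ := exists_trilinear hs
  refine ⟨C₂ * (2 * (C₄ * (C₁ * C₁ * C₁))), fun f₁ f₂ f₃ m₁ m₂ => ?_⟩
  have hw : ∀ f : Lp ℂ 2 (volume : Measure SpaceTime),
      nrm volume (fun ζ => wt s (33 / 64) ζ * absFourier f ζ) ≤ C₁ * xNorm ψ s (33 / 64) f := by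
    intro f
    refine (h₁ f (𝓕 f : Lp ℂ 2 (volume : Measure SpaceTime)) ?_).1
    rw [Lp.fourier_toTemperedDistribution_eq]
    exact isFunction_lp_two _
  have hfin : nrm volume (cnv (absFourier f₁) (absFourier f₂)) < ⊤ := by
    refine (h₃ _ _ (measurable_absFourier _) (measurable_absFourier _)).trans_lt ?_
    refine ENNReal.mul_lt_top ENNReal.coe_lt_top (ENNReal.mul_lt_top ?_ ?_)
    · exact ((nrm_wt_mono hs le_rfl _).trans (hw f₁)).trans_lt
        (ENNReal.mul_lt_top ENNReal.coe_lt_top m₁)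
    · exact ((nrm_wt_mono (by linarith) (by norm_num) _).trans (hw f₂)).trans_lt
        (ENNReal.mul_lt_top ENNReal.coe_lt_top m₂)
  obtain ⟨hk, hK⟩ := enorm_fourier_mul_mul_le (h := f₃) hfin
  refine ⟨hk, ?_⟩
  set k : SpaceTime → ℂ := fun z => f₁ z * f₂ z * f₃ z with hkdef
  set T : SpaceTime → ℝ≥0∞ := cnv (cnv (absFourier f₁) (absFourier f₂)) (absFourier f₃) with hT
  have hTm : Measurable T := measurable_cnv (measurable_cnv (measurable_absFourier _)
    (measurable_absFourier _)) (measurable_absFourier _)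
  have hwm := measurable_wt (s + 1) (-(15 / 32))
  calc xNorm ψ s (-(15 / 32)) (dxAddDy (distOfIntegrable hk))
      ≤ C₂ * nrm volume (fun ζ => wt s (-(15 / 32)) ζ *
          ‖(((freqX ζ + freqY ζ : ℝ) : ℂ) * Complex.I) * 𝓕 k ζ‖ₑ) :=
        (h₂ _ _ (isFunction_fourier_dxAddDy (isFunction_fourier_distOfIntegrable hk))).2
    _ ≤ C₂ * nrm volume (fun ζ => 2 * (wt (s + 1) (-(15 / 32)) ζ * T ζ)) := by
        refine mul_le_mul_right (nrm_mono fun ζ => ?_) _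
        rw [enorm_mul]
        calc wt s (-(15 / 32)) ζ * (‖((freqX ζ + freqY ζ : ℝ) : ℂ) * Complex.I‖ₑ * ‖𝓕 k ζ‖ₑ)
            ≤ wt s (-(15 / 32)) ζ * ((2 * wt 1 0 ζ) * T ζ) :=
              mul_le_mul_right (mul_le_mul' (enorm_derivSymbol_le ζ) (hK ζ)) _
          _ = 2 * ((wt s (-(15 / 32)) ζ * wt 1 0 ζ) * T ζ) := by ring
          _ = _ := by rw [wt_mul_wt, add_zero]
    _ = C₂ * (2 * nrm volume (fun ζ => wt (s + 1) (-(15 / 32)) ζ * T ζ)) := by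
        rw [nrm_const_mul _ (by fun_prop)]
    _ ≤ C₂ * (2 * (C₄ * ((C₁ * xNorm ψ s (33 / 64) f₁) * (C₁ * xNorm ψ s (33 / 64) f₂) *
          (C₁ * xNorm ψ s (33 / 64) f₃)))) := by
        refine mul_le_mul_right (mul_le_mul_right ((h₄ _ _ _ (measurable_absFourier _)
          (measurable_absFourier _) (measurable_absFourier _)).trans ?_) _) _
        exact mul_le_mul_right (mul_le_mul' (mul_le_mul' (hw f₁) (hw f₂)) (hw f₃)) _
    _ = _ := by push_cast; ring

end MZK

end

theorem theorem3p1 (ψ : ℝ → ℝ) (hψ : MZK.IsCutoff ψ) (s : ℝ) (hs : 1 / 4 ≤ s) :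
    ∃ b ∈ Set.Ioo (1 / 2 : ℝ) 1, ∃ ε : ℝ, 0 < ε ∧ ∃ C : ℝ, 0 < C ∧
      ∀ u₁ ∈ MZK.xSpace ψ s b, ∀ u₂ ∈ MZK.xSpace ψ s b, ∀ u₃ ∈ MZK.xSpace ψ s b,
        ∃ w : 𝓢'(MZK.SpaceTime, ℂ), MZK.IsProduct u₁ u₂ u₃ w ∧
          MZK.xNorm ψ s (b - 1 + ε) (MZK.dxAddDy w) ≤
            ENNReal.ofReal C *
              (MZK.xNorm ψ s b u₁ * MZK.xNorm ψ s b u₂ * MZK.xNorm ψ s b u₃) := by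
  obtain ⟨C, hC⟩ := hψ.exists_xNorm_dxAddDy_le hs
  refine ⟨33 / 64, ⟨by norm_num, by norm_num⟩, 1 / 64, by norm_num, C + 1, by positivity,
    fun u₁ m₁ u₂ m₂ u₃ m₃ => ?_⟩
  obtain ⟨f₁, rfl⟩ := hψ.exists_lp_of_mem_xSpace (by linarith) (by norm_num) m₁
  obtain ⟨f₂, rfl⟩ := hψ.exists_lp_of_mem_xSpace (by linarith) (by norm_num) m₂
  obtain ⟨f₃, rfl⟩ := hψ.exists_lp_of_mem_xSpace (by linarith) (by norm_num) m₃
  obtain ⟨hk, hle⟩ := hC f₁ f₂ f₃ m₁ m₂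
  refine ⟨MZK.distOfIntegrable hk, ⟨f₁, f₂, f₃, MZK.isFunction_lp_two f₁, MZK.isFunction_lp_two f₂,
    MZK.isFunction_lp_two f₃, MZK.isFunction_distOfIntegrable hk⟩, ?_⟩
  rw [show (33 / 64 - 1 + 1 / 64 : ℝ) = -(15 / 32) by norm_num]
  refine hle.trans (mul_le_mul_left ?_ _)
  rw [← ENNReal.ofReal_coe_nnreal]
  exact ENNReal.ofReal_le_ofReal (by linarith)
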